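/- Varieties are integral separated schemes of finite type over $\mathbb{C}$. Let $S$ be either the point $\operatorname{Spec}\mathbb{C}$ or a smooth curve over $\mathbb{C}$, let $q:\mathcal{W}\to S$ be a smooth dominant morphism of varieties, and let $i:\mathcal{X}\hookrightarrow\mathcal{W}$ be a closed subvariety of codimension $1$ that is flat over $S$. Let $T^\vee(\mathcal{W}/S)=\operatorname{Spec}_{\mathcal{W}}\operatorname{Sym}T_{\mathcal{W}/S}$ be the relative cotangent bundle and $\pi:\mathbb{P}T^\vee(\mathcal{W}/S)=\operatorname{Proj}_{\mathcal{W}}\operatorname{Sym}T_{\mathcal{W}/S}\to\mathcal{W}$ the bundle of lines in it. Let $\operatorname{Sm}(\mathcal{X}/S)\subset\mathcal{X}$ be the open locus where $\mathcal{X}\to S$ is smooth. The relative conormal variety is the closure $$\Lambda_{\mathcal{X}/S}=\overline{\{(x,\xi)\in T^\vee(\mathcal{W}/S)\;|\;x\in\operatorname{Sm}(\mathcal{X}/S),\ \xi\perp T_x\mathcal{X}_{q(x)}\}}\subset T^\vee(\mathcal{W}/S),$$ and $\mathbb{P}\Lambda_{\mathcal{X}/S}\subset\mathbb{P}T^\vee(\mathcal{W}/S)$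 is the image of $\Lambda_{\mathcal{X}/S}$ minus the zero section, with its reduced closed subscheme structure. The relative singular scheme $\operatorname{Sing}(\mathcal{X}/S)\subset\mathcal{X}$ is the closed subscheme given locally by $V(F,\partial_1F,\dots,\partial_nF)$, where $F$ is a local equation of $\mathcal{X}$ in $\mathcal{W}$ and $\partial_1,\dots,\partial_n$ generate the relative tangent sheaf $T_{\mathcal{W}/S}$. Then the restriction of $\pi$ to $\mathbb{P}\Lambda_{\mathcal{X}/S}$ factors through a morphism $p:\mathbb{P}\Lambda_{\mathcal{X}/S}\to\mathcal{X}$, and $p$ is the blowup of $\mathcal{X}$ along $\operatorname{Sing}(\mathcal{X}/S)$; that is, the inverse image ideal of $\operatorname{Sing}(\mathcal{X}/S)$ under $p$ is invertible and $p$ is universal among morphisms to $\mathcal{X}$ with this property. Equivalently, there is a unique isomorphism $\mathbb{P}\Lambda_{\mathcal{X}/S}\cong\operatorname{Bl}_{\operatorname{Sing}(\mathcal{X}/S)}\mathcal{X}$ of schemes over $\mathcal{X}$. -/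

import Mathlib

open CategoryTheory CategoryTheory.Limits AlgebraicGeometry TensorProduct HomogeneousLocalization

universe u
noncomputable section

namespace RelConormal

/-! ### The scheme `Proj (Sym T)` of an `A`-module `T` and its base change -/

namespace SymProj
variable (A : Type u) [CommRing A] (T : Type u) [AddCommGroup T] [Module A T]

/-- The grading of `Sym_A T`: the degree `n` part is spanned by products of `n` elements of `T`. -/
def grading (n : ℕ) : Submodule A (SymmetricAlgebra A T) :=
  LinearMap.range (SymmetricAlgebra.ι A T) ^ n

variable {A T} in
theorem ι_mem (t : T) : SymmetricAlgebra.ι A T t ∈ grading A T 1 := by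
  simp [grading]

instance : SetLike.GradedMonoid (grading A T) :=
  inferInstanceAs (SetLike.GradedMonoid ((LinearMap.range (SymmetricAlgebra.ι A T) ^ ·)))

/-- The inclusion of `T` as the degree one part. -/
def gι : T →ₗ[A] DirectSum ℕ fun i => grading A T i :=
  DirectSum.lof A ℕ (fun i => grading A T i) 1 ∘ₗ
    (SymmetricAlgebra.ι A T).codRestrict _ ι_mem

instance : GradedAlgebra (grading A T) :=
  GradedAlgebra.ofAlgHom _ (SymmetricAlgebra.lift (gι A T))
    (by
      apply SymmetricAlgebra.algHom_ext
      ext m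
      simp [gι, DirectSum.lof_eq_of, DirectSum.coeAlgHom_of])
    fun i x => by
      obtain ⟨x, hx⟩ := x
      unfold grading at hx
      induction hx using Submodule.pow_induction_on_left' with
      | algebraMap r => rw [AlgHom.commutes, DirectSum.algebraMap_apply]; rfl
      | add x y i hx hy ihx ihy => simp only [map_add, ihx, ihy]; rw [← map_add]; rfl
      | mem_mul m hm i x hx ih =>
        obtain ⟨m, rfl⟩ := hm
        simp only [map_mul, ih, SymmetricAlgebra.lift_ι_apply]
        simp only [gι, LinearMap.comp_apply, DirectSum.lof_eq_of, DirectSum.of_mul_of]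
        exact DirectSum.of_eq_of_gradedMonoid_eq (Sigma.subtype_ext (add_comm _ _) rfl)

variable {A T}
variable {A' : Type u} [CommRing A'] [Algebra A A'] {T' : Type u} [AddCommGroup T'] [Module A' T']
  [Module A T'] [IsScalarTower A A' T']

/-- The ring map `Sym_A T → Sym_A' T'` induced by a linear map `T → T'` over `A → A'`. -/
def map (φ : T →ₗ[A] T') : SymmetricAlgebra A T →ₐ[A] SymmetricAlgebra A' T' :=
  SymmetricAlgebra.lift ((SymmetricAlgebra.ι A' T').restrictScalars A ∘ₗ φ)

@[simp] theorem map_ι (φ : T →ₗ[A] T') (t : T) :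
    map φ (SymmetricAlgebra.ι A T t) = SymmetricAlgebra.ι A' T' (φ t) := by
  simp [map]

theorem map_mem (φ : T →ₗ[A] T') {n : ℕ} {x : SymmetricAlgebra A T} (hx : x ∈ grading A T n) :
    map φ x ∈ grading A' T' n := by
  unfold grading at hx
  induction hx using Submodule.pow_induction_on_left' with
  | algebraMap r =>
    rw [AlgHom.commutes, IsScalarTower.algebraMap_apply A A']
    exact SetLike.algebraMap_mem_graded (grading A' T') _
  | add x y i hx hy ihx ihy => rw [map_add]; exact add_mem ihx ihy
  | mem_mul m hm i x hx ih =>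
    obtain ⟨m, rfl⟩ := hm
    rw [map_mul, map_ι, Nat.succ_eq_add_one, add_comm]
    exact SetLike.GradedMul.mul_mem (ι_mem _) ih

/-- `map` as a homomorphism of graded rings. -/
def gmap (φ : T →ₗ[A] T') : grading A T →+*ᵍ grading A' T' where
  toRingHom := (map (A' := A') φ).toRingHom
  map_mem := map_mem φ

theorem gmap_mem (φ : T →ₗ[A] T') {n : ℕ} {x : SymmetricAlgebra A T} (hx : x ∈ grading A T n) :
    gmap (A' := A') φ x ∈ grading A' T' n := map_mem φ hx

@[simp] theorem gmap_ι (φ : T →ₗ[A] T') (t : T) :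
    gmap (A' := A') φ (SymmetricAlgebra.ι A T t) = SymmetricAlgebra.ι A' T' (φ t) := map_ι φ t

@[simp] theorem gmap_algebraMap (φ : T →ₗ[A] T') (a : A) :
    gmap (A' := A') φ (algebraMap A _ a) = algebraMap A' _ (algebraMap A A' a) :=
  ((map (A' := A') φ).commutes a).trans (IsScalarTower.algebraMap_apply A A' _ a)

theorem ringHom_ext {B : Type*} [CommRing B] {f g : SymmetricAlgebra A T →+* B}
    (h₁ : ∀ a, f (algebraMap A _ a) = g (algebraMap A _ a))
    (h₂ : ∀ t, f (SymmetricAlgebra.ι A T t) = g (SymmetricAlgebra.ι A T t)) : f = g := by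
  refine RingHom.ext fun x => ?_
  induction x using SymmetricAlgebra.induction with
  | algebraMap r => exact h₁ r
  | ι x => exact h₂ x
  | mul a b ha hb => simp [ha, hb]
  | add a b ha hb => simp [ha, hb]

theorem irrelevant_le_span :
    (HomogeneousIdeal.irrelevant (grading A T)).toIdeal ≤
      Ideal.span (Set.range (SymmetricAlgebra.ι A T)) := by
  rw [HomogeneousIdeal.toIdeal_irrelevant_le]
  intro i hi x hx
  obtain ⟨i, rfl⟩ := Nat.exists_eq_succ_of_ne_zero hi.ne'
  replace hx : x ∈ LinearMap.range (SymmetricAlgebra.ι A T) ^ (i + 1) := hx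
  rw [pow_succ] at hx
  induction hx using Submodule.mul_induction_on' with
  | mem_mul_mem m _ n hn => exact Ideal.mul_mem_left _ _ (Ideal.subset_span hn)
  | add x _ y _ hx hy => exact add_mem hx hy

theorem irrelevant_le_map {φ : T →ₗ[A] T'} (hφ : IsBaseChange A' φ) :
    HomogeneousIdeal.irrelevant (grading A' T') ≤
      (HomogeneousIdeal.irrelevant (grading A T)).map (gmap φ) := by
  change HomogeneousIdeal.toIdeal _ ≤ HomogeneousIdeal.toIdeal _
  refine irrelevant_le_span.trans (Ideal.span_le.mpr ?_)
  rintro _ ⟨t, rfl⟩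
  simp only [HomogeneousIdeal.toIdeal_map, SetLike.mem_coe]
  induction t using hφ.inductionOn with
  | zero => simp
  | tmul t =>
    rw [← gmap_ι]
    refine Ideal.mem_map_of_mem _ ?_
    exact HomogeneousIdeal.mem_irrelevant_of_mem _ one_pos (ι_mem t)
  | smul a t h => rw [map_smul, Algebra.smul_def]; exact Ideal.mul_mem_left _ _ h
  | add x y hx hy => rw [map_add]; exact add_mem hx hy

variable (A T) in
/-- The structure map of `A` into the degree zero part. -/
def toZero : A →+* grading A T 0 where
  toFun a := ⟨algebraMap A _ a, SetLike.algebraMap_mem_graded _ _⟩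
  map_one' := by ext; simp
  map_mul' _ _ := by ext; simp
  map_zero' := by ext; simp
  map_add' _ _ := by ext; simp

variable (A T) in
/-- The structure morphism `Proj (Sym_A T) ⟶ Spec A`. -/
def toSpec : Proj (grading A T) ⟶ Spec (.of A) :=
  Proj.toSpecZero (grading A T) ≫ Spec.map (CommRingCat.ofHom (toZero A T))

variable (T) in
/-- The structure map of `A` into the coordinate ring of the basic open `D₊(s)`. -/
def toAway (s : SymmetricAlgebra A T) : A →+* Away (grading A T) s :=
  (fromZeroRingHom (grading A T) _).comp (toZero A T)

/-- The function `x / s` on `D₊(s)`, for `x ∈ T` and `s` of degree one. -/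
def frac {s : SymmetricAlgebra A T} (hs : s ∈ grading A T 1) (x : T) : Away (grading A T) s :=
  Away.mk _ hs 1 (SymmetricAlgebra.ι A T x) (by simpa using ι_mem x)

theorem away_mk_add {s : SymmetricAlgebra A T} (hs : s ∈ grading A T 1) (n : ℕ)
    {x y : SymmetricAlgebra A T} (hx : x ∈ grading A T (n • 1)) (hy : y ∈ grading A T (n • 1)) :
    Away.mk (grading A T) hs n (x + y) (add_mem hx hy) =
      Away.mk (grading A T) hs n x hx + Away.mk (grading A T) hs n y hy := by
  ext
  rw [val_add, Away.val_mk, Away.val_mk, Away.val_mk, Localization.add_mk_self]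

theorem away_mk_succ {s : SymmetricAlgebra A T} (hs : s ∈ grading A T 1) (m : T) (n : ℕ)
    {x : SymmetricAlgebra A T} (hx : x ∈ grading A T (n • 1))
    (h : SymmetricAlgebra.ι A T m * x ∈ grading A T ((n + 1) • 1)) :
    Away.mk (grading A T) hs (n + 1) (SymmetricAlgebra.ι A T m * x) h =
      frac hs m * Away.mk (grading A T) hs n x hx := by
  ext
  rw [val_mul, frac, Away.val_mk, Away.val_mk, Away.val_mk, Localization.mk_mul]
  congr 1
  ext
  simp only [pow_one, Submonoid.coe_mul]
  exact pow_succ' _ n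

theorem away_ext {B : Type*} [CommRing B] {s : SymmetricAlgebra A T} (hs : s ∈ grading A T 1)
    {f g : Away (grading A T) s →+* B}
    (h₁ : ∀ a, f (toAway T s a) = g (toAway T s a)) (h₂ : ∀ x, f (frac hs x) = g (frac hs x)) :
    f = g := by
  refine RingHom.ext fun z => ?_
  obtain ⟨n, x, hx, rfl⟩ := Away.mk_surjective _ hs z
  have hx' : x ∈ LinearMap.range (SymmetricAlgebra.ι A T) ^ n := by
    rw [smul_eq_mul, mul_one] at hx
    exact hx
  induction hx' using Submodule.pow_induction_on_left' with
  | algebraMap r =>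
    have : Away.mk (grading A T) hs 0 _ hx = toAway T s r := by
      ext
      rw [Away.val_mk]
      simp only [pow_zero]
      rfl
    rw [this, h₁]
  | add x y i hx1 hy1 ihx ihy =>
    have hx2 : x ∈ grading A T (i • 1) := by rw [smul_eq_mul, mul_one]; exact hx1
    have hy2 : y ∈ grading A T (i • 1) := by rw [smul_eq_mul, mul_one]; exact hy1
    rw [away_mk_add hs i hx2 hy2, map_add, map_add, ihx, ihy]
  | mem_mul m hm i x hx1 ih =>
    obtain ⟨m, rfl⟩ := hm
    have hx2 : x ∈ grading A T (i • 1) := by rw [smul_eq_mul, mul_one]; exact hx1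
    rw [away_mk_succ hs m i hx2, map_mul, map_mul, ih, h₂]

/-- A linear map `T → B` with `s ↦ 1` induces a ring map on functions of `D₊(s)`. -/
def awayLift {B : Type*} [CommRing B] [Algebra A B] {s : SymmetricAlgebra A T} (φ : T →ₗ[A] B)
    (h : SymmetricAlgebra.lift φ s = 1) : Away (grading A T) s →+* B :=
  (Localization.awayLift (SymmetricAlgebra.lift φ).toRingHom s (by simp [h])).comp
    (algebraMap (Away (grading A T) s) (Localization.Away _))

theorem awayLift_toAway {B : Type*} [CommRing B] [Algebra A B] {s : SymmetricAlgebra A T}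
    (φ : T →ₗ[A] B) (h : SymmetricAlgebra.lift φ s = 1) (a : A) :
    awayLift φ h (toAway T s a) = algebraMap A B a := by
  have : (toAway T s a).val = algebraMap _ _ (algebraMap A (SymmetricAlgebra A T) a) := by
    rw [← Localization.mk_one_eq_algebraMap]; rfl
  simp [awayLift, this, Localization.awayLift]

theorem awayLift_frac {B : Type*} [CommRing B] [Algebra A B] {s : SymmetricAlgebra A T}
    (hs : s ∈ grading A T 1) (φ : T →ₗ[A] B) (h : SymmetricAlgebra.lift φ s = 1) (x : T) :
    awayLift φ h (frac hs x) = φ x := by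
  have hu : IsUnit ((SymmetricAlgebra.lift φ).toRingHom s) := by simp [h]
  have key : (frac hs x).val * algebraMap _ _ s = algebraMap _ _ (SymmetricAlgebra.ι A T x) := by
    rw [frac, Away.val_mk, ← Localization.mk_one_eq_algebraMap, ← Localization.mk_one_eq_algebraMap,
      Localization.mk_mul, Localization.mk_eq_mk_iff, Localization.r_iff_exists]
    refine ⟨1, ?_⟩
    simp only [pow_one, mul_one, OneMemClass.coe_one, one_mul]
    exact CommMonoid.mul_comm _ _
  have := congrArg (Localization.awayLift (SymmetricAlgebra.lift φ).toRingHom s hu) key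
  rw [map_mul] at this
  simpa [awayLift, Localization.awayLift, h] using this

theorem frac_self {s : SymmetricAlgebra A T} (hs : s ∈ grading A T 1) {t : T}
    (h : SymmetricAlgebra.ι A T t = s) : frac hs t = 1 := by
  subst h
  ext
  rw [frac, Away.val_mk, val_one]
  simp only [pow_one]
  exact Localization.mk_self (⟨_, _⟩ : Submonoid.powers _)

theorem frac_add {s : SymmetricAlgebra A T} (hs : s ∈ grading A T 1) (x y : T) :
    frac hs (x + y) = frac hs x + frac hs y := by
  ext
  rw [val_add, frac, frac, frac, Away.val_mk, Away.val_mk, Away.val_mk, Localization.add_mk_self,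
    map_add]

theorem frac_smul {s : SymmetricAlgebra A T} (hs : s ∈ grading A T 1) (a : A) (x : T) :
    frac hs (a • x) = toAway T s a * frac hs x := by
  have : (toAway T s a).val = algebraMap _ _ (algebraMap A (SymmetricAlgebra A T) a) := by
    rw [← Localization.mk_one_eq_algebraMap]; rfl
  ext
  rw [val_mul, this, frac, frac, Away.val_mk, Away.val_mk, map_smul, Algebra.smul_def,
    ← Localization.mk_one_eq_algebraMap, Localization.mk_mul, one_mul]

theorem isPushout_of_univ {R S R' S' : Type u} [CommRing R] [CommRing S] [CommRing R'] [CommRing S']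
    {f : R →+* S} {g : R →+* R'} {k : S →+* S'} {l : R' →+* S'} (w : k.comp f = l.comp g)
    (H : ∀ (B : Type u) [CommRing B] (α : S →+* B) (β : R' →+* B), α.comp f = β.comp g →
      ∃ γ : S' →+* B, γ.comp k = α ∧ γ.comp l = β)
    (H' : ∀ (B : Type u) [CommRing B] (γ γ' : S' →+* B), γ.comp k = γ'.comp k →
      γ.comp l = γ'.comp l → γ = γ') :
    IsPushout (CommRingCat.ofHom f) (CommRingCat.ofHom g) (CommRingCat.ofHom k)
      (CommRingCat.ofHom l) := by
  have hw : CommRingCat.ofHom f ≫ CommRingCat.ofHom k = CommRingCat.ofHom g ≫ CommRingCat.ofHom l :=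
    CommRingCat.hom_ext w
  have E (s : PushoutCocone (CommRingCat.ofHom f) (CommRingCat.ofHom g)) :=
    H s.pt s.inl.hom s.inr.hom congr(($s.condition).hom)
  refine ⟨⟨hw⟩, ⟨PushoutCocone.IsColimit.mk hw (fun s => CommRingCat.ofHom (E s).choose)
    (fun s => CommRingCat.hom_ext (E s).choose_spec.1)
    (fun s => CommRingCat.hom_ext (E s).choose_spec.2) fun s m h₁ h₂ => CommRingCat.hom_ext ?_⟩⟩
  exact H' _ _ _ (congr(($h₁).hom).trans (E s).choose_spec.1.symm)
    (congr(($h₂).hom).trans (E s).choose_spec.2.symm)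

theorem isPushout_sym {φ : T →ₗ[A] T'} (hφ : IsBaseChange A' φ) :
    IsPushout (CommRingCat.ofHom (algebraMap A (SymmetricAlgebra A T)))
      (CommRingCat.ofHom (algebraMap A A'))
      (CommRingCat.ofHom (gmap (A' := A') φ).toRingHom)
      (CommRingCat.ofHom (algebraMap A' (SymmetricAlgebra A' T'))) := by
  refine isPushout_of_univ ?_ ?_ ?_
  · ext a
    exact gmap_algebraMap φ a
  · intro B _ α β h
    let : Algebra A' B := β.toAlgebra
    let : Algebra A B := (β.comp (algebraMap A A')).toAlgebra
    have : IsScalarTower A A' B := .of_algebraMap_eq' rfl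
    let αₐ : SymmetricAlgebra A T →ₐ[A] B := { α with commutes' := fun a => congr($h a) }
    let ψ := hφ.lift (αₐ.toLinearMap ∘ₗ SymmetricAlgebra.ι A T)
    refine ⟨(SymmetricAlgebra.lift ψ).toRingHom, ringHom_ext (fun a => ?_) fun t => ?_, ?_⟩
    · have := (SymmetricAlgebra.lift ψ).commutes (algebraMap A A' a)
      refine (congrArg (SymmetricAlgebra.lift ψ) (gmap_algebraMap φ a)).trans (this.trans ?_)
      exact congr($h a).symm
    · refine (congrArg (SymmetricAlgebra.lift ψ) (gmap_ι φ t)).trans ?_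
      simp [ψ, hφ.lift_eq]
      rfl
    · ext a
      exact (SymmetricAlgebra.lift ψ).commutes a
  · intro B _ γ γ' h₁ h₂
    refine ringHom_ext (fun a => congr($h₂ a)) fun t => ?_
    induction t using hφ.inductionOn with
    | zero => simp
    | tmul t => 
      have := congr($h₁ (SymmetricAlgebra.ι A T t))
      simpa using this
    | smul a t h =>
      have := congr($h₂ a)
      simp only [RingHom.comp_apply] at this
      rw [map_smul, Algebra.smul_def, map_mul, map_mul, h, this]
    | add x y hx hy => rw [map_add, map_add, map_add, hx, hy]

theorem awayMap_toAway (φ : T →ₗ[A] T') (s : SymmetricAlgebra A T) (a : A) :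
    Away.map (gmap (A' := A') φ) s (toAway T s a) = toAway T' _ (algebraMap A A' a) := by
  change HomogeneousLocalization.map _ _ (HomogeneousLocalization.mk _) =
    HomogeneousLocalization.mk _
  rw [map_mk]
  ext
  rw [val_mk, val_mk]
  simp [toZero]

theorem awayMap_frac (φ : T →ₗ[A] T') {s : SymmetricAlgebra A T} (hs : s ∈ grading A T 1) (x : T) :
    Away.map (gmap (A' := A') φ) s (frac hs x) = frac (gmap_mem φ hs) (φ x) := by
  ext
  rw [frac, Away.map_mk, frac, Away.val_mk, Away.val_mk, gmap_ι]

theorem isPushout_away {φ : T →ₗ[A] T'} (hφ : IsBaseChange A' φ) (t : T) :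
    IsPushout (CommRingCat.ofHom (toAway T (SymmetricAlgebra.ι A T t)))
      (CommRingCat.ofHom (algebraMap A A'))
      (CommRingCat.ofHom (Away.map (gmap (A' := A') φ) (SymmetricAlgebra.ι A T t)))
      (CommRingCat.ofHom (toAway T' (gmap (A' := A') φ (SymmetricAlgebra.ι A T t)))) := by
  have hs' := gmap_mem (A' := A') φ (ι_mem t)
  refine isPushout_of_univ ?_ ?_ ?_
  · ext a : 1
    exact awayMap_toAway φ _ a
  · intro B _ α β h
    let : Algebra A' B := β.toAlgebra
    let : Algebra A B := (β.comp (algebraMap A A')).toAlgebra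
    have : IsScalarTower A A' B := .of_algebraMap_eq' rfl
    let ψ₀ : T →ₗ[A] B :=
      { toFun x := α (frac (ι_mem t) x)
        map_add' x y := by rw [frac_add, map_add]
        map_smul' a x := by
          rw [frac_smul, map_mul, RingHom.id_apply, Algebra.smul_def]
          exact congrArg (· * _) congr($h a) }
    let ψ := hφ.lift ψ₀
    have h1 : SymmetricAlgebra.lift ψ (gmap (A' := A') φ (SymmetricAlgebra.ι A T t)) = 1 := by
      rw [gmap_ι, SymmetricAlgebra.lift_ι_apply, hφ.lift_eq]
      change α (frac (ι_mem t) t) = 1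
      rw [frac_self _ rfl, map_one]
    refine ⟨awayLift ψ h1, away_ext (ι_mem t) (fun a => ?_) fun x => ?_, ?_⟩
    · rw [RingHom.comp_apply, awayMap_toAway, awayLift_toAway]
      exact congr($h a).symm
    · rw [RingHom.comp_apply, awayMap_frac, awayLift_frac, hφ.lift_eq]
      rfl
    · ext a
      exact awayLift_toAway ψ h1 a
  · intro B _ γ γ' h₁ h₂
    refine away_ext hs' (fun a => congr($h₂ a)) fun t => ?_
    induction t using hφ.inductionOn with
    | zero =>
      have : frac hs' (0 : T') = 0 := by
        have := frac_add hs' 0 0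
        simpa using this
      rw [this, map_zero, map_zero]
    | tmul x =>
      have := congr($h₁ (frac (ι_mem t) x))
      rwa [RingHom.comp_apply, RingHom.comp_apply, awayMap_frac] at this
    | smul a x h =>
      have := congr($h₂ a)
      simp only [RingHom.comp_apply] at this
      rw [frac_smul, map_mul, map_mul, h, this]
    | add x y hx hy => rw [frac_add, map_add, map_add, hx, hy]

/-- Functoriality of `Proj (Sym T)` under base change. -/
def projMap {φ : T →ₗ[A] T'} (hφ : IsBaseChange A' φ) :
    Proj (grading A' T') ⟶ Proj (grading A T) :=
  Proj.map (gmap φ) (irrelevant_le_map hφ)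

theorem awayι_toSpec (s : SymmetricAlgebra A T) (hs : s ∈ grading A T 1) :
    Proj.awayι (grading A T) s hs one_pos ≫ toSpec A T =
      Spec.map (CommRingCat.ofHom (toAway T s)) := by
  rw [toSpec, Proj.awayι_toSpecZero_assoc, ← Spec.map_comp]
  rfl

variable (A T) in
/-- The affine cover of `Proj (Sym_A T)` by the `D₊(t)`, `t ∈ T`. -/
def cover : (Proj (grading A T)).AffineOpenCover :=
  Proj.affineOpenCoverOfIrrelevantLESpan (grading A T) (SymmetricAlgebra.ι A T) (m := fun _ => 1)
    ι_mem (fun _ => one_pos) irrelevant_le_span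

theorem isPullback_proj {φ : T →ₗ[A] T'} (hφ : IsBaseChange A' φ) :
    IsPullback (projMap hφ) (toSpec A' T') (toSpec A T)
      (Spec.map (CommRingCat.ofHom (algebraMap A A'))) := by
  refine Scheme.isPullback_of_openCover _ _ _ _ (cover A T).openCover fun (t : T) => ?_
  have h₁ : IsPullback (Spec.map (CommRingCat.ofHom (Away.map (gmap (A' := A') φ)
      (SymmetricAlgebra.ι A T t)))) 
      (Proj.awayι (grading A' T') _ (gmap_mem φ (ι_mem t)) one_pos)
      (Proj.awayι (grading A T) _ (ι_mem t) one_pos) (projMap hφ) := by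
    refine IsOpenImmersion.isPullback _ _ _ _ ?_ ?_
    · exact Proj.awayι_comp_map _ _ one_pos _ (ι_mem t)
    · rw [Proj.opensRange_awayι, Proj.opensRange_awayι]
      rfl
  have h₂ := isPullback_SpecMap_of_isPushout _ _ _ _ (isPushout_away hφ t)
  rw [← awayι_toSpec _ (ι_mem t), ← awayι_toSpec _ (gmap_mem φ (ι_mem t))] at h₂
  refine h₂.of_iso h₁.flip.isoPullback (Iso.refl _) (Iso.refl _) (Iso.refl _) ?_ ?_ ?_ ?_
  · exact (Category.comp_id _).trans h₁.flip.isoPullback_hom_snd.symm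
  · exact (Category.comp_id _).trans (h₁.flip.isoPullback_hom_fst_assoc _).symm
  · exact (Category.comp_id _).trans (Category.id_comp _).symm
  · simp

end SymProj

/-! ### Relative one-forms and relative vector fields on pairs of affine opens -/

theorem isBaseChange_kaehlerDifferential_map (R R' A A' : Type u) [CommRing R] [CommRing R']
    [CommRing A] [CommRing A'] [Algebra R R'] [Algebra R A] [Algebra R A'] [Algebra R' A']
    [Algebra A A'] [IsScalarTower R A A'] [IsScalarTower R R' A']
    [Algebra.FormallyEtale A A'] [Algebra.FormallyUnramified R R'] :
    IsBaseChange A' (KaehlerDifferential.map R R' A A') := by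
  have h : Function.Bijective (KaehlerDifferential.map R R' A' A') := by
    refine ⟨?_, KaehlerDifferential.map_surjective R R' A'⟩
    rw [injective_iff_map_eq_zero]
    intro x hx
    obtain ⟨x, rfl⟩ := (KaehlerDifferential.exact_mapBaseChange_map R R' A' x).mp hx
    rw [Subsingleton.elim x 0, map_zero]
  have h' := (KaehlerDifferential.isBaseChange_of_formallyEtale R A A').comp
    (IsBaseChange.ofEquiv (LinearEquiv.ofBijective _ h))
  convert h'
  refine Derivation.liftKaehlerDifferential_unique _ _ ?_
  ext x
  simp

section
variable (R R' A A' : Type u) [CommRing R] [CommRing R']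
    [CommRing A] [CommRing A'] [Algebra R R'] [Algebra R A] [Algebra R A'] [Algebra R' A']
    [Algebra A A'] [IsScalarTower R A A'] [IsScalarTower R R' A']
    [Algebra.FormallyEtale A A'] [Algebra.FormallyUnramified R R']

/-- The restriction of relative vector fields (linear forms on one-forms) along `A → A'`. -/
def vfMap : Module.Dual A Ω[A⁄R] →ₗ[A] Module.Dual A' Ω[A'⁄R'] :=
  (isBaseChange_kaehlerDifferential_map R R' A A').toDual

theorem vfMap_D (t : Module.Dual A Ω[A⁄R]) (x : A) :
    vfMap R R' A A' t (KaehlerDifferential.D R' A' (algebraMap A A' x)) =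
      algebraMap A A' (t (KaehlerDifferential.D R A x)) := by
  rw [← IsBaseChange.toDual_comp_apply (isBaseChange_kaehlerDifferential_map R R' A A'),
    KaehlerDifferential.map_D]
  rfl

theorem isBaseChange_vfMap [Module.Free A Ω[A⁄R]] [Module.Finite A Ω[A⁄R]] :
    IsBaseChange A' (vfMap R R' A A') :=
  (isBaseChange_kaehlerDifferential_map R R' A A').dual

end

theorem formallyEtale_res {X : Scheme.{u}} {U V : X.Opens} (hU : IsAffineOpen U)
    (hV : IsAffineOpen V) (h : U ≤ V) :
    (X.presheaf.map (homOfLE h).op).hom.FormallyEtale := by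
  have h' : Scheme.Hom.appLE (𝟙 X) V U h = X.presheaf.map (homOfLE h).op := by
    simp [Scheme.Hom.appLE]
    rfl
  exact h' ▸ (Scheme.Hom.etale_appLE (𝟙 X) hV hU h).formallyEtale

variable {W S : Scheme.{u}}

/-- Affine opens `U ⊆ W` and `V ⊆ S` such that `q` maps `U` into `V`. -/
structure AffinePair (q : W ⟶ S) where
  V : S.Opens
  isAffineOpen_V : IsAffineOpen V
  U : W.Opens
  isAffineOpen_U : IsAffineOpen U
  le : U ≤ q ⁻¹ᵁ V

namespace AffinePair
variable {q : W ⟶ S}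

instance (c : AffinePair q) : Algebra Γ(S, c.V) Γ(W, c.U) := (q.appLE c.V c.U c.le).hom.toAlgebra

/-- The module of relative one-forms on `U`. -/
abbrev Cotangent (c : AffinePair q) : Type u := Ω[Γ(W, c.U)⁄Γ(S, c.V)]

/-- The module of relative vector fields on `U`, the dual of the relative one-forms. -/
abbrev Tangent (c : AffinePair q) : Type u := Module.Dual Γ(W, c.U) c.Cotangent

instance : Preorder (AffinePair q) where
  le c d := c.V ≤ d.V ∧ c.U ≤ d.U
  le_refl c := ⟨le_rfl, le_rfl⟩
  le_trans _ _ _ h₁ h₂ := ⟨h₁.1.trans h₂.1, h₁.2.trans h₂.2⟩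

variable {c d : AffinePair q}

theorem isScalarTower_left (h : c ≤ d) :
    letI := (W.presheaf.map (homOfLE h.2).op).hom.toAlgebra
    letI := (q.appLE d.V c.U (h.2.trans d.le)).hom.toAlgebra
    IsScalarTower Γ(S, d.V) Γ(W, d.U) Γ(W, c.U) := by
  let := (W.presheaf.map (homOfLE h.2).op).hom.toAlgebra
  let := (q.appLE d.V c.U (h.2.trans d.le)).hom.toAlgebra
  refine .of_algebraMap_eq' ?_
  simp only [RingHom.algebraMap_toAlgebra, ← CommRingCat.hom_comp]
  rw [Scheme.Hom.appLE_map]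

theorem isScalarTower_right (h : c ≤ d) :
    letI := (S.presheaf.map (homOfLE h.1).op).hom.toAlgebra
    letI := (q.appLE d.V c.U (h.2.trans d.le)).hom.toAlgebra
    IsScalarTower Γ(S, d.V) Γ(S, c.V) Γ(W, c.U) := by
  let := (S.presheaf.map (homOfLE h.1).op).hom.toAlgebra
  let := (q.appLE d.V c.U (h.2.trans d.le)).hom.toAlgebra
  refine .of_algebraMap_eq' ?_
  simp only [RingHom.algebraMap_toAlgebra, ← CommRingCat.hom_comp]
  rw [Scheme.Hom.map_appLE]

open SymProj

/-- The graded ring `Sym (T_{W/S})` on `U`. -/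
abbrev symGrading (c : AffinePair q) := grading Γ(W, c.U) c.Tangent

/-- Restriction of relative vector fields to a smaller pair. -/
def res (h : c ≤ d) : d.Tangent →+ c.Tangent :=
  letI := (W.presheaf.map (homOfLE h.2).op).hom.toAlgebra
  letI := (S.presheaf.map (homOfLE h.1).op).hom.toAlgebra
  letI := (q.appLE d.V c.U (h.2.trans d.le)).hom.toAlgebra
  haveI := isScalarTower_left h
  haveI := isScalarTower_right h
  haveI : Algebra.FormallyEtale Γ(W, d.U) Γ(W, c.U) :=
    formallyEtale_res c.isAffineOpen_U d.isAffineOpen_U h.2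
  haveI : Algebra.FormallyEtale Γ(S, d.V) Γ(S, c.V) :=
    formallyEtale_res c.isAffineOpen_V d.isAffineOpen_V h.1
  (vfMap Γ(S, d.V) Γ(S, c.V) Γ(W, d.U) Γ(W, c.U)).toAddMonoidHom

/-- Restriction on symmetric algebras of relative vector fields. -/
def symRes (h : c ≤ d) : d.symGrading →+*ᵍ c.symGrading :=
  letI := (W.presheaf.map (homOfLE h.2).op).hom.toAlgebra
  letI := (S.presheaf.map (homOfLE h.1).op).hom.toAlgebra
  letI := (q.appLE d.V c.U (h.2.trans d.le)).hom.toAlgebra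
  haveI := isScalarTower_left h
  haveI := isScalarTower_right h
  haveI : Algebra.FormallyEtale Γ(W, d.U) Γ(W, c.U) :=
    formallyEtale_res c.isAffineOpen_U d.isAffineOpen_U h.2
  haveI : Algebra.FormallyEtale Γ(S, d.V) Γ(S, c.V) :=
    formallyEtale_res c.isAffineOpen_V d.isAffineOpen_V h.1
  gmap (vfMap Γ(S, d.V) Γ(S, c.V) Γ(W, d.U) Γ(W, c.U))

theorem res_D (h : c ≤ d) (t : d.Tangent) (x : Γ(W, d.U)) :
    res h t (KaehlerDifferential.D _ _ (W.presheaf.map (homOfLE h.2).op x)) =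
      W.presheaf.map (homOfLE h.2).op (t (KaehlerDifferential.D _ _ x)) := by
  let := (W.presheaf.map (homOfLE h.2).op).hom.toAlgebra
  let := (S.presheaf.map (homOfLE h.1).op).hom.toAlgebra
  let := (q.appLE d.V c.U (h.2.trans d.le)).hom.toAlgebra
  have := isScalarTower_left h
  have := isScalarTower_right h
  have : Algebra.FormallyEtale Γ(W, d.U) Γ(W, c.U) :=
    formallyEtale_res c.isAffineOpen_U d.isAffineOpen_U h.2
  have : Algebra.FormallyEtale Γ(S, d.V) Γ(S, c.V) :=
    formallyEtale_res c.isAffineOpen_V d.isAffineOpen_V h.1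
  exact vfMap_D Γ(S, d.V) Γ(S, c.V) Γ(W, d.U) Γ(W, c.U) t x

theorem symRes_algebraMap (h : c ≤ d) (x : Γ(W, d.U)) :
    symRes h (algebraMap _ _ x) = algebraMap _ _ (W.presheaf.map (homOfLE h.2).op x) := by
  let := (W.presheaf.map (homOfLE h.2).op).hom.toAlgebra
  let := (S.presheaf.map (homOfLE h.1).op).hom.toAlgebra
  let := (q.appLE d.V c.U (h.2.trans d.le)).hom.toAlgebra
  have := isScalarTower_left h
  have := isScalarTower_right h
  have : Algebra.FormallyEtale Γ(W, d.U) Γ(W, c.U) :=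
    formallyEtale_res c.isAffineOpen_U d.isAffineOpen_U h.2
  have : Algebra.FormallyEtale Γ(S, d.V) Γ(S, c.V) :=
    formallyEtale_res c.isAffineOpen_V d.isAffineOpen_V h.1
  exact gmap_algebraMap (vfMap Γ(S, d.V) Γ(S, c.V) Γ(W, d.U) Γ(W, c.U)) x

theorem symRes_ι (h : c ≤ d) (t : d.Tangent) :
    symRes h (SymmetricAlgebra.ι _ _ t) = SymmetricAlgebra.ι _ _ (res h t) := by
  let := (W.presheaf.map (homOfLE h.2).op).hom.toAlgebra
  let := (S.presheaf.map (homOfLE h.1).op).hom.toAlgebra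
  let := (q.appLE d.V c.U (h.2.trans d.le)).hom.toAlgebra
  have := isScalarTower_left h
  have := isScalarTower_right h
  have : Algebra.FormallyEtale Γ(W, d.U) Γ(W, c.U) :=
    formallyEtale_res c.isAffineOpen_U d.isAffineOpen_U h.2
  have : Algebra.FormallyEtale Γ(S, d.V) Γ(S, c.V) :=
    formallyEtale_res c.isAffineOpen_V d.isAffineOpen_V h.1
  exact gmap_ι (vfMap Γ(S, d.V) Γ(S, c.V) Γ(W, d.U) Γ(W, c.U)) t

theorem free_of_le (h : c ≤ d) (hd : Module.Free Γ(W, d.U) d.Cotangent) :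
    Module.Free Γ(W, c.U) c.Cotangent := by
  let := (W.presheaf.map (homOfLE h.2).op).hom.toAlgebra
  let := (S.presheaf.map (homOfLE h.1).op).hom.toAlgebra
  let := (q.appLE d.V c.U (h.2.trans d.le)).hom.toAlgebra
  have := isScalarTower_left h
  have := isScalarTower_right h
  have : Algebra.FormallyEtale Γ(W, d.U) Γ(W, c.U) :=
    formallyEtale_res c.isAffineOpen_U d.isAffineOpen_U h.2
  have : Algebra.FormallyEtale Γ(S, d.V) Γ(S, c.V) :=
    formallyEtale_res c.isAffineOpen_V d.isAffineOpen_V h.1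
  have hb := isBaseChange_kaehlerDifferential_map Γ(S, d.V) Γ(S, c.V) Γ(W, d.U) Γ(W, c.U)
  exact Module.Free.of_equiv hb.equiv

theorem finite_of_le (h : c ≤ d) (hd : Module.Finite Γ(W, d.U) d.Cotangent) :
    Module.Finite Γ(W, c.U) c.Cotangent := by
  let := (W.presheaf.map (homOfLE h.2).op).hom.toAlgebra
  let := (S.presheaf.map (homOfLE h.1).op).hom.toAlgebra
  let := (q.appLE d.V c.U (h.2.trans d.le)).hom.toAlgebra
  have := isScalarTower_left h
  have := isScalarTower_right h
  have : Algebra.FormallyEtale Γ(W, d.U) Γ(W, c.U) :=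
    formallyEtale_res c.isAffineOpen_U d.isAffineOpen_U h.2
  have : Algebra.FormallyEtale Γ(S, d.V) Γ(S, c.V) :=
    formallyEtale_res c.isAffineOpen_V d.isAffineOpen_V h.1
  have hb := isBaseChange_kaehlerDifferential_map Γ(S, d.V) Γ(S, c.V) Γ(W, d.U) Γ(W, c.U)
  exact Module.Finite.equiv hb.equiv

theorem free_and_finite (h : (q.appLE c.V c.U c.le).hom.IsStandardSmooth) :
    Module.Free Γ(W, c.U) c.Cotangent ∧ Module.Finite Γ(W, c.U) c.Cotangent := by
  have : Algebra.IsStandardSmooth Γ(S, c.V) Γ(W, c.U) := h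
  exact ⟨inferInstance, inferInstance⟩

theorem tangent_ext {s t : c.Tangent} (h : c ≤ d)
    (H : ∀ x, s (KaehlerDifferential.D _ _ (W.presheaf.map (homOfLE h.2).op x)) =
      t (KaehlerDifferential.D _ _ (W.presheaf.map (homOfLE h.2).op x))) : s = t := by
  let := (W.presheaf.map (homOfLE h.2).op).hom.toAlgebra
  let := (S.presheaf.map (homOfLE h.1).op).hom.toAlgebra
  let := (q.appLE d.V c.U (h.2.trans d.le)).hom.toAlgebra
  have := isScalarTower_left h
  have := isScalarTower_right h
  have : Algebra.FormallyEtale Γ(W, d.U) Γ(W, c.U) :=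
    formallyEtale_res c.isAffineOpen_U d.isAffineOpen_U h.2
  have : Algebra.FormallyEtale Γ(S, d.V) Γ(S, c.V) :=
    formallyEtale_res c.isAffineOpen_V d.isAffineOpen_V h.1
  have hb := isBaseChange_kaehlerDifferential_map Γ(S, d.V) Γ(S, c.V) Γ(W, d.U) Γ(W, c.U)
  refine hb.algHom_ext _ _ fun v => ?_
  have : (s.restrictScalars Γ(W, d.U) ∘ₗ
      KaehlerDifferential.map Γ(S, d.V) Γ(S, c.V) Γ(W, d.U) Γ(W, c.U)) =
    (t.restrictScalars Γ(W, d.U) ∘ₗ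
      KaehlerDifferential.map Γ(S, d.V) Γ(S, c.V) Γ(W, d.U) Γ(W, c.U)) := by
    refine Derivation.liftKaehlerDifferential_unique _ _ ?_
    ext x
    have e := KaehlerDifferential.map_D Γ(S, d.V) Γ(S, c.V) Γ(W, d.U) Γ(W, c.U) x
    exact (congrArg s e).trans ((H x).trans (congrArg t e).symm)
  exact congr($this v)

theorem symRes_irrelevant (h : c ≤ d) (h₁ : Module.Free Γ(W, d.U) d.Cotangent)
    (h₂ : Module.Finite Γ(W, d.U) d.Cotangent) :
    HomogeneousIdeal.irrelevant c.symGrading ≤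
      (HomogeneousIdeal.irrelevant d.symGrading).map (symRes h) := by
  let := (W.presheaf.map (homOfLE h.2).op).hom.toAlgebra
  let := (S.presheaf.map (homOfLE h.1).op).hom.toAlgebra
  let := (q.appLE d.V c.U (h.2.trans d.le)).hom.toAlgebra
  have := isScalarTower_left h
  have := isScalarTower_right h
  have : Algebra.FormallyEtale Γ(W, d.U) Γ(W, c.U) :=
    formallyEtale_res c.isAffineOpen_U d.isAffineOpen_U h.2
  have : Algebra.FormallyEtale Γ(S, d.V) Γ(S, c.V) :=
    formallyEtale_res c.isAffineOpen_V d.isAffineOpen_V h.1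
  exact irrelevant_le_map (isBaseChange_vfMap Γ(S, d.V) Γ(S, c.V) Γ(W, d.U) Γ(W, c.U))

theorem isPullback_projMap (h : c ≤ d) (h₁ : Module.Free Γ(W, d.U) d.Cotangent)
    (h₂ : Module.Finite Γ(W, d.U) d.Cotangent) :
    IsPullback (Proj.map (symRes h) (symRes_irrelevant h h₁ h₂)) (toSpec Γ(W, c.U) c.Tangent)
      (toSpec Γ(W, d.U) d.Tangent) (Spec.map (W.presheaf.map (homOfLE h.2).op)) := by
  let := (W.presheaf.map (homOfLE h.2).op).hom.toAlgebra
  let := (S.presheaf.map (homOfLE h.1).op).hom.toAlgebra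
  let := (q.appLE d.V c.U (h.2.trans d.le)).hom.toAlgebra
  have := isScalarTower_left h
  have := isScalarTower_right h
  have : Algebra.FormallyEtale Γ(W, d.U) Γ(W, c.U) :=
    formallyEtale_res c.isAffineOpen_U d.isAffineOpen_U h.2
  have : Algebra.FormallyEtale Γ(S, d.V) Γ(S, c.V) :=
    formallyEtale_res c.isAffineOpen_V d.isAffineOpen_V h.1
  exact isPullback_proj (isBaseChange_vfMap Γ(S, d.V) Γ(S, c.V) Γ(W, d.U) Γ(W, c.U))

theorem isPullback_specMap (h : c ≤ d) (h₁ : Module.Free Γ(W, d.U) d.Cotangent)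
    (h₂ : Module.Finite Γ(W, d.U) d.Cotangent) :
    IsPullback (Spec.map (CommRingCat.ofHom (symRes h).toRingHom))
      (Spec.map (CommRingCat.ofHom (algebraMap Γ(W, c.U) (SymmetricAlgebra Γ(W, c.U) c.Tangent))))
      (Spec.map (CommRingCat.ofHom (algebraMap Γ(W, d.U) (SymmetricAlgebra Γ(W, d.U) d.Tangent))))
      (Spec.map (W.presheaf.map (homOfLE h.2).op)) := by
  let := (W.presheaf.map (homOfLE h.2).op).hom.toAlgebra
  let := (S.presheaf.map (homOfLE h.1).op).hom.toAlgebra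
  let := (q.appLE d.V c.U (h.2.trans d.le)).hom.toAlgebra
  have := isScalarTower_left h
  have := isScalarTower_right h
  have : Algebra.FormallyEtale Γ(W, d.U) Γ(W, c.U) :=
    formallyEtale_res c.isAffineOpen_U d.isAffineOpen_U h.2
  have : Algebra.FormallyEtale Γ(S, d.V) Γ(S, c.V) :=
    formallyEtale_res c.isAffineOpen_V d.isAffineOpen_V h.1
  exact isPullback_SpecMap_of_isPushout _ _ _ _
    (isPushout_sym (isBaseChange_vfMap Γ(S, d.V) Γ(S, c.V) Γ(W, d.U) Γ(W, c.U)))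

theorem res_self (t : c.Tangent) : res le_rfl t = t := by
  refine tangent_ext le_rfl fun x => ?_
  rw [res_D]
  simp

theorem res_res {e : AffinePair q} (h : c ≤ d) (h' : d ≤ e) (t : e.Tangent) :
    res h (res h' t) = res (h.trans h') t := by
  refine tangent_ext (h.trans h') fun x => ?_
  rw [res_D]
  have : W.presheaf.map (homOfLE (h.trans h').2).op x =
    W.presheaf.map (homOfLE h.2).op (W.presheaf.map (homOfLE h'.2).op x) := by
    rw [← CategoryTheory.comp_apply, ← Functor.map_comp]
    rfl
  rw [this, res_D, res_D, ← CategoryTheory.comp_apply, ← Functor.map_comp]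
  rfl

theorem symRes_self : symRes (le_refl c) = .id _ := by
  refine GradedRingHom.ext fun x => ?_
  have : (symRes (le_refl c)).toRingHom = RingHom.id _ :=
    ringHom_ext (fun a => (symRes_algebraMap _ a).trans (by simp))
      fun t => (symRes_ι _ t).trans (by rw [res_self]; rfl)
  exact congr($this x)

theorem symRes_comp {e : AffinePair q} (h : c ≤ d) (h' : d ≤ e) :
    (symRes h).comp (symRes h') = symRes (h.trans h') := by
  refine GradedRingHom.ext fun x => ?_
  have : ((symRes h).comp (symRes h')).toRingHom = (symRes (h.trans h')).toRingHom := by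
    refine ringHom_ext (fun a => ?_) fun t => ?_
    · change symRes h (symRes h' _) = symRes (h.trans h') _
      rw [symRes_algebraMap, symRes_algebraMap, symRes_algebraMap, ← CategoryTheory.comp_apply,
        ← Functor.map_comp]
      rfl
    · change symRes h (symRes h' _) = symRes (h.trans h') _
      rw [symRes_ι, symRes_ι, symRes_ι, res_res]
  exact congr($this x)

end AffinePair

/-! ### Charts and the relative cotangent bundle -/

/-- A chart of a smooth morphism `q : W ⟶ S`: affine opens `U ⊆ W`, `V ⊆ S` with `q(U) ⊆ V` such
that the relative one-forms on `U` are free of finite rank. These cover `W` when `q` is smooth. -/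
structure Chart (q : W ⟶ S) extends AffinePair q where
  free : Module.Free Γ(W, U) toAffinePair.Cotangent
  finite : Module.Finite Γ(W, U) toAffinePair.Cotangent

namespace Chart
variable {q : W ⟶ S}

open SymProj

instance : Preorder (Chart q) := Preorder.lift Chart.toAffinePair

theorem exists_mem [Smooth q] (w : W) : ∃ c : Chart q, w ∈ c.U := by
  obtain ⟨V, hV, U, hU, hw, e, h⟩ := Smooth.exists_isStandardSmooth q w
  have h' := AffinePair.free_and_finite (c := ⟨V, hV, U, hU, e⟩) h
  exact ⟨⟨⟨V, hV, U, hU, e⟩, h'.1, h'.2⟩, hw⟩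

theorem exists_le (c d : Chart q) {w : W} (hc : w ∈ c.U) (hd : w ∈ d.U) :
    ∃ e : Chart q, e ≤ c ∧ e ≤ d ∧ w ∈ e.U := by
  obtain ⟨_, ⟨V, hV, rfl⟩, hwV, hV'⟩ := S.isBasis_affineOpens.exists_subset_of_mem_open
    (show q w ∈ ((c.V ⊓ d.V : S.Opens) : Set S) from ⟨c.le hc, d.le hd⟩) (c.V ⊓ d.V).2
  obtain ⟨_, ⟨U, hU, rfl⟩, hwU, hU'⟩ := W.isBasis_affineOpens.exists_subset_of_mem_open
    (show w ∈ ((c.U ⊓ d.U ⊓ q ⁻¹ᵁ V : W.Opens) : Set W) from ⟨⟨hc, hd⟩, hwV⟩)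
    (c.U ⊓ d.U ⊓ q ⁻¹ᵁ V).2
  let e : AffinePair q := ⟨V, hV, U, hU, fun x hx => (hU' hx).2⟩
  have h : e ≤ c.toAffinePair := ⟨fun x hx => (hV' hx).1, fun x hx => (hU' hx).1.1⟩
  have h' : e ≤ d.toAffinePair := ⟨fun x hx => (hV' hx).2, fun x hx => (hU' hx).1.2⟩
  exact ⟨⟨e, AffinePair.free_of_le h c.free, AffinePair.finite_of_le h c.finite⟩, h, h', hwU⟩

/-- The inclusion of a smaller chart. -/
def resSpec {c d : Chart q} (h : c ≤ d) : Spec Γ(W, c.U) ⟶ Spec Γ(W, d.U) :=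
  Spec.map (W.presheaf.map (homOfLE h.2).op)

theorem resSpec_fromSpec {c d : Chart q} (h : c ≤ d) :
    resSpec h ≫ d.isAffineOpen_U.fromSpec = c.isAffineOpen_U.fromSpec :=
  d.isAffineOpen_U.map_fromSpec c.isAffineOpen_U _

instance {c d : Chart q} (h : c ≤ d) : IsOpenImmersion (resSpec h) := by
  have : IsOpenImmersion (resSpec h ≫ d.isAffineOpen_U.fromSpec) := by
    rw [resSpec_fromSpec h]
    exact c.isAffineOpen_U.isOpenImmersion_fromSpec
  have := d.isAffineOpen_U.isOpenImmersion_fromSpec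
  exact IsOpenImmersion.of_comp _ d.isAffineOpen_U.fromSpec

theorem cover_directed (c d : Chart q)
    (x : ↥(pullback c.isAffineOpen_U.fromSpec d.isAffineOpen_U.fromSpec)) :
    ∃ (e : Chart q) (hc : e ≤ c) (hd : e ≤ d) (y : Spec Γ(W, e.U)),
      pullback.lift (resSpec hc) (resSpec hd)
        ((resSpec_fromSpec hc).trans (resSpec_fromSpec hd).symm) y = x := by
  have := c.isAffineOpen_U.isOpenImmersion_fromSpec
  have := d.isAffineOpen_U.isOpenImmersion_fromSpec
  let p := pullback.fst c.isAffineOpen_U.fromSpec d.isAffineOpen_U.fromSpec ≫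
    c.isAffineOpen_U.fromSpec
  have hc : p x ∈ c.U := c.isAffineOpen_U.range_fromSpec.le ⟨_, rfl⟩
  have hd : p x ∈ d.U := by
    refine d.isAffineOpen_U.range_fromSpec.le ?_
    simp only [p, pullback.condition]
    exact ⟨_, rfl⟩
  obtain ⟨e, hec, hed, hw⟩ := exists_le c d hc hd
  obtain ⟨y, hy⟩ : p x ∈ Set.range e.isAffineOpen_U.fromSpec := e.isAffineOpen_U.range_fromSpec.ge hw
  refine ⟨e, hec, hed, y, ?_⟩
  apply p.isOpenEmbedding.injective
  rw [← Scheme.Hom.comp_apply, pullback.lift_fst_assoc, resSpec_fromSpec, hy]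

variable (q) in
/-- The open cover of `W` by all charts. -/
abbrev cover [Smooth q] : W.OpenCover where
  I₀ := Chart q
  X c := Spec Γ(W, c.U)
  f c := c.isAffineOpen_U.fromSpec
  mem₀ := by
    rw [Scheme.presieve₀_mem_precoverage_iff]
    refine ⟨fun w => ?_, fun c => c.isAffineOpen_U.isOpenImmersion_fromSpec⟩
    obtain ⟨c, hc⟩ := exists_mem (q := q) w
    refine ⟨c, ?_⟩
    rw [c.isAffineOpen_U.range_fromSpec]
    exact hc

variable [Smooth q]

instance : (cover q).LocallyDirected where
  trans {c d} h := resSpec (leOfHom h)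
  trans_id c := by
    change Spec.map (W.presheaf.map (𝟙 _)) = _
    rw [CategoryTheory.Functor.map_id, Spec.map_id]
  trans_comp {c d e} h h' := by
    rw [resSpec, resSpec, resSpec, ← Spec.map_comp, ← Functor.map_comp]
    rfl
  w {c d} h := resSpec_fromSpec _
  directed {c d} x := by
    obtain ⟨e, hc, hd, y, h⟩ := cover_directed c d x
    exact ⟨e, homOfLE hc, homOfLE hd, y, h⟩
  property_trans {c d} h := inferInstanceAs (IsOpenImmersion (resSpec _))

variable (q) in
/-- The schemes `Proj (Sym T_{U/V})` over the charts, with their gluing. -/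
def projGluing : (cover q).RelativeGluingData where
  functor :=
    { obj c := Proj (AffinePair.symGrading (Chart.toAffinePair c))
      map {c d} h := Proj.map (AffinePair.symRes (leOfHom h))
        (AffinePair.symRes_irrelevant (leOfHom h) d.free d.finite)
      map_id c := by
        simp only [AffinePair.symRes_self]
        exact Proj.map_id
      map_comp {c d e} h h' := by
        simp only [← AffinePair.symRes_comp (leOfHom h) (leOfHom h')]
        exact Proj.map_comp _ _ _ _ }
  natTrans :=
    { app c := toSpec Γ(W, c.U) c.Tangent
      naturality {c d} h := (AffinePair.isPullback_projMap (leOfHom h) d.free d.finite).w }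
  equifibered {c d} h := AffinePair.isPullback_projMap (leOfHom h) d.free d.finite

variable (q) in
/-- The schemes `Spec (Sym T_{U/V})` over the charts, with their gluing. -/
def specGluing : (cover q).RelativeGluingData where
  functor :=
    { obj c := Spec (.of (SymmetricAlgebra Γ(W, c.U) c.Tangent))
      map {c d} h := Spec.map (CommRingCat.ofHom (AffinePair.symRes (leOfHom h)).toRingHom)
      map_id c := by
        rw [AffinePair.symRes_self]
        exact Spec.map_id _
      map_comp {c d e} h h' := by
        rw [← AffinePair.symRes_comp (leOfHom h) (leOfHom h'), ← Spec.map_comp]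
        rfl }
  natTrans :=
    { app c := Spec.map (CommRingCat.ofHom (algebraMap Γ(W, c.U) (SymmetricAlgebra Γ(W, c.U) c.Tangent)))
      naturality {c d} h := (AffinePair.isPullback_specMap (leOfHom h) d.free d.finite).w }
  equifibered {c d} h := AffinePair.isPullback_specMap (leOfHom h) d.free d.finite

end Chart

/-! ### The conormal variety, the relative singular scheme, and blowups -/

section Bundles
variable (q : W ⟶ S) [Smooth q]

/-- The relative cotangent bundle `T^∨(W/S)`, the relative spectrum of `Sym (T_{W/S})`. -/
def cotangentBundle : Scheme.{u} := (Chart.specGluing q).glued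

/-- The projection `T^∨(W/S) ⟶ W`. -/
def cotangentBundle.proj : cotangentBundle q ⟶ W := (Chart.specGluing q).toBase

/-- The open part of `T^∨(W/S)` over a chart. -/
def cotangentBundle.chart (c : Chart q) :
    Spec (.of (SymmetricAlgebra Γ(W, c.U) c.Tangent)) ⟶ cotangentBundle q :=
  (Chart.specGluing q).cover.f c

/-- The projectivised relative cotangent bundle `ℙT^∨(W/S)`: the relative `Proj` of `Sym (T_{W/S})`,
whose points over `w` are the lines in the cotangent space of the fibre at `w`. -/
def projCotangentBundle : Scheme.{u} := (Chart.projGluing q).glued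

/-- The projection `ℙT^∨(W/S) ⟶ W`. -/
def projCotangentBundle.proj : projCotangentBundle q ⟶ W := (Chart.projGluing q).toBase

/-- The open part of `ℙT^∨(W/S)` over a chart. -/
def projCotangentBundle.chart (c : Chart q) : Proj c.symGrading ⟶ projCotangentBundle q :=
  (Chart.projGluing q).cover.f c

end Bundles

/-- The set of points at which `f` is smooth, i.e. with a neighbourhood that is smooth over `S`. -/
def smoothLocus {X : Scheme.{u}} (f : X ⟶ S) : Set X :=
  {x | ∃ U : X.Opens, x ∈ U ∧ Smooth (U.ι ≫ f)}

variable {X : Scheme.{u}} (q : W ⟶ S) (i : X ⟶ W)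

variable {q} in
/-- The ideal of the closed subscheme `X` of `W` on a chart. -/
def Chart.equations (c : Chart q) : Ideal Γ(W, c.U) := i.ker.ideal ⟨c.U, c.isAffineOpen_U⟩

variable {q} in
/-- The derivative `t(F)` of a function `F` along a relative vector field `t`. -/
def Chart.deriv (c : Chart q) (t : c.Tangent) (F : Γ(W, c.U)) : Γ(W, c.U) :=
  t (KaehlerDifferential.D Γ(S, c.V) Γ(W, c.U) F)

/-- The set of all `(x, ξ)` in `T^∨(W/S)` with `x` in the smooth locus of `X/S` and `ξ ⊥ T_x X_{q(x)}`.
In a chart, a point `ξ` over `x` is a prime `𝔮` of `Sym T` over the prime of `x`; the value at `x` of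
a vector field `t` is tangent to the fibre of `X` when `t(F)` vanishes at `x` for all equations `F`
of `X`, and `ξ` annihilates it when `t ∈ 𝔮`. -/
def conormalSet [Smooth q] : Set (cotangentBundle q) :=
  {ξ | cotangentBundle.proj q ξ ∈ i '' smoothLocus (i ≫ q) ∧
    ∃ (c : Chart q) (𝔮 : PrimeSpectrum (SymmetricAlgebra Γ(W, c.U) c.Tangent)),
      cotangentBundle.chart q c 𝔮 = ξ ∧
      ∀ t : c.Tangent,
        (∀ F ∈ c.equations i, algebraMap _ _ (c.deriv t F) ∈ 𝔮.asIdeal) →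
        SymmetricAlgebra.ι Γ(W, c.U) c.Tangent t ∈ 𝔮.asIdeal}

/-- The relative conormal variety `Λ_{X/S}`. -/
def conormalVariety [Smooth q] : Set (cotangentBundle q) := closure (conormalSet q i)

/-- The image of `Λ` minus the zero section under the quotient map `T^∨(W/S) ∖ 0 → ℙT^∨(W/S)`. In a chart
this map sends a prime of `Sym T` to its homogeneous core, and the zero section consists of the
primes whose homogeneous core contains the irrelevant ideal, which is not a point of `Proj`. -/
def projectivization [Smooth q] (Λ : Set (cotangentBundle q)) : Set (projCotangentBundle q) :=
  {p | ∃ (c : Chart q) (𝔮 : PrimeSpectrum (SymmetricAlgebra Γ(W, c.U) c.Tangent))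
    (l : ProjectiveSpectrum c.symGrading),
      cotangentBundle.chart q c 𝔮 ∈ Λ ∧
      l.asHomogeneousIdeal = 𝔮.asIdeal.homogeneousCore c.symGrading ∧
      projCotangentBundle.chart q c l = p}

/-- The ideal of `ℙΛ_{X/S}` with its reduced structure. -/
def projConormalIdeal [Smooth q] : (projCotangentBundle q).IdealSheafData :=
  .vanishingIdeal ⟨closure (projectivization q (conormalVariety q i)), isClosed_closure⟩

/-- The projectivised relative conormal variety `ℙΛ_{X/S}`. -/
def projConormal [Smooth q] : Scheme.{u} := (projConormalIdeal q i).subscheme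

/-- The inclusion of `ℙΛ_{X/S}` into `ℙT^∨(W/S)`. -/
def projConormal.ι [Smooth q] : projConormal q i ⟶ projCotangentBundle q :=
  (projConormalIdeal q i).subschemeι

/-- The ideal sheaf of the relative singular scheme `Sing(X/S) ⊆ W`: it is generated by the local
equations `F` of `X` and their derivatives along relative vector fields. -/
def relSingIdeal : W.IdealSheafData :=
  sInf {J | ∀ c : Chart q, ∀ F ∈ c.equations i,
    F ∈ J.ideal ⟨c.U, c.isAffineOpen_U⟩ ∧
    ∀ t : c.Tangent, c.deriv t F ∈ J.ideal ⟨c.U, c.isAffineOpen_U⟩}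

/-- An ideal sheaf is invertible if it is locally generated by a nonzerodivisor. -/
def IsInvertibleIdeal {T : Scheme.{u}} (J : T.IdealSheafData) : Prop :=
  ∀ x : T, ∃ U : T.affineOpens, x ∈ U.1 ∧
    ∃ f ∈ nonZeroDivisors Γ(T, U.1), J.ideal U = Ideal.span {f}

/-- `b : B ⟶ X` is the blowup of `X` along the closed subscheme with ideal sheaf `I`: the inverse image
ideal of `I` on `B` is invertible, and `b` is universal with this property. -/
structure IsBlowup {B X : Scheme.{u}} (b : B ⟶ X) (I : X.IdealSheafData) : Prop where
  isInvertibleIdeal : IsInvertibleIdeal (I.comap b)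
  existsUnique_lift : ∀ (T : Scheme.{u}) (g : T ⟶ X), IsInvertibleIdeal (I.comap g) →
    ∃! h : T ⟶ B, h ≫ b = g

end RelConormal

end

section
open IsLocalRing

namespace MvPowerSeries
variable {k : Type*} [Field k]

theorem maximalIdeal_eq_map_idealOfVars (n : ℕ) :
    maximalIdeal (MvPowerSeries (Fin n) k) =
      (MvPolynomial.idealOfVars (Fin n) k).map
        (algebraMap (MvPolynomial (Fin n) k) (MvPowerSeries (Fin n) k)) := by
  have hmax : (MvPolynomial.idealOfVars (Fin n) k).IsMaximal := by
    have : MvPolynomial.idealOfVars (Fin n) k =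
        RingHom.ker (MvPolynomial.constantCoeff (σ := Fin n) (R := k)) := by
      ext p
      rw [← pow_one (MvPolynomial.idealOfVars (Fin n) k), MvPolynomial.mem_pow_idealOfVars_iff',
        RingHom.mem_ker, MvPolynomial.constantCoeff_eq]
      refine ⟨fun H => H 0 (by simp), fun H d hd => ?_⟩
      rw [Nat.lt_one_iff, Finsupp.degree_eq_zero_iff] at hd
      rw [hd, H]
    rw [this]
    exact RingHom.ker_isMaximal_of_surjective _ fun a => ⟨MvPolynomial.C a, by simp⟩
  have hfg := IsNoetherian.noetherian (MvPolynomial.idealOfVars (Fin n) k)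
  have h := AdicCompletion.isMaximal_map_of_le _ (MvPolynomial.idealOfVars (Fin n) k) le_rfl hfg
  let e := (toAdicCompletionAlgEquiv (Fin n) k)
  refine (IsLocalRing.eq_maximalIdeal ?_).symm
  have h2 : (MvPolynomial.idealOfVars (Fin n) k).map
        (algebraMap (MvPolynomial (Fin n) k) (MvPowerSeries (Fin n) k)) =
      Ideal.comap e.toRingEquiv ((MvPolynomial.idealOfVars (Fin n) k).map (algebraMap (MvPolynomial (Fin n) k)
        (AdicCompletion (MvPolynomial.idealOfVars (Fin n) k) (MvPolynomial (Fin n) k)))) := by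
    rw [← Ideal.map_symm, ← e.symm.toAlgHom.comp_algebraMap, ← Ideal.map_map]
    rfl
  rw [h2]
  exact Ideal.comap_isMaximal_of_equiv _

instance isAdicComplete_maximalIdeal (n : ℕ) :
    IsAdicComplete (maximalIdeal (MvPowerSeries (Fin n) k)) (MvPowerSeries (Fin n) k) := by
  have hfg := IsNoetherian.noetherian (MvPolynomial.idealOfVars (Fin n) k)
  have h := AdicCompletion.isAdicComplete_self _ hfg
  rw [maximalIdeal_eq_map_idealOfVars]
  let e := (toAdicCompletionAlgEquiv (Fin n) k)
  rw [← e.symm.toAlgHom.comp_algebraMap, ← Ideal.map_map]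
  exact (IsAdicComplete.congr_ringEquiv _ e.symm.toRingEquiv).mpr h

instance flat_mvPolynomial (n : ℕ) :
    Module.Flat (MvPolynomial (Fin n) k) (MvPowerSeries (Fin n) k) :=
  .of_linearEquiv (toAdicCompletionAlgEquiv (Fin n) k).toLinearEquiv

/-- The restriction of a power series to the first coordinate axis. -/
noncomputable def toFirstAxis (n : ℕ) : MvPowerSeries (Fin (n + 1)) k →+* PowerSeries k :=
  (PowerSeries.map constantCoeff).comp (finSuccEquiv k n).toRingEquiv.toRingHom

theorem toFirstAxis_X_zero (n : ℕ) : toFirstAxis (k := k) n (X 0) = PowerSeries.X := by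
  change PowerSeries.map constantCoeff (finSuccEquiv k n (X 0)) = _
  rw [finSuccEquiv_X_zero, PowerSeries.map_X]

theorem toFirstAxis_X_succ (n : ℕ) (j : Fin n) : toFirstAxis (k := k) n (X j.succ) = 0 := by
  change PowerSeries.map constantCoeff (finSuccEquiv k n (X j.succ)) = _
  rw [finSuccEquiv_X_succ, PowerSeries.map_C, constantCoeff_X, map_zero]

theorem toFirstAxis_C (n : ℕ) (a : k) : toFirstAxis (k := k) n (C a) = PowerSeries.C a := by
  change PowerSeries.map constantCoeff (finSuccEquiv k n (C a)) = _
  rw [finSuccEquiv_C, PowerSeries.map_C, constantCoeff_C]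

theorem coeff_toFirstAxis (n d : ℕ) (f : MvPowerSeries (Fin (n + 1)) k) :
    PowerSeries.coeff d (toFirstAxis n f) = coeff (Finsupp.single 0 d) f := by
  change PowerSeries.coeff d (PowerSeries.map constantCoeff (finSuccEquiv k n f)) = _
  rw [PowerSeries.coeff_map, ← coeff_zero_eq_constantCoeff_apply, coeff_coeff_finSuccEquiv]
  congr
  ext j
  refine Fin.cases ?_ (fun j => ?_) j <;> simp

/-- The images of the coordinates under the linear change of coordinates that maps the first
coordinate axis to the line spanned by `a`. -/
noncomputable def linearChange {n : ℕ} (a : Fin (n + 1) → k) : Fin (n + 1) → MvPowerSeries (Fin (n + 1)) k :=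
  Fin.cons (C (a 0) * X 0) fun j => C (a j.succ) * X 0 + X j.succ

theorem linearChange_zero {n : ℕ} (a : Fin (n + 1) → k) : linearChange a 0 = C (a 0) * X 0 := rfl

theorem linearChange_succ {n : ℕ} (a : Fin (n + 1) → k) (j : Fin n) :
    linearChange a j.succ = C (a j.succ) * X 0 + X j.succ := rfl

theorem hasSubst_linearChange {n : ℕ} (a : Fin (n + 1) → k) : HasSubst (linearChange a) := by
  refine hasSubst_of_constantCoeff_zero fun j => ?_
  refine Fin.cases ?_ (fun j => ?_) j <;> simp [linearChange]

theorem toFirstAxis_linearChange {n : ℕ} (a : Fin (n + 1) → k) (j : Fin (n + 1)) :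
    toFirstAxis n (linearChange a j) = PowerSeries.C (a j) * PowerSeries.X := by
  refine Fin.cases ?_ (fun j => ?_) j <;>
    simp [linearChange, toFirstAxis_C, toFirstAxis_X_zero, toFirstAxis_X_succ]

theorem subst_linearChange_linearChange {n : ℕ} (a b : Fin (n + 1) → k) (h₀ : a 0 * b 0 = 1)
    (h : ∀ j : Fin n, a j.succ * b 0 + b j.succ = 0) (f : MvPowerSeries (Fin (n + 1)) k) :
    subst (linearChange b) (subst (linearChange a) f) = f := by
  have hb := hasSubst_linearChange b
  have : (fun j => subst (linearChange b) (linearChange a j)) = X := by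
    ext1 j
    rw [← substAlgHom_apply hb]
    have hC (r : k) : substAlgHom hb (C r) = C r := (substAlgHom hb).commutes r
    refine Fin.cases ?_ (fun j => ?_) j
    · rw [linearChange_zero, map_mul, hC, substAlgHom_X, linearChange_zero, ← mul_assoc, ← map_mul,
        h₀, map_one, one_mul]
    · rw [linearChange_succ, map_add, map_mul, hC, substAlgHom_X, substAlgHom_X, linearChange_zero,
        linearChange_succ, ← mul_assoc, ← map_mul, ← add_assoc, ← add_mul, ← map_add, h, map_zero,
        zero_mul, zero_add]
  rw [subst_comp_subst_apply (hasSubst_linearChange a) hb, this, subst_self, id]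

/-- The linear change of coordinates that maps the first coordinate axis to the line spanned
by `a`. -/
noncomputable def linearEquiv {n : ℕ} (a : Fin (n + 1) → k) (h : a 0 ≠ 0) :
    MvPowerSeries (Fin (n + 1)) k ≃+* MvPowerSeries (Fin (n + 1)) k :=
  RingEquiv.ofRingHom (substAlgHom (hasSubst_linearChange a)).toRingHom
    (substAlgHom (hasSubst_linearChange
      (Fin.cons (a 0)⁻¹ fun j => - a j.succ * (a 0)⁻¹ : Fin (n + 1) → k))).toRingHom
    (by
      ext1 f
      refine (substAlgHom_apply (hasSubst_linearChange _) _).trans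
        ((congrArg _ (substAlgHom_apply (hasSubst_linearChange _) _)).trans ?_)
      refine subst_linearChange_linearChange _ _ ?_ (fun j => ?_) f
      · simp [h]
      · simp [h])
    (by
      ext1 f
      refine (substAlgHom_apply (hasSubst_linearChange _) _).trans
        ((congrArg _ (substAlgHom_apply (hasSubst_linearChange _) _)).trans ?_)
      refine subst_linearChange_linearChange _ _ ?_ (fun j => ?_) f
      · simp [h]
      · simp)

theorem coeff_toFirstAxis_linearEquiv {n : ℕ} (a : Fin (n + 1) → k) (h : a 0 ≠ 0)
    (f : MvPowerSeries (Fin (n + 1)) k) (d : ℕ) :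
    PowerSeries.coeff d (toFirstAxis n (linearEquiv a h f)) =
      ∑ e ∈ Finset.finsuppAntidiag Finset.univ d, coeff e f * e.prod fun j m => a j ^ m := by
  have key (e : Fin (n + 1) →₀ ℕ) : coeff (Finsupp.single 0 d)
      (e.prod fun s m => linearChange a s ^ m) =
      if e.degree = d then e.prod fun j m => a j ^ m else 0 := by
    rw [← coeff_toFirstAxis, Finsupp.prod, map_prod]
    simp only [map_pow, toFirstAxis_linearChange, mul_pow, Finset.prod_mul_distrib,
      Finset.prod_pow_eq_pow_sum]
    rw [← Finset.prod_congr rfl (fun i _ => map_pow PowerSeries.C (a i) (e i)), ← map_prod,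
      PowerSeries.coeff_C_mul, PowerSeries.coeff_X_pow, Finsupp.degree_apply]
    simp [Finsupp.prod, eq_comm]
  rw [coeff_toFirstAxis]
  have : linearEquiv a h f = subst (linearChange a) f :=
    substAlgHom_apply (hasSubst_linearChange a) f
  rw [this, coeff_subst (hasSubst_linearChange a)]
  simp only [key, smul_eq_mul]
  rw [finsum_eq_sum_of_support_subset (s := Finset.finsuppAntidiag Finset.univ d)]
  · refine Finset.sum_congr rfl fun e he => ?_
    rw [Finset.mem_finsuppAntidiag] at he
    rw [if_pos]
    rw [← he.1, Finsupp.degree_eq_sum]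
  · intro e he
    simp only [Function.mem_support, ne_eq, mul_eq_zero, ite_eq_right_iff, not_or,
      Classical.not_imp] at he
    rw [Finset.mem_coe, Finset.mem_finsuppAntidiag]
    refine ⟨?_, Finset.subset_univ _⟩
    rw [← he.2.1, Finsupp.degree_eq_sum]

theorem exists_toFirstAxis_linearEquiv_ne_zero [Infinite k] {n : ℕ} {f : MvPowerSeries (Fin (n + 1)) k}
    (hf : f ≠ 0) : ∃ (a : Fin (n + 1) → k) (h : a 0 ≠ 0), toFirstAxis n (linearEquiv a h f) ≠ 0 := by
  obtain ⟨e₀, he₀⟩ : ∃ e, coeff e f ≠ 0 := by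
    by_contra! H
    exact hf (ext fun e => by simp [H])
  let g : MvPolynomial (Fin (n + 1)) k :=
    ∑ e ∈ Finset.finsuppAntidiag Finset.univ e₀.degree, MvPolynomial.monomial e (coeff e f)
  have hg : MvPolynomial.X 0 * g ≠ 0 := by
    refine mul_ne_zero (MvPolynomial.X_ne_zero _) fun H => he₀ ?_
    have := congrArg (MvPolynomial.coeff e₀) H
    simp only [g, MvPolynomial.coeff_sum, MvPolynomial.coeff_monomial] at this
    rw [Finset.sum_ite_eq' , if_pos] at this
    · simpa using this
    · simp [Finset.mem_finsuppAntidiag, Finsupp.degree_eq_sum]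
  obtain ⟨a, ha⟩ : ∃ a, MvPolynomial.eval a (MvPolynomial.X 0 * g) ≠ 0 := by
    by_contra! H
    exact hg (MvPolynomial.funext fun a => by simpa using H a)
  simp only [map_mul, MvPolynomial.eval_X, mul_ne_zero_iff] at ha
  refine ⟨a, ha.1, fun H => ha.2 ?_⟩
  have := coeff_toFirstAxis_linearEquiv a ha.1 f e₀.degree
  rw [H, map_zero] at this
  simp only [g, map_sum, MvPolynomial.eval_monomial]
  exact this.symm

end MvPowerSeries

theorem Polynomial.prime_coe_of_dvd_isDistinguishedAt {A : Type*} [CommRing A] [IsDomain A] [IsLocalRing A]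
    [IsAdicComplete (maximalIdeal A) A] {g p : Polynomial A}
    (hg : g.IsDistinguishedAt (maximalIdeal A)) (hp : Prime p) (hpg : p ∣ g) :
    Prime (p : PowerSeries A) := by
  obtain ⟨r, rfl⟩ := hpg
  have hlc : IsUnit p.leadingCoeff := by
    refine IsUnit.of_mul_eq_one r.leadingCoeff ?_
    rw [← Polynomial.leadingCoeff_mul]
    exact hg.monic
  obtain ⟨u, hu⟩ := hlc
  let p' := Polynomial.C (↑u⁻¹ : A) * p
  have hu' : IsUnit (Polynomial.C (↑u⁻¹ : A)) := (Units.isUnit _).map _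
  have hp' : Prime p' := (associated_unit_mul_left p _ hu').symm.prime hp
  have hmon : p'.Monic := by
    simp only [p', Polynomial.Monic, Polynomial.leadingCoeff_mul, Polynomial.leadingCoeff_C, ← hu,
      Units.inv_mul]
  have hdist : p'.IsDistinguishedAt (maximalIdeal A) := by
    have h1 := hg.map_eq_X_pow
    have h2 : (p'.map (Ideal.Quotient.mk (maximalIdeal A))) ∣ Polynomial.X ^ (p * r).natDegree := by
      rw [← h1]
      refine Polynomial.map_dvd _ ?_
      exact (associated_unit_mul_left p _ hu').dvd.trans (dvd_mul_right _ _)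
    let : Field (A ⧸ maximalIdeal A) := Ideal.Quotient.field _
    obtain ⟨j, -, hj⟩ := (dvd_prime_pow Polynomial.prime_X _).mp h2
    have h3 := Polynomial.eq_of_monic_of_associated (hmon.map _) (Polynomial.monic_X_pow j) hj
    have h4 : j = p'.natDegree := by
      rw [← hmon.natDegree_map (Ideal.Quotient.mk (maximalIdeal A)), h3, Polynomial.natDegree_X_pow]
    refine ⟨⟨fun {m} hm => ?_⟩, hmon⟩
    rw [← Ideal.Quotient.eq_zero_iff_mem, ← Polynomial.coeff_map, h3, Polynomial.coeff_X_pow,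
      if_neg (by omega)]
  have h0 : (p' : PowerSeries A) ≠ 0 := by
    rw [Ne, Polynomial.coe_eq_zero_iff]
    exact hp'.ne_zero
  have : Prime (p' : PowerSeries A) := by
    rw [← Ideal.span_singleton_prime h0, ← Ideal.Quotient.isDomain_iff_prime]
    have := (Ideal.Quotient.isDomain_iff_prime _).mpr ((Ideal.span_singleton_prime hp'.ne_zero).mpr hp')
    exact hdist.algEquivQuotient.symm.toMulEquiv.isDomain _
  have h5 : (p' : PowerSeries A) = PowerSeries.C (↑u⁻¹ : A) * (p : PowerSeries A) := by
    simp [p']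
  rw [h5] at this
  exact (associated_unit_mul_left _ _ ((Units.isUnit _).map _)).prime this

instance MvPowerSeries.uniqueFactorizationMonoid {k : Type*} [Field k] [Infinite k] (n : ℕ) :
    UniqueFactorizationMonoid (MvPowerSeries (Fin n) k) := by
  induction n with
  | zero =>
    exact (isEmptyEquiv (Fin 0) k).symm.toMulEquiv.uniqueFactorizationMonoid inferInstance
  | succ n ih =>
    have : IsDomain (MvPowerSeries (Fin (n + 1)) k) := NoZeroDivisors.to_isDomain _
    have : IsDomain (MvPowerSeries (Fin n) k) := NoZeroDivisors.to_isDomain _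
    refine UniqueFactorizationMonoid.iff_exists_prime_mem_of_isPrime.mpr fun P hP hP' => ?_
    obtain ⟨f, hfP, hf⟩ := Submodule.exists_mem_ne_zero_of_ne_bot hP
    obtain ⟨a, ha, hfa⟩ := exists_toFirstAxis_linearEquiv_ne_zero hf
    let E : MvPowerSeries (Fin (n + 1)) k ≃+* PowerSeries (MvPowerSeries (Fin n) k) :=
      (linearEquiv a ha).trans (finSuccEquiv k n).toRingEquiv
    have hE : (E f).map (residue _) ≠ 0 := by
      intro H
      refine hfa (PowerSeries.ext fun d => ?_)
      have := congrArg (PowerSeries.coeff d) H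
      rw [PowerSeries.coeff_map, map_zero, residue_eq_zero_iff, mem_maximalIdeal, mem_nonunits_iff,
        MvPowerSeries.isUnit_iff_constantCoeff, isUnit_iff_ne_zero, not_not] at this
      rw [map_zero]
      exact (PowerSeries.coeff_map ..).trans this
    obtain ⟨g, u, H⟩ := PowerSeries.exists_isWeierstrassFactorization hE
    have hgP : E.symm (g : PowerSeries _) ∈ P := by
      refine (hP'.mem_or_mem (x := _) (y := E.symm u) ?_).resolve_right fun h => ?_
      · rw [← map_mul, ← H.eq_mul, E.symm_apply_apply]
        exact hfP
      · exact hP'.ne_top (P.eq_top_of_isUnit_mem h (H.isUnit.map E.symm))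
    have hg0 : g ≠ 0 := H.isDistinguishedAt.monic.ne_zero
    have hprod : ∃ p, Prime p ∧ p ∣ g ∧ E.symm (p : PowerSeries _) ∈ P := by
      obtain ⟨u, hu⟩ := UniqueFactorizationMonoid.factors_prod hg0
      have h1 : (UniqueFactorizationMonoid.factors g).prod ∈
          P.comap (E.symm.toRingHom.comp Polynomial.coeToPowerSeries.ringHom) := by
        rw [(Units.eq_mul_inv_iff_mul_eq u).mpr hu]
        exact Ideal.mul_mem_right _ _ hgP
      have := hP'.comap (E.symm.toRingHom.comp (Polynomial.coeToPowerSeries.ringHom (R := MvPowerSeries (Fin n) k)))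
      obtain ⟨p, hp, hpP⟩ := this.multiset_prod_mem_iff_exists_mem _ |>.mp h1
      exact ⟨p, UniqueFactorizationMonoid.prime_of_factor p hp,
        UniqueFactorizationMonoid.dvd_of_mem_factors hp, hpP⟩
    obtain ⟨p, hp, hpg, hpP⟩ := hprod
    refine ⟨_, hpP, ?_⟩
    exact (MulEquiv.prime_iff E.symm.toMulEquiv).mpr
      (Polynomial.prime_coe_of_dvd_isDistinguishedAt H.isDistinguishedAt hp hpg)

end

section
open IsLocalRing

theorem Ideal.exists_colon_of_minimal {A : Type*} [CommRing A] [IsDomain A] [IsNoetherianRing A]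
    {P : Ideal A} [P.IsPrime] (hP : P ≠ ⊥)
    (hmin : ∀ P' : Ideal A, P'.IsPrime → P' ≤ P → P' ≠ ⊥ → P' = P) :
    ∃ f g : A, f ≠ 0 ∧ ∀ a, a ∈ P ↔ f ∣ a * g := by
  obtain ⟨f, hfP, hf⟩ := Submodule.exists_mem_ne_zero_of_ne_bot hP
  have h1 : P ∈ (Module.annihilator A (A ⧸ Ideal.span {f})).minimalPrimes := by
    rw [Ideal.annihilator_quotient]
    refine ⟨⟨inferInstance, (Ideal.span_singleton_le_iff_mem P).mpr hfP⟩, fun P' hP' hle => ?_⟩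
    refine (hmin P' hP'.1 hle fun h => hf ?_).ge
    simpa [h] using hP'.2 (Ideal.mem_span_singleton_self f)
  have h2 := Module.associatedPrimes.minimalPrimes_annihilator_subset_associatedPrimes A _ h1
  obtain ⟨-, x, hx⟩ := isAssociatedPrime_iff.mp h2
  obtain ⟨g, rfl⟩ := Ideal.Quotient.mk_surjective x
  refine ⟨f, g, hf, fun a => ?_⟩
  rw [hx, Submodule.mem_colon_singleton, Submodule.mem_bot, ← Ideal.mem_span_singleton,
    ← Ideal.Quotient.eq_zero_iff_mem, map_mul]
  rfl

theorem Module.Flat.exists_of_mul_eq_mul {A B : Type*} [CommRing A] [CommRing B] [Algebra A B]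
    [Module.Flat A B] {f g : A} {b b' : B} (h : b * algebraMap A B g = b' * algebraMap A B f) :
    ∃ (l : ℕ) (a a' : Fin l → A) (y : Fin l → B), (∀ j, a j * g = a' j * f) ∧
      b = ∑ j, algebraMap A B (a j) * y j := by
  obtain ⟨l, a, y, h1, h2⟩ := Module.Flat.isTrivialRelation_of_sum_smul_eq_zero
    (f := ![g, -f]) (x := ![b, b']) (by
      simp [Algebra.smul_def]
      linear_combination h)
  refine ⟨l, a 0, a 1, y, fun j => ?_, ?_⟩
  · have := h2 j
    simp at this
    linear_combination this
  · simpa [Algebra.smul_def] using h1 0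

/-- A prime ideal of height one of a Noetherian domain becomes principal locally around a point at
which the domain has a flat local extension that is a unique factorization domain. -/
theorem Ideal.exists_locally_principal_of_flat {A B : Type*} [CommRing A] [IsDomain A] [IsNoetherianRing A]
    [CommRing B] [IsDomain B] [IsLocalRing B] [UniqueFactorizationMonoid B] [Algebra A B] [Module.Flat A B]
    (P : Ideal A) [P.IsPrime] (hP : P ≠ ⊥)
    (hmin : ∀ P' : Ideal A, P'.IsPrime → P' ≤ P → P' ≠ ⊥ → P' = P) :
    ∃ F ∈ P, ∃ s, algebraMap A B s ∉ maximalIdeal B ∧ ∀ y ∈ P, s * y ∈ Ideal.span {F} := by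
  classical
  obtain ⟨f, g, hf, hfg⟩ := Ideal.exists_colon_of_minimal hP hmin
  have hf' : algebraMap A B f ≠ 0 := by
    intro h
    have := Module.Flat.isSMulRegular_of_nonZeroDivisors (M := B) (mem_nonZeroDivisors_of_ne_zero hf)
    have h1 := @this 1 0 (by simp [Algebra.smul_def, h])
    exact one_ne_zero h1
  obtain ⟨f', g', d, hrel, hfd, hgd⟩ := UniqueFactorizationMonoid.exists_reduced_factors _ hf'
    (algebraMap A B g)
  have hd : d ≠ 0 := by
    rintro rfl
    simp [← hfd] at hf'
  have hmap : P.map (algebraMap A B) = Ideal.span {f'} := by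
    refine le_antisymm (Ideal.map_le_iff_le_comap.mpr fun a ha => ?_)
      ((Ideal.span_singleton_le_iff_mem _).mpr ?_)
    · rw [Ideal.mem_comap, Ideal.mem_span_singleton]
      refine hrel.dvd_of_dvd_mul_right ?_
      have := map_dvd (algebraMap A B) ((hfg a).mp ha)
      rw [map_mul, ← hfd, ← hgd, mul_left_comm] at this
      exact (mul_dvd_mul_iff_left hd).mp this
    · obtain ⟨l, a, a', y, h1, h2⟩ := Module.Flat.exists_of_mul_eq_mul (A := A) (f := f) (g := g)
        (b := f') (b' := g') (by rw [← hfd, ← hgd]; ring)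
      rw [h2]
      refine Submodule.sum_mem _ fun j _ => Ideal.mul_mem_right _ _ (Ideal.mem_map_of_mem _ ?_)
      exact (hfg _).mpr ⟨a' j, by rw [h1, mul_comm]⟩
  have hf'0 : f' ≠ 0 := by
    rintro rfl
    simp [← hfd] at hf'
  obtain ⟨F, hFP, u, hF⟩ : ∃ F ∈ P, ∃ u : Bˣ, algebraMap A B F = u * f' := by
    by_contra! H
    have h1 : P.map (algebraMap A B) ≤ maximalIdeal B * Ideal.span {f'} := by
      refine Ideal.map_le_iff_le_comap.mpr fun a ha => ?_
      obtain ⟨c, hc⟩ := Ideal.mem_span_singleton.mp (hmap.le (Ideal.mem_map_of_mem _ ha))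
      rw [Ideal.mem_comap, hc, mul_comm f' c]
      refine Ideal.mul_mem_mul (I := maximalIdeal B) ?_ (Ideal.mem_span_singleton_self f')
      rw [mem_maximalIdeal, mem_nonunits_iff]
      rintro ⟨u, rfl⟩
      exact H a ha u (by rw [hc, mul_comm])
    obtain ⟨z, hz, h2⟩ := Ideal.mem_mul_span_singleton.mp
      (h1 (hmap.ge (Ideal.mem_span_singleton_self _)))
    have : z = 1 := mul_right_cancel₀ hf'0 (by rw [h2, one_mul])
    exact (mem_maximalIdeal _).mp hz (this ▸ isUnit_one)
  have key : ∀ y ∈ P, ∃ s, algebraMap A B s ∉ maximalIdeal B ∧ s * y ∈ Ideal.span {F} := by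
    intro y hy
    obtain ⟨c, hc⟩ := Ideal.mem_span_singleton.mp (hmap.le (Ideal.mem_map_of_mem _ hy))
    obtain ⟨l, a, a', z, h1, h2⟩ := Module.Flat.exists_of_mul_eq_mul (A := A) (f := F) (g := y)
        (b := 1) (b' := c * (u⁻¹ : Bˣ)) (by
          rw [hF, hc, one_mul, mul_assoc, Units.inv_mul_cancel_left, mul_comm])
    by_contra! H
    refine (mem_maximalIdeal (1 : B)).mp ?_ isUnit_one
    rw [h2]
    refine Submodule.sum_mem _ fun j _ => Ideal.mul_mem_right _ _ ?_
    by_contra h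
    exact H _ h (h1 j ▸ Ideal.mul_mem_left _ _ (Ideal.mem_span_singleton_self _))
  obtain ⟨t, ht⟩ := IsNoetherian.noetherian P
  choose! σ hσ₁ hσ₂ using key
  have htP : ∀ y ∈ t, y ∈ P := fun y hy => ht ▸ Submodule.subset_span hy
  refine ⟨F, hFP, ∏ y ∈ t, σ y, ?_, fun y hy => ?_⟩
  · rw [map_prod]
    refine Finset.prod_induction _ (· ∉ maximalIdeal B) (fun a b ha hb h => ?_) (fun h => ?_)
      fun y hy => hσ₁ y (htP y hy)
    · exact ((maximalIdeal.isMaximal B).isPrime.mem_or_mem h).elim ha hb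
    · exact (mem_maximalIdeal (1 : B)).mp h isUnit_one
  · rw [← ht] at hy
    induction hy using Submodule.span_induction with
    | mem y hy =>
      rw [← Finset.prod_erase_mul _ _ hy, mul_assoc]
      exact Ideal.mul_mem_left _ _ (hσ₂ y (htP y hy))
    | zero => simp
    | add x y _ _ hx hy => rw [mul_add]; exact add_mem hx hy
    | smul a x _ hx => rw [smul_eq_mul, mul_left_comm]; exact Ideal.mul_mem_left _ _ hx

/-- A standard smooth algebra over an algebraically closed field has at every closed point a flat
map to a power series ring. -/
theorem Algebra.IsStandardSmooth.exists_flat_mvPowerSeries {k A : Type} [Field k] [IsAlgClosed k]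
    [CommRing A] [Algebra k A] [Algebra.IsStandardSmooth k A] (m : Ideal A) [m.IsMaximal] :
    ∃ (n : ℕ) (φ : A →+* MvPowerSeries (Fin n) k), φ.Flat ∧
      (maximalIdeal (MvPowerSeries (Fin n) k)).comap φ = m := by
  have hbij : Function.Bijective (algebraMap k (A ⧸ m)) := by
    let := Ideal.Quotient.field m
    have : Algebra.FiniteType k (A ⧸ m) := inferInstance
    have : Module.Finite k (A ⧸ m) := finite_of_finite_type_of_isJacobsonRing k (A ⧸ m)
    exact ⟨(algebraMap k (A ⧸ m)).injective, IsAlgClosed.algebraMap_bijective_of_isIntegral.2⟩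
  let ε : (A ⧸ m) ≃ₐ[k] k := (AlgEquiv.ofBijective (Algebra.ofId k (A ⧸ m)) hbij).symm
  let ev : A →ₐ[k] k := ε.toAlgHom.comp (Ideal.Quotient.mkₐ k m)
  have hev : RingHom.ker ev = m := by
    ext a
    change ε (Ideal.Quotient.mk m a) = 0 ↔ _
    rw [EmbeddingLike.map_eq_zero_iff, Ideal.Quotient.eq_zero_iff_mem]
  obtain ⟨n, ψ, hψ, het⟩ := RingHom.IsStandardSmooth.exists_etale_mvPolynomial
    (f := algebraMap k A) (by rwa [RingHom.isStandardSmooth_algebraMap])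
  let c : Fin n → k := fun j => ev (ψ (.X j))
  let τ : MvPolynomial (Fin n) k ≃ₐ[k] MvPolynomial (Fin n) k :=
    AlgEquiv.ofAlgHom (MvPolynomial.aeval fun j => .X j - .C (c j))
      (MvPolynomial.aeval fun j => .X j + .C (c j)) (by ext; simp) (by ext; simp)
  let ψ' : MvPolynomial (Fin n) k →+* A := ψ.comp τ.toRingEquiv.toRingHom
  have het' : ψ'.Etale := RingHom.Etale.respectsIso.2 _ τ.toRingEquiv het
  have hψ'C (a : k) : ψ' (.C a) = algebraMap k A a := by
    rw [← hψ]
    simp [ψ', τ]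
  have hψ'X (j) : ev (ψ' (.X j)) = 0 := by
    have : ψ (.C (c j)) = algebraMap k A (c j) := congr($hψ (c j))
    have h2 : ψ' (.X j) = ψ (.X j) - ψ (.C (c j)) := by simp [ψ', τ]
    rw [h2, map_sub, this, AlgHom.commutes]
    exact sub_self _
  algebraize [ψ']
  let M := maximalIdeal (MvPowerSeries (Fin n) k)
  have hCC : RingHom.ker (MvPowerSeries.constantCoeff (σ := Fin n) (R := k)) = M := by
    ext p
    rw [RingHom.mem_ker, mem_maximalIdeal, mem_nonunits_iff,
      MvPowerSeries.isUnit_iff_constantCoeff, isUnit_iff_ne_zero, not_not]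
  have hsq : ∀ p : MvPolynomial (Fin n) k, ev (ψ' p) =
      MvPowerSeries.constantCoeff (p : MvPowerSeries (Fin n) k) := by
    intro p
    have : ev.toRingHom.comp ψ' = MvPowerSeries.constantCoeff.comp
        (MvPolynomial.coeToMvPowerSeries.ringHom (σ := Fin n) (R := k)) := by
      refine MvPolynomial.ringHom_ext (fun a => ?_) fun j => ?_
      · simp [hψ'C]
      · simp [hψ'X]
    exact congr($this p)
  let g₀ : A →ₐ[MvPolynomial (Fin n) k] MvPowerSeries (Fin n) k ⧸ M :=
    { (Ideal.Quotient.mk M).comp ((MvPowerSeries.C (σ := Fin n)).comp ev.toRingHom) with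
      commutes' := fun p => by
        change Ideal.Quotient.mk M (MvPowerSeries.C (ev (ψ' p))) = Ideal.Quotient.mk M p
        rw [Ideal.Quotient.eq, hsq, ← hCC, RingHom.mem_ker, map_sub, MvPowerSeries.constantCoeff_C,
          sub_self] }
  obtain ⟨g, hg⟩ := Algebra.FormallySmooth.exists_mkₐ_comp_eq_of_isAdicComplete
    (R := MvPolynomial (Fin n) k) g₀
  refine ⟨n, g.toRingHom, ?_, ?_⟩
  · let D := TensorProduct (MvPolynomial (Fin n) k) (MvPowerSeries (Fin n) k) A
    let h : D →ₐ[MvPowerSeries (Fin n) k] MvPowerSeries (Fin n) k :=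
      Algebra.TensorProduct.lift (AlgHom.id _ _) g fun _ _ => Commute.all _ _
    have h1 : h.toRingHom.Flat := by
      algebraize [h.toRingHom]
      have : IsScalarTower (MvPowerSeries (Fin n) k) D (MvPowerSeries (Fin n) k) :=
        .of_algebraMap_eq' h.comp_algebraMap.symm
      have : Algebra.Etale D (MvPowerSeries (Fin n) k) :=
        Algebra.Etale.of_restrictScalars (MvPowerSeries (Fin n) k) _ _
      change Module.Flat D (MvPowerSeries (Fin n) k)
      infer_instance
    have h2 : (Algebra.TensorProduct.includeRight :
        A →ₐ[MvPolynomial (Fin n) k] D).toRingHom.Flat := by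
      have h4 : (algebraMap A (TensorProduct (MvPolynomial (Fin n) k) A
          (MvPowerSeries (Fin n) k))).Flat := by
        rw [RingHom.flat_algebraMap_iff]
        infer_instance
      let e : TensorProduct (MvPolynomial (Fin n) k) A (MvPowerSeries (Fin n) k)
          ≃ₐ[MvPolynomial (Fin n) k] D :=
        Algebra.TensorProduct.comm (MvPolynomial (Fin n) k) A (MvPowerSeries (Fin n) k)
      have := h4.comp (RingHom.Flat.of_bijective (f := e.toRingEquiv.toRingHom) e.bijective)
      convert! this
    have h3 : g.toRingHom = h.toRingHom.comp (Algebra.TensorProduct.includeRight :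
        A →ₐ[MvPolynomial (Fin n) k] D).toRingHom := by
      refine RingHom.ext fun a => ?_
      exact ((Algebra.TensorProduct.lift_tmul (AlgHom.id _ _) g (fun _ _ => Commute.all _ _) 1 a).trans
        (by simp)).symm
    rw [h3]
    exact h2.comp h1
  · ext a
    have : Ideal.Quotient.mk M (g a) = Ideal.Quotient.mk M (MvPowerSeries.C (ev a)) := congr($hg a)
    rw [Ideal.Quotient.eq, ← hCC, RingHom.mem_ker, map_sub, MvPowerSeries.constantCoeff_C, sub_eq_zero] at this
    rw [Ideal.mem_comap, ← hev]
    change g a ∈ M ↔ _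
    rw [← hCC, RingHom.mem_ker, this, RingHom.mem_ker]

/-- Prime ideals of height one of a standard smooth domain over an algebraically closed field are
locally principal. -/
theorem Algebra.IsStandardSmooth.exists_locally_principal {k A : Type} [Field k] [IsAlgClosed k]
    [CommRing A] [IsDomain A] [Algebra k A] [Algebra.IsStandardSmooth k A] (m : Ideal A) [m.IsMaximal]
    (P : Ideal A) [P.IsPrime] (hP : P ≠ ⊥)
    (hmin : ∀ P' : Ideal A, P'.IsPrime → P' ≤ P → P' ≠ ⊥ → P' = P) :
    ∃ F ∈ P, ∃ s ∉ m, ∀ y ∈ P, s * y ∈ Ideal.span {F} := by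
  obtain ⟨n, φ, hφ, rfl⟩ := exists_flat_mvPowerSeries (k := k) m
  have : IsDomain (MvPowerSeries (Fin n) k) := NoZeroDivisors.to_isDomain _
  have : IsNoetherianRing A := Algebra.FiniteType.isNoetherianRing k A
  have : Infinite k := inferInstance
  algebraize [φ]
  exact Ideal.exists_locally_principal_of_flat (B := MvPowerSeries (Fin n) k) P hP hmin

end

section
open IsLocalRing

/-- The equation of a hypersurface that is smooth over `R` at a point has a nonvanishing derivative
at this point. -/
theorem Algebra.FormallySmooth.exists_isUnit_dual_D {R A A' D : Type*} [CommRing R] [CommRing A]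
    [CommRing A'] [CommRing D] [Nontrivial D] [Algebra R A] [Algebra R A'] [Algebra A A'] [IsScalarTower R A A']
    [Algebra R D] [IsLocalRing A'] [Algebra.FormallySmooth R D] (π : A' →ₐ[R] D)
    (hπ : Function.Surjective π) (F : A) (hker : RingHom.ker π = Ideal.span {algebraMap A A' F})
    (hF : algebraMap A A' F ≠ 0) [Module.Free A Ω[A⁄R]] [Module.Finite A Ω[A⁄R]] :
    ∃ t : Module.Dual A Ω[A⁄R], IsUnit (algebraMap A A' (t (KaehlerDifferential.D R A F))) := by
  by_contra! H
  set F' := algebraMap A A' F with hF'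
  let J : Ideal A' := Ideal.span {F' ^ 2}
  have hπF : π F' = 0 := by
    rw [← RingHom.mem_ker, hker]
    exact Ideal.mem_span_singleton_self _
  let π' : (A' ⧸ J) →ₐ[R] D := Ideal.Quotient.liftₐ J π fun a ha => by
    obtain ⟨b, rfl⟩ := Ideal.mem_span_singleton.mp ha
    rw [map_mul, map_pow, hπF]; ring
  have hπ'm (a : A') : π' (Ideal.Quotient.mk J a) = π a := rfl
  have hπ' : Function.Surjective π' := fun d => by
    obtain ⟨a, rfl⟩ := hπ d
    exact ⟨Ideal.Quotient.mk J a, rfl⟩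
  have hker' (x : A' ⧸ J) (hx : π' x = 0) : ∃ a, x = Ideal.Quotient.mk J (a * F') := by
    obtain ⟨a, rfl⟩ := Ideal.Quotient.mk_surjective x
    rw [hπ'm, ← RingHom.mem_ker, hker] at hx
    obtain ⟨b, rfl⟩ := Ideal.mem_span_singleton.mp hx
    exact ⟨b, by rw [mul_comm]⟩
  have hsq (x y : A' ⧸ J) (hx : π' x = 0) (hy : π' y = 0) : x * y = 0 := by
    obtain ⟨a, rfl⟩ := hker' x hx
    obtain ⟨b, rfl⟩ := hker' y hy
    rw [← map_mul, Ideal.Quotient.eq_zero_iff_mem, Ideal.mem_span_singleton]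
    exact ⟨a * b, by ring⟩
  have hnil : IsNilpotent (RingHom.ker (π' : (A' ⧸ J) →+* D)) := by
    refine ⟨2, ?_⟩
    rw [pow_two, Ideal.zero_eq_bot, eq_bot_iff, Ideal.mul_le]
    intro x hx y hy
    exact hsq x y hx hy
  let σ : D →ₐ[R] A' ⧸ J := Algebra.FormallySmooth.liftOfSurjective (AlgHom.id R D) π' hπ' hnil
  have hσ (d : D) : π' (σ d) = d :=
    Algebra.FormallySmooth.liftOfSurjective_apply (AlgHom.id R D) π' hπ' hnil d
  let θ : A →ₐ[R] A' ⧸ J := (Ideal.Quotient.mkₐ R J).comp (IsScalarTower.toAlgHom R A A')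
  let ζ : A →ₐ[R] A' ⧸ J := σ.comp (π.comp (IsScalarTower.toAlgHom R A A'))
  have hθζ (a : A) : π' (θ a - ζ a) = 0 := by
    rw [map_sub, sub_eq_zero]
    exact (hσ _).symm
  let δ : Derivation R A (A' ⧸ J) := Derivation.mk' (θ.toLinearMap - ζ.toLinearMap) fun a b => by
    change θ (a * b) - ζ (a * b) = a • (θ b - ζ b) + b • (θ a - ζ a)
    have hs (a : A) (x : A' ⧸ J) : a • x = θ a * x := by
      rw [Algebra.smul_def]; rfl
    rw [hs, hs, map_mul, map_mul]
    linear_combination -hsq _ _ (hθζ a) (hθζ b)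
  have hδF : δ F = Ideal.Quotient.mk J F' := by
    change θ F - ζ F = _
    have : ζ F = 0 := by
      change σ (π F') = 0
      rw [hπF, map_zero]
    rw [this, sub_zero]
    rfl
  have hrange (ω : Ω[A⁄R]) : π' (δ.liftKaehlerDifferential ω) = 0 := by
    have hω : ω ∈ Submodule.span A (Set.range (KaehlerDifferential.D R A)) := by
      rw [KaehlerDifferential.span_range_derivation]; trivial
    induction hω using Submodule.span_induction with
    | mem x hx =>
      obtain ⟨a, rfl⟩ := hx
      rw [Derivation.liftKaehlerDifferential_comp_D]
      exact hθζ a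
    | zero => simp
    | add x y _ _ hx hy => rw [map_add, map_add, hx, hy, add_zero]
    | smul a x _ hx => rw [map_smul, Algebra.smul_def, map_mul, hx, mul_zero]
  let b := Module.Free.chooseBasis A Ω[A⁄R]
  have hsum := b.sum_repr (KaehlerDifferential.D R A F)
  have h1 := congrArg δ.liftKaehlerDifferential hsum
  rw [Derivation.liftKaehlerDifferential_comp_D, hδF, map_sum] at h1
  choose c hc using fun j => hker' _ (hrange (b j))
  let e : A' := ∑ j, algebraMap A A' (b.repr (KaehlerDifferential.D R A F) j) * c j
  have h2 : Ideal.Quotient.mk J (e * F') = Ideal.Quotient.mk J F' := by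
    rw [← h1, Finset.sum_mul, map_sum]
    refine Finset.sum_congr rfl fun j _ => ?_
    rw [map_smul, hc, Algebra.smul_def, mul_assoc, map_mul]
    rfl
  have he : e ∈ maximalIdeal A' := by
    refine Submodule.sum_mem _ fun j _ => Ideal.mul_mem_right _ _ ?_
    exact (mem_maximalIdeal _).mpr (H (b.coord j))
  have hF'm : F' ∈ maximalIdeal A' := by
    refine (mem_maximalIdeal _).mpr fun h => ?_
    have := h.map π
    rw [hπF] at this
    exact not_isUnit_zero this
  rw [eq_comm, Ideal.Quotient.eq, Ideal.mem_span_singleton] at h2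
  obtain ⟨r, hr⟩ := h2
  have h3 : (1 - (e + F' * r)) * F' = 0 := by linear_combination hr
  have h4 : IsUnit (1 - (e + F' * r)) :=
    isUnit_one_sub_self_of_mem_nonunits _ ((mem_maximalIdeal _).mp
      (add_mem he (Ideal.mul_mem_right _ _ hF'm)))
  exact hF (h4.mul_right_eq_zero.mp h3)

end

noncomputable section

namespace AlgebraicGeometry.Scheme.IdealSheafData

theorem ideal_comap_of_isAffine {X Y : Scheme.{u}} [IsAffine X] [IsAffine Y] (f : X ⟶ Y)
    (J : Y.IdealSheafData) :
    (J.comap f).ideal ⟨⊤, isAffineOpen_top X⟩ =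
      (J.ideal ⟨⊤, isAffineOpen_top Y⟩).map f.appTop.hom := by
  have key (K : Ideal Γ(X, ⊤)) : (J.comap f).ideal ⟨⊤, isAffineOpen_top X⟩ ≤ K ↔
      (J.ideal ⟨⊤, isAffineOpen_top Y⟩).map f.appTop.hom ≤ K := by
    have hK : (ofIdealTop K).ideal ⟨⊤, isAffineOpen_top X⟩ = K := by simp
    rw [Ideal.map_le_iff_le_comap]
    constructor
    · intro h
      have h1 : J.comap f ≤ ofIdealTop K := le_of_isAffine (by rwa [hK])
      rw [← le_map_iff_comap_le] at h1
      have h2 := h1 ⟨⊤, isAffineOpen_top Y⟩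
      rw [ideal_map_of_isAffineHom] at h2
      exact h2.trans (Ideal.comap_mono hK.le)
    · intro h
      have h1 : J ≤ (ofIdealTop K).map f := by
        refine le_of_isAffine ?_
        rw [ideal_map_of_isAffineHom]
        exact h.trans (Ideal.comap_mono hK.ge)
      rw [le_map_iff_comap_le] at h1
      exact (h1 _).trans hK.le
  exact le_antisymm ((key _).mpr le_rfl) ((key _).mp le_rfl)

theorem ideal_comap_of_image_eq {X Y : Scheme.{u}} (f : X ⟶ Y) [IsOpenImmersion f]
    (J : Y.IdealSheafData) (U : Y.affineOpens) (V : X.affineOpens) (h : U.1 = f ''ᵁ V.1)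
    (h' : V.1 ≤ f ⁻¹ᵁ U.1) :
    (J.comap f).ideal V = (J.ideal U).map (f.appLE U V h').hom := by
  obtain ⟨U, hU⟩ := U
  obtain rfl : U = f ''ᵁ V.1 := h
  rw [ideal_comap_of_isOpenImmersion]
  have e : f.appLE (f ''ᵁ V.1) V h' = (f.appIso V).hom := by rw [Scheme.Hom.appIso_hom']
  change _ = (J.ideal ⟨f ''ᵁ V.1, hU⟩).map (f.appLE (f ''ᵁ V.1) V h').hom
  rw [e]
  have := Ideal.comap_symm (I := J.ideal ⟨f ''ᵁ V.1, hU⟩) (f.appIso V.1).commRingCatIsoToRingEquiv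
  exact this

theorem ideal_comap {X Y : Scheme.{u}} (f : X ⟶ Y) (J : Y.IdealSheafData) (U : Y.affineOpens)
    (V : X.affineOpens) (h : V.1 ≤ f ⁻¹ᵁ U.1) :
    (J.comap f).ideal V = (J.ideal U).map (f.appLE U V h).hom := by
  have : IsAffine V.1 := V.2
  have : IsAffine U.1 := U.2
  have e : f.resLE U.1 V.1 h ≫ U.1.ι = V.1.ι ≫ f := f.resLE_comp_ι h
  have h1 := ideal_comap_of_isAffine (f.resLE U.1 V.1 h) (J.comap U.1.ι)
  have hV : (⊤ : V.1.toScheme.Opens) ≤ V.1.ι ⁻¹ᵁ V.1 := by simp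
  have hU : (⊤ : U.1.toScheme.Opens) ≤ U.1.ι ⁻¹ᵁ U.1 := by simp
  rw [← comap_comp, e, comap_comp,
    ideal_comap_of_image_eq V.1.ι _ V ⟨⊤, isAffineOpen_top _⟩ (by simp) hV,
    ideal_comap_of_image_eq U.1.ι _ U ⟨⊤, isAffineOpen_top _⟩ (by simp) hU, Ideal.map_map,
    ← CommRingCat.hom_comp] at h1
  have e2 : U.1.ι.appLE U.1 ⊤ hU ≫ (f.resLE U.1 V.1 h).appTop =
      f.appLE U V h ≫ V.1.ι.appLE V.1 ⊤ hV := by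
    have hT : (⊤ : V.1.toScheme.Opens) ≤ (f.resLE U.1 V.1 h) ⁻¹ᵁ (⊤ : U.1.toScheme.Opens) :=
      fun _ _ => trivial
    have e3 : (f.resLE U.1 V.1 h).appTop = (f.resLE U.1 V.1 h).appLE ⊤ ⊤ hT :=
      Scheme.Hom.app_eq_appLE _
    rw [e3, Scheme.Hom.appLE_comp_appLE, Scheme.Hom.appLE_comp_appLE]
    simp only [e]
  erw [e2] at h1
  rw [CommRingCat.hom_comp, ← Ideal.map_map] at h1
  have hiso : IsIso (V.1.ι.appLE V.1 ⊤ hV) := by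
    have : V.1.ι.appLE V.1 ⊤ hV = V.1.topIso.inv := by
      simp [Scheme.Hom.appLE, Scheme.Opens.topIso]
      exact (X.presheaf.map_comp _ _).symm
    rw [this]
    infer_instance
  have hb := ConcreteCategory.bijective_of_isIso (V.1.ι.appLE V.1 ⊤ hV)
  have := congrArg (Ideal.comap (V.1.ι.appLE V.1 ⊤ hV).hom) h1
  erw [Ideal.comap_map_of_bijective _ hb, Ideal.comap_map_of_bijective _ hb] at this
  exact this

theorem le_ker_of_isReduced {X Y : Scheme.{u}} [IsReduced X] (f : X ⟶ Y) (J : Y.IdealSheafData)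
    (h : Set.range f ⊆ J.support) : J ≤ f.ker := by
  rw [← map_bot, le_map_iff_comap_le, le_bot_iff, ← support_eq_top_iff, support_comap]
  refine top_le_iff.mp fun x _ => h ⟨x, rfl⟩

theorem mem_ideal_vanishingIdeal_closure {X : Scheme.{u}} (η : X) (U : X.affineOpens)
    (f : Γ(X, U.1)) :
    f ∈ (vanishingIdeal ⟨closure {η}, isClosed_closure⟩).ideal U ↔ η ∉ X.basicOpen f := by
  rw [vanishingIdeal_ideal, PrimeSpectrum.mem_vanishingIdeal]
  constructor
  · intro h hη
    have hU : η ∈ U.1 := X.basicOpen_le f hη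
    obtain ⟨y, rfl⟩ : η ∈ Set.range U.2.fromSpec := U.2.range_fromSpec.ge hU
    have h1 := h y (subset_closure rfl)
    have : y ∈ U.2.fromSpec ⁻¹ᵁ X.basicOpen f := hη
    rw [U.2.fromSpec_preimage_basicOpen] at this
    exact this h1
  · intro h y hy
    by_contra hf
    have h1 : U.2.fromSpec y ∈ X.basicOpen f := by
      change y ∈ U.2.fromSpec ⁻¹ᵁ X.basicOpen f
      rw [U.2.fromSpec_preimage_basicOpen]
      exact hf
    exact h ((specializes_iff_mem_closure.mpr hy).mem_open (X.basicOpen f).2 h1)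

end AlgebraicGeometry.Scheme.IdealSheafData

namespace RelConormal

theorem IsInvertibleIdeal.exists_le {T : Scheme.{u}} {J : T.IdealSheafData}
    (hJ : IsInvertibleIdeal J) {x : T} {O : T.Opens} (hx : x ∈ O) :
    ∃ V : T.affineOpens, x ∈ V.1 ∧ V.1 ≤ O ∧
      ∃ f ∈ nonZeroDivisors Γ(T, V.1), J.ideal V = Ideal.span {f} := by
  obtain ⟨U, hxU, f, hf, h⟩ := hJ x
  obtain ⟨r, hr, hxr⟩ := U.2.exists_basicOpen_le (⟨x, hx⟩ : O) hxU
  refine ⟨T.affineBasicOpen r, hxr, hr, T.presheaf.map (homOfLE (T.basicOpen_le r)).op f, ?_, ?_⟩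
  · have := U.2.isLocalization_basicOpen r
    exact IsLocalization.map_nonZeroDivisors_le (.powers r) Γ(T, T.basicOpen r) ⟨f, hf, rfl⟩
  · rw [← J.map_ideal (U := T.affineBasicOpen r) (V := U) (T.basicOpen_le r), h, Ideal.map_span,
      Set.image_singleton]
    rfl

theorem IsInvertibleIdeal.comap_of_isOpenImmersion {T T' : Scheme.{u}} {J : T.IdealSheafData}
    (hJ : IsInvertibleIdeal J) (j : T' ⟶ T) [IsOpenImmersion j] :
    IsInvertibleIdeal (J.comap j) := by
  intro x
  obtain ⟨V, hxV, hV, f, hf, h⟩ := hJ.exists_le (x := j x) (O := j.opensRange) ⟨x, rfl⟩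
  have hV' : j ''ᵁ j ⁻¹ᵁ V.1 = V.1 := by
    rw [Scheme.Hom.image_preimage_eq_opensRange_inf, inf_eq_right.mpr hV]
  have hiso : IsIso (j.appLE V.1 (j ⁻¹ᵁ V.1) le_rfl) := by
    rw [← Scheme.Hom.app_eq_appLE]
    exact Scheme.Hom.isIso_app j V.1 hV
  have hb := ConcreteCategory.bijective_of_isIso (j.appLE V.1 (j ⁻¹ᵁ V.1) le_rfl)
  refine ⟨⟨j ⁻¹ᵁ V.1, V.2.preimage_of_isOpenImmersion j hV⟩, hxV, j.appLE V.1 (j ⁻¹ᵁ V.1) le_rfl f, ?_, ?_⟩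
  · rw [mem_nonZeroDivisors_iff_right] at hf ⊢
    intro y hy
    obtain ⟨z, rfl⟩ := hb.2 y
    rw [← map_mul] at hy
    rw [hf z (hb.1 (hy.trans (map_zero _).symm)), map_zero]
  · rw [Scheme.IdealSheafData.ideal_comap j J V _ le_rfl, h, Ideal.map_span, Set.image_singleton]

end RelConormal

end

noncomputable section

theorem AlgebraicGeometry.IsAffineOpen.appLE_SpecMap_fromSpec {W : Scheme.{u}} {U : W.Opens}
    (hU : IsAffineOpen U) {B : CommRingCat.{u}} (ψ : Γ(W, U) ⟶ B)
    (h : ⊤ ≤ (Spec.map ψ ≫ hU.fromSpec) ⁻¹ᵁ U) :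
    (Spec.map ψ ≫ hU.fromSpec).appLE U ⊤ h = ψ ≫ (Scheme.ΓSpecIso B).inv := by
  have h1 : ⊤ ≤ hU.fromSpec ⁻¹ᵁ U := by rw [hU.fromSpec_preimage_self]
  have h2 : ⊤ ≤ (Spec.map ψ) ⁻¹ᵁ (⊤ : (Spec Γ(W, U)).Opens) := fun _ _ => trivial
  have e1 : hU.fromSpec.appLE U ⊤ h1 = (Scheme.ΓSpecIso Γ(W, U)).inv := by
    rw [Scheme.Hom.appLE, hU.fromSpec_app_self, Category.assoc, ← Functor.map_comp]
    exact (congrArg _ (CategoryTheory.Functor.map_id _ _)).trans (Category.comp_id _)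
  have e2 : (Spec.map ψ).appLE ⊤ ⊤ h2 = (Spec.map ψ).appTop := (Scheme.Hom.app_eq_appLE _).symm
  rw [← Scheme.Hom.appLE_comp_appLE _ _ U ⊤ ⊤ h1 h2, e1, e2]
  exact (Scheme.ΓSpecIso_inv_naturality ψ).symm

namespace RelConormal

variable {W S X : Scheme.{u}} {q : W ⟶ S} (i : X ⟶ W)

namespace Chart

theorem tangent_induction {e c : Chart q} (h : e ≤ c) {p : e.Tangent → Prop} (zero : p 0)
    (res : ∀ t, p (AffinePair.res h t)) (smul : ∀ (a : Γ(W, e.U)) t, p t → p (a • t))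
    (add : ∀ s t, p s → p t → p (s + t)) (t : e.Tangent) : p t := by
  let := (W.presheaf.map (homOfLE h.2).op).hom.toAlgebra
  let := (S.presheaf.map (homOfLE h.1).op).hom.toAlgebra
  let := (q.appLE c.V e.U (h.2.trans c.le)).hom.toAlgebra
  have := AffinePair.isScalarTower_left h
  have := AffinePair.isScalarTower_right h
  have : Algebra.FormallyEtale Γ(W, c.U) Γ(W, e.U) :=
    formallyEtale_res e.isAffineOpen_U c.isAffineOpen_U h.2
  have : Algebra.FormallyEtale Γ(S, c.V) Γ(S, e.V) :=
    formallyEtale_res e.isAffineOpen_V c.isAffineOpen_V h.1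
  have := c.free
  have := c.finite
  exact (isBaseChange_vfMap Γ(S, c.V) Γ(S, e.V) Γ(W, c.U) Γ(W, e.U)).inductionOn t p zero res smul add

theorem equations_of_le {e c : Chart q} (h : e ≤ c) :
    e.equations i = (c.equations i).map (W.presheaf.map (homOfLE h.2).op).hom :=
  (i.ker.map_ideal (U := ⟨e.U, e.isAffineOpen_U⟩) (V := ⟨c.U, c.isAffineOpen_U⟩) h.2).symm

theorem deriv_mul (c : Chart q) (t : c.Tangent) (F G : Γ(W, c.U)) :
    c.deriv t (F * G) = F * c.deriv t G + G * c.deriv t F := by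
  simp [deriv]

theorem deriv_add (c : Chart q) (t : c.Tangent) (F G : Γ(W, c.U)) :
    c.deriv t (F + G) = c.deriv t F + c.deriv t G := by
  simp [deriv]

theorem deriv_res {e c : Chart q} (h : e ≤ c) (t : c.Tangent) (F : Γ(W, c.U)) :
    e.deriv (AffinePair.res h t) (W.presheaf.map (homOfLE h.2).op F) =
      W.presheaf.map (homOfLE h.2).op (c.deriv t F) :=
  AffinePair.res_D h t F

/-- The ideal of `Sing(X/S)` on a chart. -/
def singIdeal (c : Chart q) : Ideal Γ(W, c.U) :=
  c.equations i ⊔ Ideal.span {x | ∃ t : c.Tangent, ∃ F ∈ c.equations i, c.deriv t F = x}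

variable {i} in
theorem deriv_mem_singIdeal (c : Chart q) (t : c.Tangent) {F : Γ(W, c.U)}
    (hF : F ∈ c.equations i) : c.deriv t F ∈ c.singIdeal i :=
  Ideal.mem_sup_right (Ideal.subset_span ⟨t, F, hF, rfl⟩)

theorem singIdeal_of_le {e c : Chart q} (h : e ≤ c) :
    e.singIdeal i = (c.singIdeal i).map (W.presheaf.map (homOfLE h.2).op).hom := by
  set r := (W.presheaf.map (homOfLE h.2).op).hom
  apply le_antisymm
  · have hI : e.equations i ≤ (c.singIdeal i).map r := by
      rw [equations_of_le i h]
      exact Ideal.map_mono le_sup_left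
    refine sup_le hI (Ideal.span_le.mpr ?_)
    rintro _ ⟨t, G, hG, rfl⟩
    change e.deriv t G ∈ (c.singIdeal i).map r
    have hG' := hG
    rw [equations_of_le i h] at hG'
    induction hG' using Submodule.span_induction with
    | mem x hx =>
      obtain ⟨F, hF, rfl⟩ := hx
      induction t using tangent_induction h with
      | zero => simp [deriv]
      | res t =>
        erw [deriv_res h t F]
        exact Ideal.mem_map_of_mem r (deriv_mem_singIdeal c t hF)
      | smul a t ht => exact Ideal.mul_mem_left _ _ ht
      | add s t hs ht => exact add_mem hs ht
    | zero => simp [deriv]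
    | add x y hx hy ihx ihy =>
      rw [deriv_add]
      have hx' : x ∈ e.equations i := (equations_of_le i h).ge hx
      have hy' : y ∈ e.equations i := (equations_of_le i h).ge hy
      exact add_mem (ihx hx') (ihy hy')
    | smul a x hx ih =>
      rw [smul_eq_mul, deriv_mul]
      have hx' : x ∈ e.equations i := (equations_of_le i h).ge hx
      exact add_mem (Ideal.mul_mem_left _ _ (ih hx')) (Ideal.mul_mem_right _ _ (hI hx'))
  · rw [singIdeal, Ideal.map_sup, ← equations_of_le i h, Ideal.map_span]
    refine sup_le le_sup_left (Ideal.span_le.mpr ?_)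
    rintro _ ⟨_, ⟨t, F, hF, rfl⟩, rfl⟩
    erw [← deriv_res h t F]
    refine deriv_mem_singIdeal e _ ?_
    rw [equations_of_le i h]
    exact Ideal.mem_map_of_mem r hF

/-- The singular scheme of a chart, mapped to `W`. -/
def singι (c : Chart q) : Spec (.of (Γ(W, c.U) ⧸ c.singIdeal i)) ⟶ W :=
  Spec.map (CommRingCat.ofHom (Ideal.Quotient.mk (c.singIdeal i))) ≫ c.isAffineOpen_U.fromSpec

theorem top_le_singι_preimage (c : Chart q) : ⊤ ≤ c.singι i ⁻¹ᵁ c.U := fun y _ => by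
  change (Spec.map (CommRingCat.ofHom (Ideal.Quotient.mk (c.singIdeal i))) ≫
    c.isAffineOpen_U.fromSpec) y ∈ c.U
  rw [Scheme.Hom.comp_apply]
  exact c.isAffineOpen_U.range_fromSpec.le ⟨_, rfl⟩

theorem singι_appLE_eq_zero_iff (c : Chart q) (F : Γ(W, c.U)) :
    (c.singι i).appLE c.U ⊤ (c.top_le_singι_preimage i) F = 0 ↔ F ∈ c.singIdeal i := by
  have h := c.isAffineOpen_U.appLE_SpecMap_fromSpec
    (CommRingCat.ofHom (Ideal.Quotient.mk (c.singIdeal i))) (c.top_le_singι_preimage i)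
  have h' : (c.singι i).appLE c.U ⊤ (c.top_le_singι_preimage i) F = 
    (Scheme.ΓSpecIso (CommRingCat.of (Γ(W, c.U) ⧸ c.singIdeal i))).inv (Ideal.Quotient.mk _ F) :=
    congr($h F)
  rw [h', ← Ideal.Quotient.eq_zero_iff_mem]
  exact map_eq_zero_iff _ (ConcreteCategory.bijective_of_isIso (Scheme.ΓSpecIso
    (CommRingCat.of (Γ(W, c.U) ⧸ c.singIdeal i))).inv).1

theorem singIdeal_le_ker_singι [QuasiSeparatedSpace W] (c d : Chart q) :
    d.singIdeal i ≤ (c.singι i).ker.ideal ⟨d.U, d.isAffineOpen_U⟩ := by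
  have hqc : QuasiCompact (c.singι i) := inferInstance
  rw [Scheme.Hom.ker_apply]
  intro F hF
  rw [RingHom.mem_ker]
  have hy (y : c.singι i ⁻¹ᵁ d.U) : ∃ e : Chart q, e ≤ c ∧ e ≤ d ∧ c.singι i y.1 ∈ e.U :=
    exists_le c d (c.top_le_singι_preimage i trivial) y.2
  choose e hec hed hye using hy
  refine TopCat.Sheaf.eq_of_locally_eq' (Spec _).sheaf (fun y => c.singι i ⁻¹ᵁ (e y).U)
    (c.singι i ⁻¹ᵁ d.U) (fun y => homOfLE ((c.singι i).preimage_mono (hed y).2)) ?_ _ _ fun y => ?_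
  · intro y hy
    exact TopologicalSpace.Opens.mem_iSup.mpr ⟨⟨y, hy⟩, hye _⟩
  · have h1 : (e y).singIdeal i ≤ RingHom.ker ((c.singι i).app (e y).U).hom := by
      rw [singIdeal_of_le i (hec y), Ideal.map_le_iff_le_comap]
      intro G hG
      rw [Ideal.mem_comap, RingHom.mem_ker, ← CategoryTheory.comp_apply,
        Scheme.Hom.app_eq_appLE, Scheme.Hom.map_appLE]
      have h2 := (c.singι_appLE_eq_zero_iff i G).mpr hG
      rw [← Scheme.Hom.appLE_map _ (c.top_le_singι_preimage i) (homOfLE le_top).op,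
        CategoryTheory.comp_apply, h2, map_zero]
    have h2 : W.presheaf.map (homOfLE (hed y).2).op F ∈ (e y).singIdeal i := by
      rw [singIdeal_of_le i (hed y)]
      exact Ideal.mem_map_of_mem _ hF
    have h3 := h1 h2
    rw [RingHom.mem_ker, ← CategoryTheory.comp_apply, Scheme.Hom.naturality,
      CategoryTheory.comp_apply] at h3
    exact h3.trans (map_zero _).symm

theorem ker_singι_ideal_le (c : Chart q) :
    (c.singι i).ker.ideal ⟨c.U, c.isAffineOpen_U⟩ ≤ c.singIdeal i := by
  intro F hF
  have h1 : (c.singι i).app c.U F = 0 := (c.singι i).ideal_ker_le ⟨c.U, c.isAffineOpen_U⟩ hF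
  rw [← singι_appLE_eq_zero_iff, Scheme.Hom.appLE, CategoryTheory.comp_apply, h1, map_zero]

variable (q) in
theorem relSingIdeal_ideal [CompactSpace W] [QuasiSeparatedSpace W] [Smooth q] (c : Chart q) :
    (relSingIdeal q i).ideal ⟨c.U, c.isAffineOpen_U⟩ = c.singIdeal i := by
  obtain ⟨s, hs⟩ := isCompact_univ.elim_finite_subcover (fun c : Chart q => (c.U : Set W))
    (fun c => c.U.2) (fun w _ => Set.mem_iUnion.mpr (exists_mem w))
  classical
  let s' : Set (Chart q) := insert c (s : Set (Chart q))
  have hfin : Finite s' := (s.finite_toSet.insert c)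
  let J := ⨅ d : s', (d.1.singι i).ker
  have hJ (d : Chart q) : d.singIdeal i ≤ J.ideal ⟨d.U, d.isAffineOpen_U⟩ := by
    rw [Scheme.IdealSheafData.ideal_iInf]
    simp only [iInf_apply]
    exact le_iInf fun e => singIdeal_le_ker_singι i e.1 d
  have hJ' (d : s') : J.ideal ⟨d.1.U, d.1.isAffineOpen_U⟩ ≤ d.1.singIdeal i :=
    (iInf_le (fun d : s' => (d.1.singι i).ker) d _).trans (ker_singι_ideal_le i d.1)
  have h1 : relSingIdeal q i = J := by
    apply le_antisymm
    · exact sInf_le fun d F hF => ⟨hJ d (Ideal.mem_sup_left hF),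
        fun t => hJ d (deriv_mem_singIdeal d t hF)⟩
    · refine le_sInf fun K hK => ?_
      refine Scheme.IdealSheafData.le_of_iSup_eq_top
        (fun d : s' => ⟨d.1.U, d.1.isAffineOpen_U⟩) ?_ fun d => (hJ' d).trans ?_
      · refine top_le_iff.mp fun w _ => ?_
        obtain ⟨d, hd, hw⟩ := Set.mem_iUnion₂.mp (hs (Set.mem_univ w))
        exact TopologicalSpace.Opens.mem_iSup.mpr ⟨⟨d, Set.mem_insert_of_mem _ hd⟩, hw⟩
      · refine sup_le (fun F hF => (hK d.1 F hF).1) (Ideal.span_le.mpr ?_)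
        rintro _ ⟨t, F, hF, rfl⟩
        exact (hK d.1 F hF).2 t
  rw [h1]
  exact (hJ' ⟨c, Set.mem_insert _ _⟩).antisymm (hJ c)

end Chart
end RelConormal

end

noncomputable section

namespace RelConormal

open SymProj

theorem SymProj.mk_mem_iff {A T : Type u} [CommRing A] [AddCommGroup T] [Module A T]
    {s : SymmetricAlgebra A T} (hs : s ∈ grading A T 1) (y : Spec (.of (Away (grading A T) s)))
    (k : ℕ) {x : SymmetricAlgebra A T} (hx : x ∈ grading A T (k • 1)) :
    Away.mk (grading A T) hs k x hx ∈ y.asIdeal ↔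
      x ∈ (Proj.awayι (grading A T) s hs one_pos y).asHomogeneousIdeal := by
  have key (k : ℕ) (hk : 0 < k) (x : SymmetricAlgebra A T) (hx : x ∈ grading A T (k • 1)) :
      Away.mk (grading A T) hs k x hx ∈ y.asIdeal ↔
        x ∈ (Proj.awayι (grading A T) s hs one_pos y).asHomogeneousIdeal := by
    have hx' : x ∈ grading A T k := by simpa using hx
    have h := Proj.awayι_preimage_basicOpen (grading A T) hs one_pos hx' hk
    have h1 : y ∈ Proj.awayι (grading A T) s hs one_pos ⁻¹ᵁ Proj.basicOpen (grading A T) x ↔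
      x ∉ (Proj.awayι (grading A T) s hs one_pos y).asHomogeneousIdeal := Iff.rfl
    rw [h] at h1
    have h2 : Away.isLocalizationElem hs hx' = Away.mk (grading A T) hs k x hx := by
      ext
      rw [Away.val_mk, Away.val_mk]
      simp
    rw [h2] at h1
    exact not_iff_not.mp h1
  have hsx : s * x ∈ grading A T ((k + 1) • 1) := by
    rw [add_smul, add_comm, one_smul]
    exact SetLike.mul_mem_graded hs hx
  have h3 : Away.mk (grading A T) hs k x hx = Away.mk (grading A T) hs (k + 1) (s * x) hsx := by
    ext
    rw [Away.val_mk, Away.val_mk, Localization.mk_eq_mk_iff, Localization.r_iff_exists]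
    exact ⟨1, by simp only [pow_succ]; ring⟩
  rw [h3, key _ k.succ_pos]
  have h4 : y ∈ Proj.awayι (grading A T) s hs one_pos ⁻¹ᵁ Proj.basicOpen (grading A T) s := by
    rw [← Proj.opensRange_awayι (grading A T) s hs one_pos]
    exact ⟨y, rfl⟩
  have h5 : s ∉ (Proj.awayι (grading A T) s hs one_pos y).asHomogeneousIdeal := h4
  refine ⟨fun h => ?_, fun h => Ideal.mul_mem_left _ _ h⟩
  exact ((Proj.awayι (grading A T) s hs one_pos y).isPrime.mem_or_mem h).resolve_left h5

variable {W S X : Scheme.{u}} (q : W ⟶ S) [Smooth q]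

namespace projCotangentBundle

instance (c : Chart q) : IsOpenImmersion (chart q c) :=
  (Chart.projGluing q).cover.map_prop c

theorem chart_proj (c : Chart q) :
    chart q c ≫ proj q = toSpec Γ(W, c.U) c.Tangent ≫ c.isAffineOpen_U.fromSpec :=
  (Chart.projGluing q).ι_toBase c

theorem opensRange_chart (c : Chart q) : (chart q c).opensRange = proj q ⁻¹ᵁ c.U := by
  have h := (Chart.projGluing q).toBase_preimage_eq_opensRange_ι c
  have h' : ((Chart.cover q).f c).opensRange = c.U := c.isAffineOpen_U.opensRange_fromSpec
  rw [h'] at h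
  exact h.symm

theorem map_chart {c d : Chart q} (h : c ≤ d) :
    Proj.map (AffinePair.symRes h) (AffinePair.symRes_irrelevant h d.free d.finite) ≫ chart q d =
      chart q c :=
  (Chart.projGluing q).cover.trans_map (i := c) (j := d) (homOfLE h : (c : Chart q) ⟶ d)

/-- The affine open of `ℙT^∨(W/S)` where a vector field `t` on a chart does not vanish. -/
def piece (c : Chart q) (t : c.Tangent) :
    Spec (.of (Away c.symGrading (SymmetricAlgebra.ι Γ(W, c.U) c.Tangent t))) ⟶ projCotangentBundle q :=
  Proj.awayι c.symGrading _ (ι_mem t) one_pos ≫ chart q c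

instance (c : Chart q) (t : c.Tangent) : IsOpenImmersion (piece q c t) :=
  inferInstanceAs (IsOpenImmersion (_ ≫ _))

theorem piece_proj (c : Chart q) (t : c.Tangent) :
    piece q c t ≫ proj q =
      Spec.map (CommRingCat.ofHom (toAway c.Tangent (SymmetricAlgebra.ι Γ(W, c.U) c.Tangent t))) ≫
        c.isAffineOpen_U.fromSpec := by
  exact (Category.assoc _ _ _).trans ((congrArg (Proj.awayι c.symGrading _ (ι_mem t) one_pos ≫ ·)
    (chart_proj q c)).trans ((Category.assoc _ _ _).symm.trans
      (congrArg (· ≫ c.isAffineOpen_U.fromSpec) (awayι_toSpec _ (ι_mem t)))))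

theorem mem_opensRange_piece (c : Chart q) (t : c.Tangent) (l : Proj c.symGrading) :
    chart q c l ∈ (piece q c t).opensRange ↔
      SymmetricAlgebra.ι Γ(W, c.U) c.Tangent t ∉ l.asHomogeneousIdeal := by
  have h : (piece q c t).opensRange = chart q c ''ᵁ Proj.basicOpen c.symGrading (SymmetricAlgebra.ι Γ(W, c.U) c.Tangent t) := by
    rw [← Proj.opensRange_awayι c.symGrading (SymmetricAlgebra.ι Γ(W, c.U) c.Tangent t) (ι_mem t)
      one_pos]
    exact Scheme.Hom.opensRange_comp _ _
  rw [h]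
  exact Function.Injective.mem_set_image (chart q c).isOpenEmbedding.injective

theorem exists_mem_opensRange_piece (c : Chart q) {y : projCotangentBundle q}
    (hy : proj q y ∈ c.U) : ∃ t : c.Tangent, y ∈ (piece q c t).opensRange := by
  have : y ∈ (chart q c).opensRange := by rw [opensRange_chart]; exact hy
  obtain ⟨l, rfl⟩ := this
  simp only [mem_opensRange_piece]
  by_contra! h
  refine l.not_irrelevant_le fun x hx => ?_
  refine Ideal.span_le.mpr ?_ (irrelevant_le_span hx)
  rintro _ ⟨t, rfl⟩
  exact h t

theorem exists_piece_eq (c : Chart q) (t : c.Tangent) (l : Proj c.symGrading)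
    (h : SymmetricAlgebra.ι Γ(W, c.U) c.Tangent t ∉ l.asHomogeneousIdeal) :
    ∃ y : Spec (.of (Away c.symGrading (SymmetricAlgebra.ι Γ(W, c.U) c.Tangent t))),
      piece q c t y = chart q c l ∧ ∀ k x (hx : x ∈ c.symGrading (k • 1)),
        Away.mk c.symGrading (ι_mem t) k x hx ∈ y.asIdeal ↔ x ∈ l.asHomogeneousIdeal := by
  have hl : l ∈ (Proj.awayι c.symGrading _ (ι_mem t) one_pos).opensRange := by
    rw [Proj.opensRange_awayι]
    exact h
  obtain ⟨y, rfl⟩ := hl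
  exact ⟨y, Scheme.Hom.comp_apply _ _ _, fun k x hx => mk_mem_iff (ι_mem t) y k hx⟩

theorem piece_mem_opensRange_piece (c : Chart q) (t t' : c.Tangent)
    (y : Spec (.of (Away c.symGrading (SymmetricAlgebra.ι Γ(W, c.U) c.Tangent t)))) :
    piece q c t y ∈ (piece q c t').opensRange ↔ frac (ι_mem t) t' ∉ y.asIdeal := by
  have h1 := mk_mem_iff (ι_mem t) y 1 (x := SymmetricAlgebra.ι Γ(W, c.U) c.Tangent t')
    (by simpa using ι_mem t')
  have h2 := mem_opensRange_piece q c t' (Proj.awayι c.symGrading _ (ι_mem t) one_pos y)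
  exact h2.trans h1.not.symm

end projCotangentBundle

namespace cotangentBundle

instance (c : Chart q) : IsOpenImmersion (chart q c) :=
  (Chart.specGluing q).cover.map_prop c

theorem chart_proj (c : Chart q) :
    chart q c ≫ proj q =
      Spec.map (CommRingCat.ofHom (algebraMap _ _)) ≫ c.isAffineOpen_U.fromSpec :=
  (Chart.specGluing q).ι_toBase c

theorem opensRange_chart (c : Chart q) : (chart q c).opensRange = proj q ⁻¹ᵁ c.U := by
  have h := (Chart.specGluing q).toBase_preimage_eq_opensRange_ι c
  have h' : ((Chart.cover q).f c).opensRange = c.U := c.isAffineOpen_U.opensRange_fromSpec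
  rw [h'] at h
  exact h.symm

theorem map_chart {c d : Chart q} (h : c ≤ d) :
    Spec.map (CommRingCat.ofHom (AffinePair.symRes h).toRingHom) ≫ chart q d = chart q c :=
  (Chart.specGluing q).cover.trans_map (i := c) (j := d) (homOfLE h : (c : Chart q) ⟶ d)

end cotangentBundle

end RelConormal

end

noncomputable section

namespace RelConormal

namespace SymProj
variable {A T : Type u} [CommRing A] [AddCommGroup T] [Module A T]

@[elab_as_elim]
theorem grading_induction {p : (n : ℕ) → (x : SymmetricAlgebra A T) → x ∈ grading A T n → Prop}
    (algebraMap : ∀ a, p 0 (algebraMap A _ a) (SetLike.algebraMap_mem_graded _ _))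
    (add : ∀ n x y (hx : x ∈ grading A T n) (hy : y ∈ grading A T n), p n x hx → p n y hy →
      p n (x + y) (add_mem hx hy))
    (mul : ∀ n t x (hx : x ∈ grading A T n)
      (hx' : SymmetricAlgebra.ι A T t * x ∈ grading A T (n + 1)), p n x hx →
      p (n + 1) (SymmetricAlgebra.ι A T t * x) hx')
    {n : ℕ} {x : SymmetricAlgebra A T} (hx : x ∈ grading A T n) : p n x hx := by
  have hx' : x ∈ LinearMap.range (SymmetricAlgebra.ι A T) ^ n := hx
  induction hx' using Submodule.pow_induction_on_left' with
  | algebraMap r => exact algebraMap r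
  | add x y i hx1 hy1 ihx ihy => exact add _ _ _ hx1 hy1 (ihx hx1) (ihy hy1)
  | mem_mul m hm i x hx1 ih =>
    obtain ⟨m, rfl⟩ := hm
    exact mul _ _ _ hx1 hx (ih hx1)

variable (a : T →ₗ[A] A) (I : Ideal A)

/-- The homomorphism `Sym T → (A/I)[X]` with `t ↦ a(t) X`. -/
def coneMap : SymmetricAlgebra A T →ₐ[A] Polynomial (A ⧸ I) :=
  SymmetricAlgebra.lift
    ((Polynomial.monomial (R := A ⧸ I) 1).restrictScalars A ∘ₗ (Algebra.linearMap A (A ⧸ I)) ∘ₗ a)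

theorem coneMap_eq {n : ℕ} {x : SymmetricAlgebra A T} (hx : x ∈ grading A T n) :
    coneMap a I x = Polynomial.monomial n (Ideal.Quotient.mk I (SymmetricAlgebra.lift a x)) := by
  induction hx using grading_induction with
  | algebraMap r =>
    rw [AlgHom.commutes, AlgHom.commutes]
    rfl
  | add n x y hx hy ihx ihy => simp [ihx, ihy]
  | mul n t x hx _ ih =>
    rw [map_mul, ih, coneMap, SymmetricAlgebra.lift_ι_apply, map_mul, map_mul,
      SymmetricAlgebra.lift_ι_apply, add_comm, ← Polynomial.monomial_mul_monomial]
    rfl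

theorem isHomogeneous_ker_coneMap :
    (RingHom.ker (coneMap a I)).IsHomogeneous (grading A T) := by
  classical
  intro n x hx
  rw [RingHom.mem_ker] at hx ⊢
  rw [← DirectSum.sum_support_decompose (grading A T) x, map_sum] at hx
  have h := congrArg (Polynomial.coeff · n) hx
  simp only [Polynomial.finsetSum_coeff] at h
  rw [coneMap_eq a I (SetLike.coe_mem _)]
  by_cases hn : n ∈ (DirectSum.decompose (grading A T) x).support
  · rw [Finset.sum_eq_single_of_mem n hn, coneMap_eq a I (SetLike.coe_mem _),
      Polynomial.coeff_monomial, if_pos rfl] at h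
    · rw [h]; simp
    · intro m _ hm
      rw [coneMap_eq a I (SetLike.coe_mem _), Polynomial.coeff_monomial, if_neg hm]
  · rw [DFinsupp.notMem_support_iff.mp hn]
    simp

/-- The homogeneous ideal of the cone over the closed subscheme `V(I)` given by the lines `a`. -/
def coneIdeal : HomogeneousIdeal (grading A T) :=
  ⟨RingHom.ker (coneMap a I), isHomogeneous_ker_coneMap a I⟩

theorem mem_coneIdeal {n : ℕ} {x : SymmetricAlgebra A T} (hx : x ∈ grading A T n) :
    x ∈ coneIdeal a I ↔ SymmetricAlgebra.lift a x ∈ I := by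
  rw [← HomogeneousIdeal.mem_iff]
  change x ∈ RingHom.ker (coneMap a I) ↔ _
  rw [RingHom.mem_ker, coneMap_eq a I hx, Polynomial.monomial_eq_zero_iff,
    Ideal.Quotient.eq_zero_iff_mem]

theorem ι_mem_coneIdeal (t : T) : SymmetricAlgebra.ι A T t ∈ coneIdeal a I ↔ a t ∈ I := by
  rw [mem_coneIdeal a I (ι_mem t), SymmetricAlgebra.lift_ι_apply]

theorem algebraMap_mem_coneIdeal (r : A) : algebraMap A _ r ∈ coneIdeal a I ↔ r ∈ I := by
  rw [mem_coneIdeal a I (SetLike.algebraMap_mem_graded (grading A T) r), AlgHom.commutes]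
  rfl

theorem isPrime_coneIdeal [I.IsPrime] : (coneIdeal a I).toIdeal.IsPrime :=
  RingHom.ker_isPrime (coneMap a I).toRingHom

theorem homogeneousIdeal_le {J : HomogeneousIdeal (grading A T)} {K : Ideal (SymmetricAlgebra A T)}
    (h : ∀ n x, x ∈ grading A T n → x ∈ J → x ∈ K) : J.toIdeal ≤ K := by
  classical
  intro x hx
  rw [← DirectSum.sum_support_decompose (grading A T) x]
  exact Ideal.sum_mem _ fun n _ => h n _ (SetLike.coe_mem _) (J.isHomogeneous n hx)

/-- A prime at which `a` does not vanish and that contains the `2 × 2` minors of `a` and the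
tautological section contains the ideal of the cone. -/
theorem coneIdeal_le {K : Ideal (SymmetricAlgebra A T)} [K.IsPrime]
    (hI : ∀ r ∈ I, algebraMap A _ r ∈ K) {t₀ : T} (h₀ : algebraMap A _ (a t₀) ∉ K)
    (h : ∀ t, a t₀ • SymmetricAlgebra.ι A T t - a t • SymmetricAlgebra.ι A T t₀ ∈ K) :
    (coneIdeal a I).toIdeal ≤ K := by
  refine homogeneousIdeal_le fun n x hx hxI => ?_
  rw [mem_coneIdeal a I hx] at hxI
  have key : a t₀ ^ n • x - SymmetricAlgebra.lift a x • SymmetricAlgebra.ι A T t₀ ^ n ∈ K := by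
    clear hxI
    induction hx using grading_induction with
    | algebraMap r => 
      rw [AlgHom.commutes]
      simp [Algebra.smul_def]
    | add n x y hx hy ihx ihy =>
      have := add_mem ihx ihy
      rw [map_add, smul_add, add_smul]
      convert this using 1
      abel
    | mul n t x hx _ ih =>
      rw [map_mul, SymmetricAlgebra.lift_ι_apply]
      have h1 := Ideal.mul_mem_right (a t₀ ^ n • x) _ (h t)
      have h2 := Ideal.mul_mem_left _ (a t • SymmetricAlgebra.ι A T t₀) ih
      convert add_mem h1 h2 using 1
      simp only [Algebra.smul_def, map_mul, map_pow, pow_succ]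
      ring
  have h1 : SymmetricAlgebra.lift a x • SymmetricAlgebra.ι A T t₀ ^ n ∈ K := by
    rw [Algebra.smul_def]
    exact Ideal.mul_mem_right _ _ (hI _ hxI)
  have h2 := add_mem key h1
  rw [sub_add_cancel, Algebra.smul_def, map_pow] at h2
  exact (Ideal.IsPrime.mem_or_mem ‹_› h2).resolve_left fun h3 =>
    h₀ (Ideal.IsPrime.mem_of_pow_mem ‹_› _ h3)

theorem lift_sub_mem {a' : T →ₗ[A] A} {u : A} (h : ∀ t, a' t - u * a t ∈ I) {n : ℕ}
    {x : SymmetricAlgebra A T} (hx : x ∈ grading A T n) :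
    SymmetricAlgebra.lift a' x - u ^ n * SymmetricAlgebra.lift a x ∈ I := by
  induction hx using grading_induction with
  | algebraMap r => simp [AlgHom.commutes]
  | add n x y hx hy ihx ihy =>
    convert add_mem ihx ihy using 1
    simp only [map_add]
    ring
  | mul n t x hx _ ih =>
    have h1 := Ideal.mul_mem_right (SymmetricAlgebra.lift a' x) _ (h t)
    have h2 := Ideal.mul_mem_left _ (u * a t) ih
    convert add_mem h1 h2 using 1
    simp only [map_mul, SymmetricAlgebra.lift_ι_apply, pow_succ]
    ring

/-- The value of the function `x / sᵏ` under the map of `awayLift`. -/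
theorem pow_mul_awayLift {B : Type u} [CommRing B] [Algebra A B] {s : SymmetricAlgebra A T}
    (hs : s ∈ grading A T 1) (φ : T →ₗ[A] B) (h : SymmetricAlgebra.lift φ s = 1) (b : B)
    (hb : ∀ t, algebraMap A B (a t) = b * φ t) {k : ℕ} {x : SymmetricAlgebra A T}
    (hx : x ∈ grading A T (k • 1)) :
    b ^ k * awayLift φ h (Away.mk (grading A T) hs k x hx) =
      algebraMap A B (SymmetricAlgebra.lift a x) := by
  have hx' : x ∈ grading A T k := by simpa using hx
  induction hx' using grading_induction with
  | algebraMap r =>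
    have : Away.mk (grading A T) hs 0 _ hx = toAway T s r := by
      ext
      rw [Away.val_mk]
      simp only [pow_zero]
      rfl
    rw [this, awayLift_toAway, AlgHom.commutes]
    simp
  | add n x y hx1 hy1 ihx ihy =>
    have hx2 : x ∈ grading A T (n • 1) := by simpa using hx1
    have hy2 : y ∈ grading A T (n • 1) := by simpa using hy1
    rw [away_mk_add hs n hx2 hy2, map_add, mul_add, ihx hx2, ihy hy2, map_add, map_add]
  | mul n t x hx1 _ ih =>
    have hx2 : x ∈ grading A T (n • 1) := by simpa using hx1
    rw [away_mk_succ hs t n hx2, map_mul, awayLift_frac, map_mul, map_mul, ← ih hx2,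
      SymmetricAlgebra.lift_ι_apply, hb]
    ring

end SymProj
end RelConormal

end

noncomputable section

namespace RelConormal

variable {W S X : Scheme.{u}} {q : W ⟶ S} {i : X ⟶ W}

theorem formallySmooth_stalkMap {f : X ⟶ S} {x : X} (hx : x ∈ smoothLocus f) :
    (f.stalkMap x).hom.FormallySmooth := by
  obtain ⟨U, hxU, hU⟩ := hx
  obtain ⟨y, rfl⟩ : ∃ y : U.toScheme, U.ι y = x := ⟨⟨x, hxU⟩, rfl⟩
  have h' : ((U.ι ≫ f).stalkMap y).hom.FormallySmooth :=
    (U.ι ≫ f).smoothLocus_eq_top.ge (Set.mem_univ y)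
  rw [Scheme.Hom.stalkMap_comp] at h'
  exact (RingHom.FormallySmooth.respectsIso.cancel_right_isIso (f.stalkMap (U.ι y))
    (U.ι.stalkMap y)).mp h'

namespace Chart

theorem _root_.RelConormal.mem_ideal_ker_iff [IsIntegral X] [IsClosedImmersion i]
    (U : W.affineOpens) (F : Γ(W, U.1)) :
    F ∈ i.ker.ideal U ↔ i (genericPoint X) ∉ W.basicOpen F := by
  rw [Scheme.Hom.ker_apply, RingHom.mem_ker]
  have h : i (genericPoint X) ∈ W.basicOpen F ↔ genericPoint X ∈ X.basicOpen (i.app U.1 F) := by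
    rw [← Scheme.preimage_basicOpen]
    rfl
  rw [h, ← basicOpen_eq_bot_iff]
  constructor
  · intro h1
    rw [h1]
    exact id
  · intro h1
    by_contra h2
    obtain ⟨y, hy⟩ := (TopologicalSpace.Opens.ne_bot_iff_nonempty _).mp h2
    exact h1 ((genericPoint_specializes y).mem_open (X.basicOpen _).2 hy)

theorem mem_equations_iff [IsIntegral X] [IsClosedImmersion i] (c : Chart q) (F : Γ(W, c.U)) :
    F ∈ c.equations i ↔ i (genericPoint X) ∉ W.basicOpen F :=
  mem_ideal_ker_iff ⟨c.U, c.isAffineOpen_U⟩ F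

theorem mem_basicOpen_iff [IsIntegral X] [IsClosedImmersion i] (c : Chart q) (F : Γ(W, c.U)) :
    i (genericPoint X) ∈ W.basicOpen F ↔ F ∉ c.equations i := by
  rw [mem_equations_iff, not_not]

theorem isPrime_equations [IsIntegral X] [IsClosedImmersion i] (c : Chart q)
    (h : i (genericPoint X) ∈ c.U) : (c.equations i).IsPrime := by
  refine ⟨fun h1 => ?_, fun {F G} h1 => ?_⟩
  · have h2 := (Ideal.eq_top_iff_one _).mp h1
    rw [mem_equations_iff, Scheme.basicOpen_of_isUnit _ isUnit_one] at h2
    exact h2 h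
  · simp only [mem_equations_iff, Scheme.basicOpen_mul] at h1 ⊢
    by_contra! h2
    exact h1 h2

theorem genericPoint_mem [IsIntegral X] (U : W.Opens) {x : X} (hx : i x ∈ U) :
    i (genericPoint X) ∈ U :=
  (genericPoint_specializes x).mem_open (i ⁻¹ᵁ U).2 hx

theorem exists_mem_basicOpen_deriv [IsIntegral W] [IsIntegral X] [IsClosedImmersion i] (c : Chart q)
    {F : Γ(W, c.U)} (hF : c.equations i = Ideal.span {F}) (hF0 : F ≠ 0) {x : X}
    (hx : x ∈ smoothLocus (i ≫ q)) (hxc : i x ∈ c.U) :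
    ∃ t : c.Tangent, i x ∈ W.basicOpen (c.deriv t F) := by
  have hxV : (i ≫ q) x ∈ c.V := c.le hxc
  let := (W.presheaf.germ c.U (i x) hxc).hom.toAlgebra
  let := ((W.presheaf.germ c.U (i x) hxc).hom.comp (q.appLE c.V c.U c.le).hom).toAlgebra
  have : IsScalarTower Γ(S, c.V) Γ(W, c.U) (W.presheaf.stalk (i x)) := .of_algebraMap_eq' rfl
  let := ((i.stalkMap x).hom.comp ((W.presheaf.germ c.U (i x) hxc).hom.comp
    (q.appLE c.V c.U c.le).hom)).toAlgebra
  have hs : (S.presheaf.germ c.V ((i ≫ q) x) hxV).hom.FormallySmooth := by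
    let := S.presheaf.algebra_section_stalk (⟨(i ≫ q) x, hxV⟩ : c.V)
    have := c.isAffineOpen_V.isLocalization_stalk ⟨(i ≫ q) x, hxV⟩
    exact Algebra.FormallySmooth.of_isLocalization
      (c.isAffineOpen_V.primeIdealOf ⟨(i ≫ q) x, hxV⟩).asIdeal.primeCompl
  have h1 := hs.comp (formallySmooth_stalkMap hx)
  have h2 : ((i.stalkMap x).hom.comp ((W.presheaf.germ c.U (i x) hxc).hom.comp
      (q.appLE c.V c.U c.le).hom)) = ((i ≫ q).stalkMap x).hom.comp
        (S.presheaf.germ c.V ((i ≫ q) x) hxV).hom := by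
    have hxV' : q (i x) ∈ c.V := c.le hxc
    have h2' : q.appLE c.V c.U c.le ≫ W.presheaf.germ c.U (i x) hxc =
        S.presheaf.germ c.V (q (i x)) hxV' ≫ q.stalkMap (i x) := by
      rw [Scheme.Hom.germ_stalkMap, Scheme.Hom.appLE, Category.assoc]
      exact congrArg (q.app c.V ≫ ·) (W.presheaf.germ_res _ _ _)
    rw [Scheme.Hom.stalkMap_comp]
    exact congrArg (fun z => (z ≫ i.stalkMap x).hom) h2'
  have h3 : Algebra.FormallySmooth Γ(S, c.V) (X.presheaf.stalk x) := by
    rw [← h2] at h1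
    exact h1
  have := c.free
  have := c.finite
  have hinj := germ_injective_of_isIntegral (X := W) (i x) hxc
  let π : W.presheaf.stalk (i x) →ₐ[Γ(S, c.V)] X.presheaf.stalk x :=
    { (i.stalkMap x).hom with commutes' := fun r => rfl }
  have hker : RingHom.ker π = Ideal.span {algebraMap Γ(W, c.U) (W.presheaf.stalk (i x)) F} := by
    have hmem (a : Γ(W, c.U)) : i.stalkMap x (W.presheaf.germ c.U (i x) hxc a) = 0 ↔
        a ∈ Ideal.span {F} := by
      rw [← hF, equations, Scheme.Hom.ker_apply, RingHom.mem_ker, Scheme.Hom.germ_stalkMap_apply]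
      exact map_eq_zero_iff _ (germ_injective_of_isIntegral (X := X) x hxc)
    set M := (c.isAffineOpen_U.primeIdealOf ⟨i x, hxc⟩).asIdeal.primeCompl
    have hloc : IsLocalization M (W.presheaf.stalk (i x)) := c.isAffineOpen_U.isLocalization_stalk ⟨i x, hxc⟩
    apply le_antisymm
    · intro y hy
      obtain ⟨⟨a, r⟩, har⟩ := IsLocalization.surj M y
      have hr : IsUnit (W.presheaf.germ c.U (i x) hxc r.1) := IsLocalization.map_units _ r
      have har' : y * W.presheaf.germ c.U (i x) hxc r.1 = W.presheaf.germ c.U (i x) hxc a := har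
      have hy' : i.stalkMap x y = 0 := hy
      have ha : a ∈ Ideal.span {F} := by
        rw [← hmem, ← har', map_mul, hy', zero_mul]
      rw [Ideal.mem_span_singleton] at ha ⊢
      refine (hr.dvd_mul_right).mp ?_
      rw [har']
      exact map_dvd (W.presheaf.germ c.U (i x) hxc).hom ha
    · rw [Ideal.span_singleton_le_iff_mem]
      exact (hmem F).mpr (Ideal.mem_span_singleton_self F)
  obtain ⟨t, ht⟩ := Algebra.FormallySmooth.exists_isUnit_dual_D π (i.stalkMap_surjective x) F hker
    fun h4 => hF0 (hinj (h4.trans (map_zero _).symm))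
  exact ⟨t, (W.mem_basicOpen _ _ hxc).mpr ht⟩

end Chart

theorem genericPoint_mem_smoothLocus {S X : Scheme.{0}} (s : S ⟶ Spec (.of ℂ)) (f : X ⟶ S)
    [IsIntegral X] [LocallyOfFinitePresentation f] [Flat f] :
    genericPoint X ∈ smoothLocus f := by
  have hess := LocallyOfFiniteType.stalkMap f (genericPoint X)
  have hflat := Flat.stalkMap f (genericPoint X)
  have hloc : IsLocalHom (f.stalkMap (genericPoint X)).hom := f.toLRSHom.prop (genericPoint X)
  have hsm : (f.stalkMap (genericPoint X)).hom.FormallySmooth := by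
    let : Field (X.presheaf.stalk (genericPoint X)) := inferInstanceAs (Field X.functionField)
    algebraize [(f.stalkMap (genericPoint X)).hom]
    have hff : Module.FaithfullyFlat (S.presheaf.stalk (f (genericPoint X)))
        (X.presheaf.stalk (genericPoint X)) := Module.FaithfullyFlat.of_flat_of_isLocalHom
    have hinj : Function.Injective (algebraMap (S.presheaf.stalk (f (genericPoint X)))
        (X.presheaf.stalk (genericPoint X))) := FaithfulSMul.algebraMap_injective _ _
    have hfield : IsField (S.presheaf.stalk (f (genericPoint X))) := by
      refine ⟨exists_pair_ne _, mul_comm, fun {a} ha => ?_⟩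
      have h1 : IsUnit (algebraMap _ (X.presheaf.stalk (genericPoint X)) a) :=
        isUnit_iff_ne_zero.mpr fun h2 => ha (hinj (h2.trans (map_zero _).symm))
      exact (isUnit_of_map_unit (f.stalkMap (genericPoint X)).hom a h1).exists_right_inv
    let := hfield.toField
    have hchar : CharZero (S.presheaf.stalk (f (genericPoint X))) :=
      charZero_of_injective_ringHom (RingHom.injective
        ((S.presheaf.germ ⊤ (f (genericPoint X)) trivial).hom.comp
          (s.appTop.hom.comp (Scheme.ΓSpecIso (.of ℂ)).inv.hom)))
    have : PerfectField (S.presheaf.stalk (f (genericPoint X))) := inferInstance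
    exact Algebra.FormallySmooth.of_perfectField
  obtain ⟨U, hU, V, hV, hVU, hxV, H⟩ := exists_smooth_of_formallySmooth_stalk f _ hsm
  refine ⟨V, hxV, ?_⟩
  have : V.ι ≫ f = f.resLE U V hVU ≫ U.ι := by simp
  rw [this]
  have : IsAffine _ := hU
  have : IsAffine _ := hV
  have : Smooth (f.resLE U V hVU) := by
    rw [HasRingHomProperty.iff_of_isAffine (P := @Smooth)]
    exact (RingHom.Smooth.propertyIsLocal.respectsIso.arrow_mk_iso_iff
      (arrowResLEAppIso f U V hVU)).mpr H
  infer_instance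

end RelConormal

end

noncomputable section

namespace AlgebraicGeometry.IsAffineOpen

theorem mem_primeIdealOf_iff {X : Scheme.{u}} {U : X.Opens} (hU : IsAffineOpen U) (x : U)
    (f : Γ(X, U)) : f ∈ (hU.primeIdealOf x).asIdeal ↔ x.1 ∉ X.basicOpen f := by
  have h : x.1 ∈ X.basicOpen f ↔ hU.primeIdealOf x ∈ hU.fromSpec ⁻¹ᵁ X.basicOpen f := by
    change _ ↔ hU.fromSpec (hU.primeIdealOf x) ∈ X.basicOpen f
    rw [hU.fromSpec_primeIdealOf]
  rw [h, hU.fromSpec_preimage_basicOpen]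
  exact not_not.symm

end AlgebraicGeometry.IsAffineOpen

theorem Ideal.eq_of_height_eq_one {A : Type*} [CommRing A] [IsDomain A] {P : Ideal A} [P.IsPrime]
    (hP : P.height = 1) : P ≠ ⊥ ∧ ∀ P' : Ideal A, P'.IsPrime → P' ≤ P → P' ≠ ⊥ → P' = P := by
  refine ⟨?_, fun P' h' h1 h2 => ?_⟩
  · rintro rfl
    simp at hP
  · by_contra h3
    have h4 := Ideal.height_add_one_le_of_lt_of_isPrime (lt_of_le_of_ne h1 h3)
    rw [hP] at h4
    have h5 : P'.height = 0 := by
      have : P'.height + 1 ≤ 0 + 1 := by simpa using h4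
      exact nonpos_iff_eq_zero.mp ((ENat.add_le_add_iff_right (by simp)).mp this)
    exact h2 (Ideal.height_eq_zero_iff_eq_bot.mp h5)

namespace RelConormal

theorem isStandardSmooth_complex {W : Scheme.{0}} (σ : W ⟶ Spec (.of ℂ)) [Smooth σ] (w : W) :
    ∃ V : W.affineOpens, w ∈ V.1 ∧ ∃ f : ℂ →+* Γ(W, V.1), f.IsStandardSmooth := by
  obtain ⟨U, hU, V, hV, hw, e, h⟩ := Smooth.exists_isStandardSmooth σ w
  have hU' : U = ⊤ := by
    refine top_le_iff.mp fun y _ => ?_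
    have : Subsingleton (Spec (.of ℂ)) := inferInstanceAs (Subsingleton (PrimeSpectrum ℂ))
    rw [Subsingleton.elim y (σ w)]
    exact e hw
  subst hU'
  exact ⟨⟨V, hV⟩, hw, _, RingHom.isStandardSmooth_respectsIso.2 _
    (Scheme.ΓSpecIso (.of ℂ)).symm.commRingCatIsoToRingEquiv h⟩

theorem ideal_eq_span_of_le {W : Scheme.{u}} (J : W.IdealSheafData) {V' V : W.affineOpens}
    (h : V'.1 ≤ V.1) {F r : Γ(W, V.1)} (hF : F ∈ J.ideal V)
    (hspan : ∀ y ∈ J.ideal V, r * y ∈ Ideal.span {F})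
    (hr : IsUnit (W.presheaf.map (homOfLE h).op r)) :
    J.ideal V' = Ideal.span {W.presheaf.map (homOfLE h).op F} := by
  rw [← J.map_ideal h]
  apply le_antisymm
  · rw [Ideal.map_le_iff_le_comap]
    intro y hy
    have h3 := Ideal.mem_map_of_mem (W.presheaf.map (homOfLE h).op).hom (hspan y hy)
    rw [Ideal.map_span, Set.image_singleton, map_mul] at h3
    exact (Ideal.unit_mul_mem_iff_mem _ hr).mp h3
  · rw [Ideal.span_singleton_le_iff_mem]
    exact Ideal.mem_map_of_mem _ hF

/-- A closed subvariety of codimension one of a smooth variety is locally a hypersurface. -/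
theorem exists_ideal_ker_eq_span {W X : Scheme.{0}} (σ : W ⟶ Spec (.of ℂ)) [Smooth σ]
    [CompactSpace W] [IsIntegral W] (i : X ⟶ W) [IsIntegral X] [IsClosedImmersion i]
    (hcodim : Order.coheight (i (genericPoint X)) = 1) (x : X) :
    ∃ V : W.affineOpens, i x ∈ V.1 ∧ ∃ F ≠ 0, i.ker.ideal V = Ideal.span {F} := by
  obtain ⟨w, hw, hwc⟩ := IsClosed.exists_closed_singleton (isClosed_closure (s := {i x}))
    ⟨_, subset_closure rfl⟩
  have hspec : i x ⤳ w := specializes_iff_mem_closure.mpr hw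
  obtain ⟨z, rfl⟩ : w ∈ Set.range i := by
    refine closure_minimal ?_ i.isClosedEmbedding.isClosed_range hw
    rintro _ rfl
    exact ⟨x, rfl⟩
  obtain ⟨V, hwV, f, hf⟩ := isStandardSmooth_complex σ (i z)
  have hξ : i (genericPoint X) ∈ V.1 := Chart.genericPoint_mem V.1 hwV
  let := f.toAlgebra
  have : Algebra.IsStandardSmooth ℂ Γ(W, V.1) := hf
  have : Nonempty V.1 := ⟨⟨_, hwV⟩⟩
  have hP : (V.2.primeIdealOf ⟨_, hξ⟩).asIdeal = i.ker.ideal V := by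
    ext F
    rw [mem_ideal_ker_iff, V.2.mem_primeIdealOf_iff]
  have hheight : (V.2.primeIdealOf ⟨_, hξ⟩).asIdeal.height = 1 := by
    let := W.presheaf.algebra_section_stalk (⟨_, hξ⟩ : V.1)
    have := V.2.isLocalization_stalk ⟨_, hξ⟩
    have h := ringKrullDim_stalk_eq_coheight (i (genericPoint X))
    rw [hcodim] at h
    have h' := IsLocalization.AtPrime.ringKrullDim_eq_height
      (V.2.primeIdealOf ⟨_, hξ⟩).asIdeal (W.presheaf.stalk (i (genericPoint X)))
    rw [h] at h'
    exact_mod_cast h'.symm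
  obtain ⟨h1, h2⟩ := Ideal.eq_of_height_eq_one hheight
  have hmax := V.2.primeIdealOf_isMaximal_of_isClosed ⟨_, hwV⟩ hwc
  obtain ⟨F, hF, r, hr, hspan⟩ := Algebra.IsStandardSmooth.exists_locally_principal (k := ℂ)
    (V.2.primeIdealOf ⟨_, hwV⟩).asIdeal (V.2.primeIdealOf ⟨_, hξ⟩).asIdeal h1 h2
  rw [hP] at hspan hF h1
  rw [V.2.mem_primeIdealOf_iff, not_not] at hr
  obtain ⟨V', hle, hzV, hu⟩ : ∃ (V' : W.affineOpens) (h : V'.1 ≤ V.1), i z ∈ V'.1 ∧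
      IsUnit (W.presheaf.map (homOfLE h).op r) :=
    ⟨W.affineBasicOpen r, W.basicOpen_le r, hr, RingedSpace.isUnit_res_basicOpen W.toRingedSpace r⟩
  have : Nonempty V'.1 := ⟨⟨_, hzV⟩⟩
  have hinj := map_injective_of_isIntegral W (homOfLE hle)
  have hI := ideal_eq_span_of_le i.ker hle hF hspan hu
  refine ⟨V', hspec.mem_open V'.1.2 hzV, _, fun h0 => ?_, hI⟩
  obtain ⟨y, hy, hy0⟩ := Submodule.exists_mem_ne_zero_of_ne_bot h1
  have h4 := (i.ker.map_ideal (U := V') (V := V) hle).le (Ideal.mem_map_of_mem _ hy)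
  rw [hI, h0, Ideal.span_singleton_zero, Ideal.mem_bot] at h4
  exact hy0 (hinj (h4.trans (map_zero _).symm))

theorem Chart.exists_equations_eq_span {S W X : Scheme.{0}} (q : W ⟶ S) [Smooth q]
    (σ : W ⟶ Spec (.of ℂ)) [Smooth σ]
    [CompactSpace W] [IsIntegral W] (i : X ⟶ W) [IsIntegral X] [IsClosedImmersion i]
    (hcodim : Order.coheight (i (genericPoint X)) = 1) (x : X) :
    ∃ c : Chart q, i x ∈ c.U ∧ ∃ F ≠ 0, c.equations i = Ideal.span {F} := by
  obtain ⟨V, hxV, F, hF0, hF⟩ := exists_ideal_ker_eq_span σ i hcodim x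
  obtain ⟨d, hd⟩ := Chart.exists_mem (q := q) (i x)
  obtain ⟨_, ⟨U, hU, rfl⟩, hwU, hU'⟩ := W.isBasis_affineOpens.exists_subset_of_mem_open
    (show i x ∈ ((V.1 ⊓ d.U : W.Opens) : Set W) from ⟨hxV, hd⟩) (V.1 ⊓ d.U).2
  have hUV : U ≤ V.1 := fun y hy => (hU' hy).1
  have hUd : U ≤ d.U := fun y hy => (hU' hy).2
  let e : AffinePair q := ⟨d.V, d.isAffineOpen_V, U, hU, hUd.trans d.le⟩
  have h : e ≤ d.toAffinePair := ⟨le_rfl, hUd⟩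
  refine ⟨⟨e, AffinePair.free_of_le h d.free, AffinePair.finite_of_le h d.finite⟩, hwU,
    W.presheaf.map (homOfLE hUV).op F, ?_, ?_⟩
  · have : Nonempty U := ⟨⟨_, hwU⟩⟩
    intro h0
    exact hF0 (map_injective_of_isIntegral W (homOfLE hUV) (h0.trans (map_zero _).symm))
  · change i.ker.ideal ⟨U, hU⟩ = _
    rw [← i.ker.map_ideal (U := ⟨U, hU⟩) (V := V) hUV, hF, Ideal.map_span, Set.image_singleton]
    rfl

end RelConormal

end

noncomputable section

namespace RelConormal

open SymProj

variable {W S X : Scheme.{u}} {q : W ⟶ S} {i : X ⟶ W}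

namespace Chart

/-- The derivatives of a function, as a linear form on the relative vector fields. -/
def derivMap (c : Chart q) (F : Γ(W, c.U)) : c.Tangent →ₗ[Γ(W, c.U)] Γ(W, c.U) where
  toFun t := c.deriv t F
  map_add' _ _ := rfl
  map_smul' _ _ := rfl

theorem derivMap_mul (c : Chart q) (F G : Γ(W, c.U)) (t : c.Tangent) :
    c.derivMap (F * G) t = F * c.derivMap G t + G * c.derivMap F t :=
  c.deriv_mul t F G

variable (i) in
/-- `F` is a local equation of the integral closed subscheme `X` on a chart meeting `X`. -/
structure IsEquation [IsIntegral X] (c : Chart q) (F : Γ(W, c.U)) : Prop where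
  equations_eq : c.equations i = Ideal.span {F}
  ne_zero : F ≠ 0
  mem : i (genericPoint X) ∈ c.U

variable [IsIntegral X] {c d e : Chart q} {F G : Γ(W, c.U)}

theorem lift_symRes (h : e ≤ c) (F : Γ(W, c.U)) (x : SymmetricAlgebra Γ(W, c.U) c.Tangent) :
    SymmetricAlgebra.lift (e.derivMap (W.presheaf.map (homOfLE h.2).op F)) (AffinePair.symRes h x) =
      W.presheaf.map (homOfLE h.2).op (SymmetricAlgebra.lift (c.derivMap F) x) := by
  have key : (SymmetricAlgebra.lift (e.derivMap (W.presheaf.map (homOfLE h.2).op F))).toRingHom.comp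
      (AffinePair.symRes h).toRingHom = (W.presheaf.map (homOfLE h.2).op).hom.comp
        (SymmetricAlgebra.lift (c.derivMap F)).toRingHom := by
    refine ringHom_ext (fun a => ?_) fun t => ?_
    · change SymmetricAlgebra.lift _ (AffinePair.symRes h _) =
        W.presheaf.map (homOfLE h.2).op (SymmetricAlgebra.lift _ _)
      rw [AffinePair.symRes_algebraMap, AlgHom.commutes, AlgHom.commutes]
      rfl
    · change SymmetricAlgebra.lift _ (AffinePair.symRes h _) =
        W.presheaf.map (homOfLE h.2).op (SymmetricAlgebra.lift _ _)
      rw [AffinePair.symRes_ι, SymmetricAlgebra.lift_ι_apply, SymmetricAlgebra.lift_ι_apply]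
      exact deriv_res h t F
  exact congr($key x)

namespace IsEquation

theorem res [IsIntegral W] (hF : c.IsEquation i F) (h : e ≤ c) (hξ : i (genericPoint X) ∈ e.U) :
    e.IsEquation i (W.presheaf.map (homOfLE h.2).op F) where
  equations_eq := by
    rw [equations_of_le i h, hF.equations_eq, Ideal.map_span, Set.image_singleton]
  ne_zero h0 := by
    have : Nonempty e.U := ⟨⟨_, hξ⟩⟩
    exact hF.ne_zero (map_injective_of_isIntegral W (homOfLE h.2) (h0.trans (map_zero _).symm))
  mem := hξ

theorem self_mem (hF : c.IsEquation i F) : F ∈ c.equations i := by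
  rw [hF.equations_eq]
  exact Ideal.mem_span_singleton_self F

end IsEquation

variable [IsClosedImmersion i]

theorem res_mem_equations_iff (h : e ≤ c) (hξ : i (genericPoint X) ∈ e.U) (F : Γ(W, c.U)) :
    W.presheaf.map (homOfLE h.2).op F ∈ e.equations i ↔ F ∈ c.equations i := by
  rw [mem_equations_iff, mem_equations_iff, Scheme.basicOpen_res]
  exact not_congr ⟨fun h => h.2, fun h => ⟨hξ, h⟩⟩

namespace IsEquation

theorem exists_deriv_notMem [IsIntegral W] (hF : c.IsEquation i F)
    (hsm : genericPoint X ∈ smoothLocus (i ≫ q)) : ∃ t, c.deriv t F ∉ c.equations i := by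
  obtain ⟨t, ht⟩ := c.exists_mem_basicOpen_deriv hF.equations_eq hF.ne_zero hsm hF.mem
  exact ⟨t, (c.mem_basicOpen_iff _).mp ht⟩

/-- The homogeneous prime ideal of the conormal variety on a chart. -/
def point [IsIntegral W] (hF : c.IsEquation i F) (hsm : genericPoint X ∈ smoothLocus (i ≫ q)) :
    Proj c.symGrading where
  asHomogeneousIdeal := coneIdeal (c.derivMap F) (c.equations i)
  isPrime := by
    have := c.isPrime_equations hF.mem
    exact isPrime_coneIdeal _ _
  not_irrelevant_le h := by
    obtain ⟨t, ht⟩ := hF.exists_deriv_notMem hsm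
    refine ht ((ι_mem_coneIdeal (c.derivMap F) (c.equations i) t).mp (h ?_))
    exact HomogeneousIdeal.mem_irrelevant_of_mem _ one_pos (ι_mem t)

theorem symRes_mem_coneIdeal (h : e ≤ c) (hξ : i (genericPoint X) ∈ e.U)
    {n : ℕ} {x : SymmetricAlgebra Γ(W, c.U) c.Tangent} (hx : x ∈ c.symGrading n) :
    AffinePair.symRes h x ∈ coneIdeal (e.derivMap (W.presheaf.map (homOfLE h.2).op F)) (e.equations i) ↔
      x ∈ coneIdeal (c.derivMap F) (c.equations i) := by
  have hx' : AffinePair.symRes h x ∈ e.symGrading n := (AffinePair.symRes h).map_mem hx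
  rw [mem_coneIdeal _ _ hx, mem_coneIdeal _ _ hx', lift_symRes,
    res_mem_equations_iff h hξ]

theorem _root_.HomogeneousIdeal.ext_of_homogeneous {A σ ι : Type*} [Semiring A]
    [SetLike σ A] [AddSubmonoidClass σ A] [DecidableEq ι] [AddMonoid ι] {𝒜 : ι → σ} [GradedRing 𝒜]
    {I J : HomogeneousIdeal 𝒜} (h : ∀ n, ∀ x ∈ 𝒜 n, x ∈ I ↔ x ∈ J) : I = J := by
  classical
  refine SetLike.ext fun x => ?_
  constructor
  · intro hx
    rw [← HomogeneousIdeal.mem_iff, ← DirectSum.sum_support_decompose 𝒜 x]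
    exact Ideal.sum_mem _ fun n _ => (h n _ (SetLike.coe_mem _)).mp (I.isHomogeneous n hx)
  · intro hx
    rw [← HomogeneousIdeal.mem_iff, ← DirectSum.sum_support_decompose 𝒜 x]
    exact Ideal.sum_mem _ fun n _ => (h n _ (SetLike.coe_mem _)).mpr (J.isHomogeneous n hx)

theorem map_point [IsIntegral W] (hF : c.IsEquation i F)
    (hsm : genericPoint X ∈ smoothLocus (i ≫ q)) (h : e ≤ c) (hξ : i (genericPoint X) ∈ e.U) :
    Proj.map (AffinePair.symRes h) (AffinePair.symRes_irrelevant h c.free c.finite)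
      ((hF.res h hξ).point hsm) = hF.point hsm := by
  apply ProjectiveSpectrum.ext
  refine HomogeneousIdeal.ext_of_homogeneous fun n x hx => ?_
  exact symRes_mem_coneIdeal h hξ hx

theorem point_eq [IsIntegral W] (hF : c.IsEquation i F) (hG : c.IsEquation i G)
    (hsm : genericPoint X ∈ smoothLocus (i ≫ q)) : hF.point hsm = hG.point hsm := by
  have key {F G} (hF : c.IsEquation i F) (hG : c.IsEquation i G) {n : ℕ}
      {x : SymmetricAlgebra Γ(W, c.U) c.Tangent} (hx : x ∈ c.symGrading n)
      (h : x ∈ coneIdeal (c.derivMap F) (c.equations i)) :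
      x ∈ coneIdeal (c.derivMap G) (c.equations i) := by
    have h1 := hG.self_mem
    rw [hF.equations_eq, Ideal.mem_span_singleton'] at h1
    obtain ⟨u, rfl⟩ := h1
    rw [mem_coneIdeal _ _ hx] at h ⊢
    have h2 := lift_sub_mem (c.derivMap F) (c.equations i) (a' := c.derivMap (u * F)) (u := u)
      (fun t => by
        rw [derivMap_mul, add_sub_cancel_left]
        exact Ideal.mul_mem_right _ _ hF.self_mem) hx
    exact (Submodule.sub_mem_iff_left _ (Ideal.mul_mem_left _ _ h)).mp h2
  apply ProjectiveSpectrum.ext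
  exact HomogeneousIdeal.ext_of_homogeneous fun n x hx => ⟨key hF hG hx, key hG hF hx⟩

theorem chart_point_of_le [Smooth q] [IsIntegral W] (hF : c.IsEquation i F)
    (hsm : genericPoint X ∈ smoothLocus (i ≫ q)) (h : e ≤ c) (hξ : i (genericPoint X) ∈ e.U) :
    projCotangentBundle.chart q e ((hF.res h hξ).point hsm) =
      projCotangentBundle.chart q c (hF.point hsm) := by
  have h1 := congr($(projCotangentBundle.map_chart q h) ((hF.res h hξ).point hsm))
  exact h1.symm.trans (congrArg (projCotangentBundle.chart q c) (hF.map_point hsm h hξ))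

theorem chart_point_eq [Smooth q] [IsIntegral W] (hF : c.IsEquation i F) {G : Γ(W, d.U)}
    (hG : d.IsEquation i G) (hsm : genericPoint X ∈ smoothLocus (i ≫ q)) :
    projCotangentBundle.chart q c (hF.point hsm) = projCotangentBundle.chart q d (hG.point hsm) := by
  obtain ⟨e, hec, hed, hξ⟩ := exists_le c d hF.mem hG.mem
  exact (hF.chart_point_of_le hsm hec hξ).symm.trans ((congrArg (projCotangentBundle.chart q e)
    (point_eq (hF.res hec hξ) (hG.res hed hξ) hsm)).trans (hG.chart_point_of_le hsm hed hξ))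

end IsEquation

end Chart

namespace cotangentBundle

variable [Smooth q]

theorem algebraMap_mem_iff (c : Chart q)
    (𝔮 : Spec (.of (SymmetricAlgebra Γ(W, c.U) c.Tangent))) (F : Γ(W, c.U)) :
    algebraMap _ _ F ∈ 𝔮.asIdeal ↔ proj q (chart q c 𝔮) ∉ W.basicOpen F := by
  have h : proj q (chart q c 𝔮) = c.isAffineOpen_U.fromSpec
      (Spec.map (CommRingCat.ofHom (algebraMap Γ(W, c.U) (SymmetricAlgebra Γ(W, c.U) c.Tangent))) 𝔮) := by
    have := congr($(chart_proj q c) 𝔮)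
    exact this
  have h2 : proj q (chart q c 𝔮) ∈ W.basicOpen F ↔
      Spec.map (CommRingCat.ofHom (algebraMap Γ(W, c.U) (SymmetricAlgebra Γ(W, c.U) c.Tangent))) 𝔮 ∈
        c.isAffineOpen_U.fromSpec ⁻¹ᵁ W.basicOpen F := by
    rw [h]; rfl
  rw [h2, c.isAffineOpen_U.fromSpec_preimage_basicOpen]
  exact not_not.symm

theorem proj_chart_mem (c : Chart q) (𝔮 : Spec (.of (SymmetricAlgebra Γ(W, c.U) c.Tangent))) :
    proj q (chart q c 𝔮) ∈ c.U := by
  have : chart q c 𝔮 ∈ (chart q c).opensRange := ⟨_, rfl⟩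
  rw [opensRange_chart] at this
  exact this

theorem exists_chart_eq (c : Chart q) (ξ : cotangentBundle q) (h : proj q ξ ∈ c.U) :
    ∃ 𝔮 : Spec (.of (SymmetricAlgebra Γ(W, c.U) c.Tangent)), chart q c 𝔮 = ξ := by
  have : ξ ∈ (chart q c).opensRange := by rw [opensRange_chart]; exact h
  exact this

theorem mem_of_chart_eq {c e : Chart q} (h : e ≤ c)
    {𝔮 : Spec (.of (SymmetricAlgebra Γ(W, c.U) c.Tangent))}
    {𝔭 : Spec (.of (SymmetricAlgebra Γ(W, e.U) e.Tangent))}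
    (h𝔭 : chart q e 𝔭 = chart q c 𝔮) (x : SymmetricAlgebra Γ(W, c.U) c.Tangent) :
    AffinePair.symRes h x ∈ 𝔭.asIdeal ↔ x ∈ 𝔮.asIdeal := by
  have h1 : chart q c (Spec.map (CommRingCat.ofHom (AffinePair.symRes h).toRingHom) 𝔭) =
      chart q c 𝔮 := by
    rw [← h𝔭, ← map_chart q h, Scheme.Hom.comp_apply]
  have h2 := (chart q c).isOpenEmbedding.injective h1
  rw [← h2]
  rfl

end cotangentBundle

end RelConormal

end

noncomputable section

namespace RelConormal

open SymProj

variable {W S X : Scheme.{u}} {q : W ⟶ S} {i : X ⟶ W}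

namespace SymProj

variable {A T : Type u} [CommRing A] [AddCommGroup T] [Module A T]

theorem minor_smul_mem (a : T →ₗ[A] A) {K : Ideal (SymmetricAlgebra A T)} {t₀ t : T} (r : A)
    (h : a t₀ • SymmetricAlgebra.ι A T t - a t • SymmetricAlgebra.ι A T t₀ ∈ K) :
    a t₀ • SymmetricAlgebra.ι A T (r • t) - a (r • t) • SymmetricAlgebra.ι A T t₀ ∈ K := by
  rw [map_smul, map_smul, smul_comm, smul_assoc, ← smul_sub, Algebra.smul_def]
  exact Ideal.mul_mem_left _ _ h

theorem minor_add_mem (a : T →ₗ[A] A) {K : Ideal (SymmetricAlgebra A T)} {t₀ s t : T}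
    (hs : a t₀ • SymmetricAlgebra.ι A T s - a s • SymmetricAlgebra.ι A T t₀ ∈ K)
    (ht : a t₀ • SymmetricAlgebra.ι A T t - a t • SymmetricAlgebra.ι A T t₀ ∈ K) :
    a t₀ • SymmetricAlgebra.ι A T (s + t) - a (s + t) • SymmetricAlgebra.ι A T t₀ ∈ K := by
  rw [map_add, map_add, smul_add, add_smul, add_sub_add_comm]
  exact add_mem hs ht

theorem sub_mem_of_mul_sub_mem {K : Ideal (SymmetricAlgebra A T)} [K.IsPrime] {g E x x₀ y y₀ : A}
    {z z₀ : SymmetricAlgebra A T} (hE : algebraMap A _ E ∈ K) (hg : algebraMap A _ g ∉ K)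
    (h : algebraMap A _ (g * x₀ + E * y₀) * z - algebraMap A _ (g * x + E * y) * z₀ ∈ K) :
    x₀ • z - x • z₀ ∈ K := by
  rw [Algebra.smul_def, Algebra.smul_def]
  refine (Ideal.IsPrime.mem_or_mem ‹_› (?_ : algebraMap A _ g * _ ∈ K)).resolve_left hg
  simp only [map_add, map_mul] at h
  have h4 := sub_mem h (Ideal.mul_mem_right (algebraMap A _ y₀ * z - algebraMap A _ y * z₀) _ hE)
  convert h4 using 1
  ring

theorem eq_homogeneousCore {J : HomogeneousIdeal (grading A T)} {K : Ideal (SymmetricAlgebra A T)}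
    (h : K = J.toIdeal) : J = K.homogeneousCore (grading A T) := by
  rw [h, HomogeneousIdeal.toIdeal_homogeneousCore_eq_self]

theorem dvd_minor {E g g' a a₀ b b' b₀ b₀' : A} :
    E ∣ (g * a₀ + E * b₀) * (g' * a + E * b') - (g * a + E * b) * (g' * a₀ + E * b₀') :=
  ⟨g * a₀ * b' + b₀ * g' * a + b₀ * E * b' - (g * a * b₀' + b * g' * a₀ + b * E * b₀'), by ring⟩

end SymProj

theorem AffinePair.symRes_ι_smul_sub {c d : AffinePair q} (h : c ≤ d) (a b : Γ(W, d.U))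
    (s t : d.Tangent) :
    symRes h (SymmetricAlgebra.ι Γ(W, d.U) d.Tangent (a • s - b • t)) =
      algebraMap _ _ (W.presheaf.map (homOfLE h.2).op a) *
          SymmetricAlgebra.ι Γ(W, c.U) c.Tangent (res h s) -
        algebraMap _ _ (W.presheaf.map (homOfLE h.2).op b) *
          SymmetricAlgebra.ι Γ(W, c.U) c.Tangent (res h t) := by
  have h1 : SymmetricAlgebra.ι Γ(W, d.U) d.Tangent (a • s - b • t) =
      algebraMap _ _ a * SymmetricAlgebra.ι Γ(W, d.U) d.Tangent s -
        algebraMap _ _ b * SymmetricAlgebra.ι Γ(W, d.U) d.Tangent t := by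
    rw [map_sub, map_smul, map_smul, Algebra.smul_def, Algebra.smul_def]
  rw [h1, map_sub, map_mul, map_mul]
  exact congrArg₂ (· - ·) (congrArg₂ (· * ·) (symRes_algebraMap h a) (symRes_ι h s))
    (congrArg₂ (· * ·) (symRes_algebraMap h b) (symRes_ι h t))

theorem Chart.notMem_basicOpen_of_mem_equations {c : Chart q} {F : Γ(W, c.U)}
    (hF : F ∈ c.equations i) (x : X) : i x ∉ W.basicOpen F := by
  intro h
  have h1 : x ∈ X.basicOpen (i.app c.U F) := by
    rw [← Scheme.preimage_basicOpen]
    exact h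
  have h2 : i.app c.U F = 0 := i.ideal_ker_le ⟨c.U, c.isAffineOpen_U⟩ hF
  rw [h2, Scheme.basicOpen_zero] at h1
  exact h1

variable [IsIntegral X] [IsClosedImmersion i] [Smooth q] {c : Chart q} {F : Γ(W, c.U)}

/-- The generic point of the conormal variety. -/
theorem Chart.IsEquation.exists_mem_conormalSet (hF : c.IsEquation i F)
    (hsm : genericPoint X ∈ smoothLocus (i ≫ q)) :
    ∃ 𝔮 : Spec (.of (SymmetricAlgebra Γ(W, c.U) c.Tangent)),
      𝔮.asIdeal = (coneIdeal (c.derivMap F) (c.equations i)).toIdeal ∧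
      cotangentBundle.chart q c 𝔮 ∈ conormalSet q i := by
  have := c.isPrime_equations hF.mem
  let 𝔮 : Spec (.of (SymmetricAlgebra Γ(W, c.U) c.Tangent)) := 
    ⟨_, isPrime_coneIdeal (c.derivMap F) (c.equations i)⟩
  have h (r) : algebraMap _ _ r ∈ 𝔮.asIdeal ↔ r ∈ c.equations i :=
    algebraMap_mem_coneIdeal (c.derivMap F) (c.equations i) r
  refine ⟨𝔮, rfl, ⟨_, hsm, ?_⟩, c, 𝔮, rfl, fun t ht => ?_⟩
  · have h1 := c.isAffineOpen_U.fromSpec_primeIdealOf ⟨_, hF.mem⟩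
    have h2 := c.isAffineOpen_U.fromSpec_primeIdealOf ⟨_, cotangentBundle.proj_chart_mem c 𝔮⟩
    refine h1.symm.trans (Eq.trans (congrArg _ ?_) h2)
    apply PrimeSpectrum.ext
    ext r
    rw [c.isAffineOpen_U.mem_primeIdealOf_iff, c.isAffineOpen_U.mem_primeIdealOf_iff]
    exact (c.mem_equations_iff r).symm.trans ((h r).symm.trans
      (cotangentBundle.algebraMap_mem_iff c 𝔮 r))
  · exact (ι_mem_coneIdeal (c.derivMap F) (c.equations i) t).mpr
      ((h _).mp (ht F hF.self_mem))

variable [IsIntegral W]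

set_option maxHeartbeats 1000000 in
/-- Over a point of the smooth locus, a conormal covector is proportional to the differential of a
local equation. -/
theorem Chart.IsEquation.coneIdeal_le_of_mem_conormalSet (hF : c.IsEquation i F)
    (𝔮 : Spec (.of (SymmetricAlgebra Γ(W, c.U) c.Tangent)))
    (h𝔮 : cotangentBundle.chart q c 𝔮 ∈ conormalSet q i) :
    (coneIdeal (c.derivMap F) (c.equations i)).toIdeal ≤ 𝔮.asIdeal := by
  obtain ⟨⟨x, hx, hxw⟩, d, 𝔭, h𝔭, htan⟩ := h𝔮
  change Spec (.of (SymmetricAlgebra Γ(W, d.U) d.Tangent)) at 𝔭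
  have hxc : i x ∈ c.U := by
    rw [hxw]
    exact cotangentBundle.proj_chart_mem c 𝔮
  have hxd : i x ∈ d.U := by
    rw [hxw, ← h𝔭]
    exact cotangentBundle.proj_chart_mem d 𝔭
  obtain ⟨e, hec, hed, hxe⟩ := exists_le c d hxc hxd
  obtain ⟨𝔯, h𝔯⟩ := cotangentBundle.exists_chart_eq e (cotangentBundle.chart q c 𝔮)
    (by rw [← hxw]; exact hxe)
  change Spec (.of (SymmetricAlgebra Γ(W, e.U) e.Tangent)) at 𝔯
  have hξ := genericPoint_mem e.U hxe
  have hE := hF.res hec hξ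
  set E := W.presheaf.map (homOfLE hec.2).op F
  have hc := cotangentBundle.mem_of_chart_eq hec h𝔯
  have hd := cotangentBundle.mem_of_chart_eq hed (h𝔯.trans h𝔭.symm)
  have hIe (r) (hr : r ∈ e.equations i) : algebraMap _ _ r ∈ 𝔯.asIdeal := by
    rw [cotangentBundle.algebraMap_mem_iff, h𝔯, ← hxw]
    exact notMem_basicOpen_of_mem_equations hr x
  have hId (r) (hr : r ∈ d.equations i) : algebraMap _ _ r ∈ 𝔭.asIdeal := by
    rw [cotangentBundle.algebraMap_mem_iff, h𝔭, ← hxw]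
    exact notMem_basicOpen_of_mem_equations hr x
  have hresd (r : Γ(W, d.U)) : algebraMap _ _ (W.presheaf.map (homOfLE hed.2).op r) ∈ 𝔯.asIdeal ↔
      algebraMap _ _ r ∈ 𝔭.asIdeal := by
    rw [← hd, AffinePair.symRes_algebraMap]
  obtain ⟨t₀, G, hG, ht₀⟩ : ∃ t₀ : d.Tangent, ∃ G ∈ d.equations i,
      algebraMap _ _ (d.deriv t₀ G) ∉ 𝔭.asIdeal := by
    by_contra! hcon
    obtain ⟨t, ht⟩ := e.exists_mem_basicOpen_deriv hE.equations_eq hE.ne_zero hx hxe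
    have h1 : d.singIdeal i ≤ 𝔭.asIdeal.comap
        (algebraMap Γ(W, d.U) (SymmetricAlgebra Γ(W, d.U) d.Tangent)) := by
      refine sup_le (fun r hr => hId r hr) (Ideal.span_le.mpr ?_)
      rintro _ ⟨t, G, hG, rfl⟩
      exact hcon t G hG
    have h2 : e.singIdeal i ≤ 𝔯.asIdeal.comap
        (algebraMap Γ(W, e.U) (SymmetricAlgebra Γ(W, e.U) e.Tangent)) := by
      rw [singIdeal_of_le i hed, Ideal.map_le_iff_le_comap]
      intro r hr
      exact (hresd r).mpr (h1 hr)
    have h3 : algebraMap _ _ (e.deriv t E) ∈ 𝔯.asIdeal :=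
      h2 (e.deriv_mem_singIdeal t hE.self_mem)
    rw [cotangentBundle.algebraMap_mem_iff, h𝔯, ← hxw] at h3
    exact h3 ht
  have hmul (G) (hG : G ∈ d.equations i) :
      ∃ g, W.presheaf.map (homOfLE hed.2).op G = g * E := by
    have : W.presheaf.map (homOfLE hed.2).op G ∈ e.equations i :=
      (res_mem_equations_iff hed hξ G).mpr hG
    rw [hE.equations_eq, Ideal.mem_span_singleton'] at this
    obtain ⟨g, hg⟩ := this
    exact ⟨g, hg.symm⟩
  have hder (G g) (hg : W.presheaf.map (homOfLE hed.2).op G = g * E) (t : d.Tangent) :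
      W.presheaf.map (homOfLE hed.2).op (d.deriv t G) =
        g * e.derivMap E (AffinePair.res hed t) +
          E * e.derivMap g (AffinePair.res hed t) := by
    rw [← deriv_res hed, hg]
    exact deriv_mul e _ g E
  obtain ⟨g, hg⟩ := hmul G hG
  have hE𝔯 := hIe E hE.self_mem
  have hprime := 𝔯.isPrime
  have hg𝔯 : algebraMap _ _ (g * e.derivMap E (AffinePair.res hed t₀)) ∉ 𝔯.asIdeal := by
    intro h1
    rw [← hresd, hder G g hg, map_add, map_mul _ E] at ht₀
    exact ht₀ (add_mem h1 (Ideal.mul_mem_right _ _ hE𝔯))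
  have key (t : e.Tangent) : e.derivMap E (AffinePair.res hed t₀) • SymmetricAlgebra.ι Γ(W, e.U) e.Tangent t -
      e.derivMap E t • SymmetricAlgebra.ι Γ(W, e.U) e.Tangent (AffinePair.res hed t₀) ∈ 𝔯.asIdeal := by
    refine tangent_induction hed (p := fun t => e.derivMap E (AffinePair.res hed t₀) •
        SymmetricAlgebra.ι Γ(W, e.U) e.Tangent t - e.derivMap E t •
          SymmetricAlgebra.ι Γ(W, e.U) e.Tangent (AffinePair.res hed t₀) ∈ 𝔯.asIdeal)
      ?_ (fun t => ?_) (fun a t h => minor_smul_mem _ a h) (fun s t hs ht => minor_add_mem _ hs ht) t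
    · simp only [map_zero, smul_zero, zero_smul, sub_zero]
      exact zero_mem _
    · have h1 := htan (d.deriv t₀ G • t - d.deriv t G • t₀) fun G' hG' => by
        obtain ⟨g', hg'⟩ := hmul G' hG'
        have h2 : d.deriv (d.deriv t₀ G • t - d.deriv t G • t₀) G' =
          d.deriv t₀ G * d.deriv t G' - d.deriv t G * d.deriv t₀ G' := rfl
        refine (hresd _).mp (hIe _ ?_)
        rw [h2, map_sub, map_mul, map_mul, hder G g hg, hder G g hg, hder G' g' hg', hder G' g' hg',
          hE.equations_eq, Ideal.mem_span_singleton]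
        exact dvd_minor
      have h2 : SymmetricAlgebra.ι Γ(W, d.U) d.Tangent (d.deriv t₀ G • t - d.deriv t G • t₀) ∈
        𝔭.asIdeal := h1
      rw [← hd, AffinePair.symRes_ι_smul_sub, hder G g hg, hder G g hg] at h2
      have h3 : algebraMap _ _ g ∉ 𝔯.asIdeal := fun h3 => hg𝔯 (by
        rw [map_mul]
        exact Ideal.mul_mem_right _ _ h3)
      exact sub_mem_of_mul_sub_mem hE𝔯 h3 h2
  have hle := coneIdeal_le (e.derivMap E) (e.equations i) (K := 𝔯.asIdeal) hIe
    (t₀ := AffinePair.res hed t₀) (fun h1 => hg𝔯 (by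
      rw [map_mul]
      exact Ideal.mul_mem_left _ _ h1)) key
  refine homogeneousIdeal_le fun n y hy hyc => ?_
  rw [← hc]
  exact hle ((IsEquation.symRes_mem_coneIdeal hec hξ hy).mpr hyc)

theorem Chart.IsEquation.coneIdeal_le_of_mem_conormalVariety (hF : c.IsEquation i F)
    (𝔮 : Spec (.of (SymmetricAlgebra Γ(W, c.U) c.Tangent)))
    (h𝔮 : cotangentBundle.chart q c 𝔮 ∈ conormalVariety q i) :
    (coneIdeal (c.derivMap F) (c.equations i)).toIdeal ≤ 𝔮.asIdeal := by
  have h1 : 𝔮 ∈ cotangentBundle.chart q c ⁻¹' closure (conormalSet q i) := h𝔮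
  rw [(cotangentBundle.chart q c).isOpenEmbedding.isOpenMap.preimage_closure_eq_closure_preimage
    (cotangentBundle.chart q c).continuous] at h1
  exact closure_minimal (t := PrimeSpectrum.zeroLocus
    ((coneIdeal (c.derivMap F) (c.equations i)).toIdeal : Set (SymmetricAlgebra Γ(W, c.U) c.Tangent)))
    (fun 𝔭 h => hF.coneIdeal_le_of_mem_conormalSet 𝔭 h) (PrimeSpectrum.isClosed_zeroLocus _) h1

theorem Chart.IsEquation.chart_point_mem_projectivization (hF : c.IsEquation i F)
    (hsm : genericPoint X ∈ smoothLocus (i ≫ q)) :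
    projCotangentBundle.chart q c (hF.point hsm) ∈ projectivization q (conormalVariety q i) := by
  obtain ⟨𝔮, h𝔮, h⟩ := hF.exists_mem_conormalSet hsm
  exact ⟨c, 𝔮, hF.point hsm, subset_closure h,
    eq_homogeneousCore (J := coneIdeal (c.derivMap F) (c.equations i)) (K := 𝔮.asIdeal) h𝔮, rfl⟩

theorem closure_projectivization (hF : c.IsEquation i F)
    (hsm : genericPoint X ∈ smoothLocus (i ≫ q))
    (hgood : ∀ x : X, ∃ (d : Chart q) (G : Γ(W, d.U)), i x ∈ d.U ∧ d.IsEquation i G) :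
    closure (projectivization q (conormalVariety q i)) =
      closure {projCotangentBundle.chart q c (hF.point hsm)} := by
  have hmem := hF.chart_point_mem_projectivization hsm
  apply le_antisymm
  · refine closure_minimal ?_ isClosed_closure
    rintro _ ⟨d, 𝔮, l, h𝔮, hl, rfl⟩
    change Spec (.of (SymmetricAlgebra Γ(W, d.U) d.Tangent)) at 𝔮
    have hcl : cotangentBundle.proj q (cotangentBundle.chart q d 𝔮) ∈ Set.range i := by
      refine closure_minimal (t := cotangentBundle.proj q ⁻¹' Set.range i) ?_
        (i.isClosedEmbedding.isClosed_range.preimage (cotangentBundle.proj q).continuous) h𝔮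
      rintro ξ ⟨⟨x, _, hx⟩, _⟩
      exact ⟨x, hx⟩
    obtain ⟨x, hx⟩ := hcl
    obtain ⟨d', G, hxd', hG⟩ := hgood x
    obtain ⟨e, hed, hed', hxe⟩ := Chart.exists_le d d'
      (hx ▸ cotangentBundle.proj_chart_mem d 𝔮) hxd'
    have hξ := Chart.genericPoint_mem e.U hxe
    have hE := hG.res hed' hξ
    obtain ⟨𝔯, h𝔯⟩ := cotangentBundle.exists_chart_eq e (cotangentBundle.chart q d 𝔮)
      (by rw [← hx]; exact hxe)
    change Spec (.of (SymmetricAlgebra Γ(W, e.U) e.Tangent)) at 𝔯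
    have hle := hE.coneIdeal_le_of_mem_conormalVariety 𝔯 (h𝔯 ▸ h𝔮)
    let l₀ : Proj d.symGrading := Proj.map (AffinePair.symRes hed)
      (AffinePair.symRes_irrelevant hed d.free d.finite) (hE.point hsm)
    have hl₀ : projCotangentBundle.chart q d l₀ = projCotangentBundle.chart q c (hF.point hsm) :=
      (congr($(projCotangentBundle.map_chart q hed) (hE.point hsm))).trans
        (hE.chart_point_eq hF hsm)
    rw [← hl₀, ← specializes_iff_mem_closure]
    refine Specializes.map ?_ (projCotangentBundle.chart q d).continuous
    refine specializes_iff_mem_closure.mpr ((ProjectiveSpectrum.le_iff_mem_closure _ _ _).mp ?_)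
    change l₀.asHomogeneousIdeal.toIdeal ≤ l.asHomogeneousIdeal.toIdeal
    refine homogeneousIdeal_le fun n y hy hyl => ?_
    rw [hl]
    refine Ideal.mem_homogeneousCore_of_homogeneous_of_mem ⟨n, hy⟩ ?_
    rw [← cotangentBundle.mem_of_chart_eq hed h𝔯]
    exact hle hyl
  · exact closure_mono (Set.singleton_subset_iff.mpr hmem)

end RelConormal

end

noncomputable section

namespace AlgebraicGeometry.Scheme.IdealSheafData

theorem isReduced_subscheme_vanishingIdeal {P : Scheme.{u}} (Z : TopologicalSpace.Closeds P) :
    IsReduced (vanishingIdeal Z).subscheme := by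
  have h (U : P.affineOpens) : IsReduced (Spec (.of (Γ(P, U.1) ⧸ (vanishingIdeal Z).ideal U))) := by
    have : _root_.IsReduced (Γ(P, U.1) ⧸ (vanishingIdeal Z).ideal U) := by
      rw [← Ideal.isRadical_iff_quotient_reduced, vanishingIdeal_ideal]
      exact PrimeSpectrum.isRadical_vanishingIdeal _
    exact (affine_isReduced_iff _).mpr this
  have (U : (vanishingIdeal Z).subschemeCover.openCover.I₀) :
    IsReduced ((vanishingIdeal Z).subschemeCover.openCover.X U) := h U
  exact IsReduced.of_openCover _ (vanishingIdeal Z).subschemeCover.openCover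

theorem range_subschemeι_vanishingIdeal {P : Scheme.{u}} (Z : TopologicalSpace.Closeds P) :
    Set.range (vanishingIdeal Z).subschemeι = Z := by
  rw [range_subschemeι]
  rfl

theorem isIntegral_subscheme_vanishingIdeal_closure {P : Scheme.{u}} (η : P) :
    IsIntegral (vanishingIdeal (X := P) ⟨closure {η}, isClosed_closure⟩).subscheme := by
  have := isReduced_subscheme_vanishingIdeal (P := P) ⟨closure {η}, isClosed_closure⟩
  have h := range_subschemeι_vanishingIdeal (P := P) ⟨closure {η}, isClosed_closure⟩
  obtain ⟨z, hz⟩ : η ∈ Set.range (vanishingIdeal (X := P) ⟨closure {η}, isClosed_closure⟩).subschemeι := by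
    rw [h]
    exact subset_closure rfl
  have : IrreducibleSpace (vanishingIdeal (X := P) ⟨closure {η}, isClosed_closure⟩).subscheme := by
    refine (irreducibleSpace_def _).mpr ?_
    have h1 : closure {z} = Set.univ := by
      refine Set.eq_univ_of_forall fun x => ?_
      rw [(vanishingIdeal (X := P) ⟨closure {η}, isClosed_closure⟩).subschemeι.isEmbedding.closure_eq_preimage_closure_image,
        Set.image_singleton, hz]
      exact h.le ⟨x, rfl⟩
    rw [Set.top_eq_univ, ← h1]
    exact isIrreducible_singleton.closure
  exact isIntegral_of_irreducibleSpace_of_isReduced _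

theorem vanishingIdeal_le_ker_iff {P : Scheme.{u}} {B C : CommRingCat.{u}} (j : Spec B ⟶ P)
    [IsOpenImmersion j] (y : Spec B) (φ : B ⟶ C) :
    vanishingIdeal ⟨closure {j y}, isClosed_closure⟩ ≤ (Spec.map φ ≫ j).ker ↔
      ∀ b ∈ y.asIdeal, φ b = 0 := by
  rw [Scheme.Hom.ker_comp, le_map_iff_comap_le]
  have h1 (b : B) : (ΓSpecIso B).inv b ∈
      ((vanishingIdeal ⟨closure {j y}, isClosed_closure⟩).comap j).ideal ⟨⊤, isAffineOpen_top _⟩ ↔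
        b ∈ y.asIdeal := by
    rw [ideal_comap_of_isOpenImmersion, Ideal.mem_comap, mem_ideal_vanishingIdeal_closure]
    have h : j y ∈ P.basicOpen ((j.appIso ⊤).inv ((ΓSpecIso B).inv b)) ↔
        y ∈ (Spec B).basicOpen ((ΓSpecIso B).inv b) := by
      rw [← Scheme.image_basicOpen]
      exact Function.Injective.mem_set_image j.isOpenEmbedding.injective
    have h' : y ∈ (Spec B).basicOpen ((ΓSpecIso B).inv b) ↔ b ∉ y.asIdeal := by
      rw [basicOpen_eq_of_affine', ← CategoryTheory.comp_apply, Iso.inv_hom_id]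
      rfl
    exact (not_congr (h.trans h')).trans not_not
  have h2 (b : B) : (ΓSpecIso B).inv b ∈ (Spec.map φ).ker.ideal ⟨⊤, isAffineOpen_top _⟩ ↔
      φ b = 0 := by
    rw [Scheme.Hom.ker_apply, RingHom.mem_ker]
    have h3 : (Spec.map φ).appTop ((ΓSpecIso B).inv b) = (ΓSpecIso C).inv (φ b) :=
      congr($(ΓSpecIso_inv_naturality φ) b).symm
    refine (Eq.congr_left h3).trans ?_
    exact map_eq_zero_iff _ (ConcreteCategory.bijective_of_isIso (ΓSpecIso C).inv).1
  constructor
  · intro h b hb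
    exact (h2 b).mp (h _ ((h1 b).mpr hb))
  · intro h
    refine le_of_isAffine fun f hf => ?_
    obtain ⟨b, rfl⟩ := (ConcreteCategory.bijective_of_isIso (ΓSpecIso B).inv).2 f
    exact (h2 b).mpr (h b ((h1 b).mp hf))

end AlgebraicGeometry.Scheme.IdealSheafData

end

noncomputable section

namespace RelConormal

open SymProj

theorem notMem_asIdeal_of_isUnit {B C : CommRingCat.{u}} (φ : B ⟶ C) (z : Spec C) {b : B}
    (h : IsUnit (φ b)) : b ∉ (Spec.map φ z).asIdeal := fun h1 =>
  z.isPrime.ne_top (Ideal.eq_top_of_isUnit_mem _ h1 h)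

theorem SymProj.map_toAway_eq {A T C : Type u} [CommRing A] [AddCommGroup T] [Module A T] [CommRing C]
    {t : T} (φ : Away (grading A T) (SymmetricAlgebra.ι A T t) →+* C) {a a' : A} {t' : T}
    (h : φ (frac (ι_mem t) (a' • t + (-a) • t')) = 0) :
    φ (toAway T _ a') = φ (frac (ι_mem t) t') * φ (toAway T _ a) := by
  rw [frac_add, frac_smul, frac_smul, frac_self _ rfl, mul_one, map_neg, map_add, map_mul, map_neg,
    neg_mul, add_neg_eq_zero] at h
  rw [h, mul_comm]

theorem SymProj.lift_minor {A T : Type u} [CommRing A] [AddCommGroup T] [Module A T] (a : T →ₗ[A] A)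
    (t t' : T) :
    SymmetricAlgebra.lift a (SymmetricAlgebra.ι A T (a t' • t + (-a t) • t')) = 0 := by
  rw [SymmetricAlgebra.lift_ι_apply, map_add, map_smul, map_smul, smul_eq_mul, smul_eq_mul]
  ring

theorem isUnit_of_eq_mul_of_dvd {C : Type*} [CommRing C] {x y u : C} (hx : x ∈ nonZeroDivisors C)
    (h : x = u * y) (hxy : x ∣ y) : IsUnit u := by
  obtain ⟨a, rfl⟩ := hxy
  refine IsUnit.of_mul_eq_one a ((mul_cancel_left_mem_nonZeroDivisors hx).mp ?_)
  rw [mul_one, mul_left_comm]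
  exact h.symm

theorem _root_.AlgebraicGeometry.IsOpenImmersion.exists_specMap_comp_eq {P : Scheme.{u}}
    {B C : CommRingCat.{u}} (j : Spec B ⟶ P) [IsOpenImmersion j] (γ : Spec C ⟶ P)
    (hr : Set.range γ ⊆ Set.range j) : ∃ φ : B ⟶ C, Spec.map φ ≫ j = γ := by
  obtain ⟨φ, hφ⟩ := Spec.map_surjective (IsOpenImmersion.lift j γ hr)
  exact ⟨φ, by rw [hφ, IsOpenImmersion.lift_fac]⟩

variable {W S X : Scheme.{u}} {q : W ⟶ S} {i : X ⟶ W}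
variable {c : Chart q} {F : Γ(W, c.U)}

/-- The derivatives of the equation `F` pull back along `ψ` to multiples of the nonzerodivisor
`ψ (t₀ F)`. -/
structure Chart.IsAdapted (c : Chart q) (F : Γ(W, c.U)) (t₀ : c.Tangent) {C : CommRingCat.{u}}
    (ψ : Γ(W, c.U) ⟶ C) : Prop where
  map_eq_zero : ψ F = 0
  mem_nonZeroDivisors : ψ (c.deriv t₀ F) ∈ nonZeroDivisors C
  dvd : ∀ t, ψ (c.deriv t₀ F) ∣ ψ (c.deriv t F)

theorem Chart.IsAdapted.localization {t₀ : c.Tangent} {C : CommRingCat.{u}} {ψ : Γ(W, c.U) ⟶ C}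
    (hψ : c.IsAdapted F t₀ ψ) (s : C) :
    c.IsAdapted F t₀ (ψ ≫ CommRingCat.ofHom (algebraMap C (Localization.Away s))) where
  map_eq_zero := by
    rw [CategoryTheory.comp_apply, hψ.map_eq_zero, map_zero]
  mem_nonZeroDivisors := IsLocalization.map_nonZeroDivisors_le (.powers s) (Localization.Away s)
    ⟨_, hψ.mem_nonZeroDivisors, rfl⟩
  dvd t := map_dvd (algebraMap C (Localization.Away s)) (hψ.dvd t)

variable [Smooth q]

theorem toAway_comp {t : c.Tangent} {C : CommRingCat.{u}}
    {φ : CommRingCat.of (Away c.symGrading (SymmetricAlgebra.ι Γ(W, c.U) c.Tangent t)) ⟶ C}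
    {ψ : Γ(W, c.U) ⟶ C} (h : (Spec.map φ ≫ projCotangentBundle.piece q c t) ≫
      projCotangentBundle.proj q = Spec.map ψ ≫ c.isAffineOpen_U.fromSpec) (a : Γ(W, c.U)) :
    φ (toAway c.Tangent _ a) = ψ a := by
  have := c.isAffineOpen_U.isOpenImmersion_fromSpec
  rw [Category.assoc, projCotangentBundle.piece_proj, ← Category.assoc, cancel_mono,
    ← Spec.map_comp] at h
  exact congr($(Spec.map_injective h) a)

variable [IsIntegral X] [IsClosedImmersion i] [IsIntegral W]

variable (q i) in
/-- The morphism `q` and its hypersurface `X`: every point of `X` has a chart with a local equation of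
`X`, and `X` is generically smooth over the base. -/
structure IsHypersurface : Prop where
  smooth : genericPoint X ∈ smoothLocus (i ≫ q)
  exists_isEquation : ∀ x : X, ∃ (c : Chart q) (F : Γ(W, c.U)), i x ∈ c.U ∧ c.IsEquation i F

theorem IsHypersurface.projConormalIdeal_eq (H : IsHypersurface q i) (hF : c.IsEquation i F) :
    projConormalIdeal q i = .vanishingIdeal
      ⟨closure {projCotangentBundle.chart q c (hF.point H.smooth)}, isClosed_closure⟩ := by
  rw [projConormalIdeal]
  congr 2
  exact closure_projectivization hF H.smooth H.exists_isEquation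

theorem IsHypersurface.projConormalIdeal_le_ker_iff (H : IsHypersurface q i) (hF : c.IsEquation i F) {t : c.Tangent}
    (ht : c.deriv t F ∉ c.equations i) {C : CommRingCat.{u}}
    (φ : CommRingCat.of (Away c.symGrading (SymmetricAlgebra.ι Γ(W, c.U) c.Tangent t)) ⟶ C) :
    projConormalIdeal q i ≤ (Spec.map φ ≫ projCotangentBundle.piece q c t).ker ↔
      ∀ k x (hx : x ∈ c.symGrading (k • 1)), SymmetricAlgebra.lift (c.derivMap F) x ∈ c.equations i →
        φ (Away.mk c.symGrading (ι_mem t) k x hx) = 0 := by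
  obtain ⟨y, hy, hy'⟩ := projCotangentBundle.exists_piece_eq q c t (hF.point H.smooth)
    fun h => ht ((ι_mem_coneIdeal (c.derivMap F) (c.equations i) t).mp h)
  have hmem (k x) (hx : x ∈ c.symGrading (k • 1)) :
      Away.mk c.symGrading (ι_mem t) k x hx ∈ y.asIdeal ↔
        SymmetricAlgebra.lift (c.derivMap F) x ∈ c.equations i :=
    (hy' k x hx).trans (mem_coneIdeal (c.derivMap F) (c.equations i) hx)
  have h0 := Scheme.IdealSheafData.vanishingIdeal_le_ker_iff (projCotangentBundle.piece q c t) y φ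
  have hJ : projConormalIdeal q i = .vanishingIdeal
      ⟨closure {projCotangentBundle.piece q c t y}, isClosed_closure⟩ :=
    (H.projConormalIdeal_eq hF).trans (congrArg
      (fun z => Scheme.IdealSheafData.vanishingIdeal ⟨closure {z}, isClosed_closure⟩) hy.symm)
  refine Iff.trans ⟨fun h => h0.mp (hJ.ge.trans h), fun h => hJ.le.trans (h0.mpr h)⟩ ?_
  constructor
  · intro h k x hx hxI
    exact h _ ((hmem k x hx).mpr hxI)
  · intro h b hb
    obtain ⟨k, x, hx, rfl⟩ := Away.mk_surjective c.symGrading (ι_mem t) b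
    exact h k x hx ((hmem k x hx).mp hb)

theorem IsHypersurface.deriv_notMem (H : IsHypersurface q i) (hF : c.IsEquation i F) {T : Scheme.{u}}
    {γ : T ⟶ projCotangentBundle q} (hγ : projConormalIdeal q i ≤ γ.ker) {y : T} {t : c.Tangent}
    (hy : γ y ∈ (projCotangentBundle.piece q c t).opensRange) : c.deriv t F ∉ c.equations i := by
  rw [H.projConormalIdeal_eq hF, ← Scheme.IdealSheafData.map_bot,
    Scheme.IdealSheafData.le_map_iff_comap_le, le_bot_iff] at hγ
  have h1 := congrArg Scheme.IdealSheafData.support hγ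
  rw [Scheme.IdealSheafData.support_comap, Scheme.IdealSheafData.support_bot] at h1
  have h2 : γ y ∈ closure {projCotangentBundle.chart q c (hF.point H.smooth)} :=
    h1.ge (Set.mem_univ y)
  have h3 := (specializes_iff_mem_closure.mpr h2).mem_open
    (projCotangentBundle.piece q c t).opensRange.2 hy
  have h4 := (projCotangentBundle.mem_opensRange_piece q c t (hF.point H.smooth)).mp h3
  exact fun h => h4 ((ι_mem_coneIdeal (c.derivMap F) (c.equations i) t).mpr h)

theorem IsHypersurface.map_deriv (H : IsHypersurface q i) (hF : c.IsEquation i F) {t : c.Tangent}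
    (ht : c.deriv t F ∉ c.equations i) {C : CommRingCat.{u}}
    (φ : CommRingCat.of (Away c.symGrading (SymmetricAlgebra.ι Γ(W, c.U) c.Tangent t)) ⟶ C)
    (hφ : projConormalIdeal q i ≤ (Spec.map φ ≫ projCotangentBundle.piece q c t).ker)
    (t' : c.Tangent) :
    φ (toAway c.Tangent _ (c.deriv t' F)) =
      φ (frac (ι_mem t) t') * φ (toAway c.Tangent _ (c.deriv t F)) := by
  have h1 := (H.projConormalIdeal_le_ker_iff hF ht φ).mp hφ 1
    (SymmetricAlgebra.ι Γ(W, c.U) c.Tangent (c.derivMap F t' • t + (-c.derivMap F t) • t'))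
    (ι_mem _) (by rw [lift_minor]; exact zero_mem _)
  exact map_toAway_eq φ.hom h1

theorem IsHypersurface.mem_opensRange_piece (H : IsHypersurface q i) (hF : c.IsEquation i F)
    {t₀ : c.Tangent} {C : CommRingCat.{u}} {ψ : Γ(W, c.U) ⟶ C} (hψ : c.IsAdapted F t₀ ψ)
    {γ : Spec C ⟶ projCotangentBundle q} (hγ : projConormalIdeal q i ≤ γ.ker)
    (hproj : γ ≫ projCotangentBundle.proj q = Spec.map ψ ≫ c.isAffineOpen_U.fromSpec) (y : Spec C) :
    γ y ∈ (projCotangentBundle.piece q c t₀).opensRange := by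
  have hyc : projCotangentBundle.proj q (γ y) ∈ c.U := by
    rw [← Scheme.Hom.comp_apply, hproj, Scheme.Hom.comp_apply]
    exact c.isAffineOpen_U.range_fromSpec.le ⟨_, rfl⟩
  obtain ⟨t, ht⟩ := projCotangentBundle.exists_mem_opensRange_piece q c hyc
  have htF := H.deriv_notMem hF hγ ht
  obtain ⟨_, ⟨_, ⟨s, rfl⟩, rfl⟩, hys, hs⟩ :=
    PrimeSpectrum.isBasis_basic_opens.exists_subset_of_mem_open
      (show y ∈ (γ ⁻¹ᵁ (projCotangentBundle.piece q c t).opensRange : Set (Spec C)) from ht)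
      (γ ⁻¹ᵁ (projCotangentBundle.piece q c t).opensRange).2
  let j : C ⟶ CommRingCat.of (Localization.Away s) := CommRingCat.ofHom (algebraMap _ _)
  have hj : Set.range (Spec.map j) = (PrimeSpectrum.basicOpen s : Set (PrimeSpectrum C)) :=
    PrimeSpectrum.localization_away_comap_range (Localization.Away s) s
  have hr : Set.range (Spec.map j ≫ γ) ⊆ Set.range (projCotangentBundle.piece q c t) := by
    rintro _ ⟨z, rfl⟩
    rw [Scheme.Hom.comp_apply]
    exact hs (hj.le ⟨z, rfl⟩)
  obtain ⟨φ, hfac⟩ := IsOpenImmersion.exists_specMap_comp_eq (projCotangentBundle.piece q c t) _ hr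
  have hker : projConormalIdeal q i ≤ (Spec.map φ ≫ projCotangentBundle.piece q c t).ker := by
    rw [hfac]
    exact hγ.trans (Scheme.Hom.le_ker_comp _ _)
  have hcomp (a) : φ (toAway c.Tangent _ a) = j (ψ a) :=
    toAway_comp (ψ := ψ ≫ j) (by rw [hfac, Category.assoc, hproj, Spec.map_comp, Category.assoc]) a
  have key := H.map_deriv hF htF φ hker t₀
  have hunit : IsUnit (φ (frac (ι_mem t) t₀)) := by
    refine isUnit_of_eq_mul_of_dvd (hψ.localization s).mem_nonZeroDivisors ?_
      ((hψ.localization s).dvd t)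
    exact (hcomp _).symm.trans (key.trans (congrArg _ (hcomp _)))
  obtain ⟨z, hz⟩ : y ∈ Set.range (Spec.map j) := hj.ge hys
  have hγy : γ y = projCotangentBundle.piece q c t (Spec.map φ z) :=
    (congrArg γ hz).symm.trans congr($hfac z).symm
  refine Set.mem_of_eq_of_mem hγy
    ((projCotangentBundle.piece_mem_opensRange_piece q c t t₀ _).mpr ?_)
  exact notMem_asIdeal_of_isUnit φ z hunit

theorem IsHypersurface.exists_specMap_comp_piece (H : IsHypersurface q i) (hF : c.IsEquation i F)
    {t₀ : c.Tangent} {C : CommRingCat.{u}} {ψ : Γ(W, c.U) ⟶ C} (hψ : c.IsAdapted F t₀ ψ)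
    {γ : Spec C ⟶ projCotangentBundle q} (hγ : projConormalIdeal q i ≤ γ.ker)
    (hproj : γ ≫ projCotangentBundle.proj q = Spec.map ψ ≫ c.isAffineOpen_U.fromSpec) :
    ∃ φ : CommRingCat.of (Away c.symGrading (SymmetricAlgebra.ι Γ(W, c.U) c.Tangent t₀)) ⟶ C,
      Spec.map φ ≫ projCotangentBundle.piece q c t₀ = γ :=
  IsOpenImmersion.exists_specMap_comp_eq _ _
    (Set.range_subset_iff.mpr fun y => H.mem_opensRange_piece hF hψ hγ hproj y)

theorem IsHypersurface.lift_unique_of_isAdapted (H : IsHypersurface q i) (hF : c.IsEquation i F)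
    {t₀ : c.Tangent} {C : CommRingCat.{u}} {ψ : Γ(W, c.U) ⟶ C} (hψ : c.IsAdapted F t₀ ψ)
    {γ γ' : Spec C ⟶ projCotangentBundle q} (hγ : projConormalIdeal q i ≤ γ.ker)
    (hγ' : projConormalIdeal q i ≤ γ'.ker)
    (hproj : γ ≫ projCotangentBundle.proj q = Spec.map ψ ≫ c.isAffineOpen_U.fromSpec)
    (hproj' : γ' ≫ projCotangentBundle.proj q = Spec.map ψ ≫ c.isAffineOpen_U.fromSpec) :
    γ = γ' := by
  obtain ⟨φ, hφ⟩ := H.exists_specMap_comp_piece hF hψ hγ hproj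
  obtain ⟨φ', hφ'⟩ := H.exists_specMap_comp_piece hF hψ hγ' hproj'
  have hcomp (a) := toAway_comp (hφ ▸ hproj) a
  have hcomp' (a) := toAway_comp (hφ' ▸ hproj') a
  refine hφ.symm.trans (Eq.trans ?_ hφ')
  suffices φ = φ' by rw [this]
  rcases isEmpty_or_nonempty (Spec C) with h | h
  · have : Subsingleton C := PrimeSpectrum.isEmpty_iff_subsingleton.mp h
    ext
    exact Subsingleton.elim _ _
  · obtain ⟨y⟩ := h
    have ht₀ := H.deriv_notMem hF hγ (H.mem_opensRange_piece hF hψ hγ hproj y)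
    refine CommRingCat.hom_ext (away_ext (ι_mem t₀) (fun a => (hcomp a).trans (hcomp' a).symm)
      fun t => ?_)
    have h1 := H.map_deriv hF ht₀ φ (hφ ▸ hγ) t
    have h2 := H.map_deriv hF ht₀ φ' (hφ' ▸ hγ') t
    refine (mul_cancel_right_mem_nonZeroDivisors hψ.mem_nonZeroDivisors).mp ?_
    exact (congrArg _ (hcomp _)).symm.trans (h1.symm.trans ((hcomp _).trans ((hcomp' _).symm.trans
      (h2.trans (congrArg _ (hcomp' _))))))

theorem IsHypersurface.exists_lift_of_isAdapted (H : IsHypersurface q i) (hF : c.IsEquation i F)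
    {t₀ : c.Tangent} {C : CommRingCat.{u}} [Nontrivial C] {ψ : Γ(W, c.U) ⟶ C}
    (hψ : c.IsAdapted F t₀ ψ) :
    ∃ γ : Spec C ⟶ projCotangentBundle q, projConormalIdeal q i ≤ γ.ker ∧
      γ ≫ projCotangentBundle.proj q = Spec.map ψ ≫ c.isAffineOpen_U.fromSpec := by
  let := ψ.hom.toAlgebra
  have hnzd := hψ.mem_nonZeroDivisors
  choose a ha using hψ.dvd
  let φ : c.Tangent →ₗ[Γ(W, c.U)] C :=
    { toFun := a
      map_add' s t := by
        refine (mul_cancel_left_mem_nonZeroDivisors hnzd).mp ?_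
        rw [← ha, mul_add, ← ha, ← ha, ← map_add]
        rfl
      map_smul' r t := by
        refine (mul_cancel_left_mem_nonZeroDivisors hnzd).mp ?_
        rw [← ha, RingHom.id_apply, Algebra.smul_def, mul_left_comm, ← ha]
        exact map_mul ψ.hom r (c.deriv t F) }
  have h1 : SymmetricAlgebra.lift φ (SymmetricAlgebra.ι Γ(W, c.U) c.Tangent t₀) = 1 := by
    rw [SymmetricAlgebra.lift_ι_apply]
    refine (mul_cancel_left_mem_nonZeroDivisors hnzd).mp ?_
    rw [mul_one]
    exact (ha t₀).symm
  have hI (r) (hr : r ∈ c.equations i) : ψ r = 0 := by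
    rw [hF.equations_eq, Ideal.mem_span_singleton'] at hr
    obtain ⟨u, rfl⟩ := hr
    rw [map_mul, hψ.map_eq_zero, mul_zero]
  have ht₀ : c.deriv t₀ F ∉ c.equations i := fun h => by
    rw [hI _ h] at hnzd
    exact zero_notMem_nonZeroDivisors hnzd
  refine ⟨Spec.map (CommRingCat.ofHom (awayLift φ h1)) ≫ projCotangentBundle.piece q c t₀, ?_, ?_⟩
  · rw [H.projConormalIdeal_le_ker_iff hF ht₀]
    intro k x hx hxI
    have h2 := pow_mul_awayLift (c.derivMap F) (ι_mem t₀) φ h1 (ψ (c.deriv t₀ F)) ha hx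
    have h3 : algebraMap Γ(W, c.U) C (SymmetricAlgebra.lift (c.derivMap F) x) = 0 := hI _ hxI
    rw [h3] at h2
    exact (mul_right_mem_nonZeroDivisors_eq_zero_iff (pow_mem hnzd k)).mp ((mul_comm _ _).trans h2)
  · rw [Category.assoc, projCotangentBundle.piece_proj, ← Category.assoc, ← Spec.map_comp]
    congr 2
    ext r
    exact awayLift_toAway φ h1 r

end RelConormal

end

noncomputable section

theorem Ideal.exists_eq_mul_of_span_range_eq {R ι : Type*} [CommRing R] {b : ι → R} {f : R}
    (hf : f ∈ nonZeroDivisors R) (h : Ideal.span (Set.range b) = Ideal.span {f}) (P : Ideal R)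
    [P.IsPrime] : ∃ (t : ι) (a : R), a ∉ P ∧ b t = a * f := by
  have h1 (t : ι) : ∃ a, a * f = b t := by
    rw [← Ideal.mem_span_singleton', ← h]
    exact Ideal.subset_span ⟨t, rfl⟩
  choose a ha using h1
  by_contra! hcon
  have hP (t : ι) : a t ∈ P := by
    by_contra hP
    exact hcon t (a t) hP (ha t).symm
  have h2 : Ideal.span (Set.range b) ≤ P * Ideal.span {f} := by
    rw [Ideal.span_le]
    rintro _ ⟨t, rfl⟩
    exact Ideal.mem_mul_span_singleton.mpr ⟨a t, hP t, ha t⟩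
  obtain ⟨p, hp, hpf⟩ := Ideal.mem_mul_span_singleton.mp (h2 (h ▸ Ideal.mem_span_singleton_self f))
  have : p = 1 := (mul_cancel_right_mem_nonZeroDivisors hf).mp (by rw [hpf, one_mul])
  exact Ideal.IsPrime.ne_top ‹_› ((Ideal.eq_top_iff_one _).mpr (this ▸ hp))

theorem AlgebraicGeometry.IsAffineOpen.exists_isUnit_res {T : Scheme.{u}} (V : T.affineOpens)
    (a : Γ(T, V.1)) {x : T} (hx : x ∈ T.basicOpen a) :
    ∃ (V' : T.affineOpens) (h : V'.1 ≤ V.1), x ∈ V'.1 ∧ IsUnit (T.presheaf.map (homOfLE h).op a) ∧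
      ∀ f ∈ nonZeroDivisors Γ(T, V.1),
        T.presheaf.map (homOfLE h).op f ∈ nonZeroDivisors Γ(T, V'.1) := by
  refine ⟨T.affineBasicOpen a, T.basicOpen_le a, hx,
    RingedSpace.isUnit_res_basicOpen T.toRingedSpace a, fun f hf => ?_⟩
  have := V.2.isLocalization_basicOpen a
  exact IsLocalization.map_nonZeroDivisors_le (.powers a) Γ(T, T.basicOpen a) ⟨f, hf, rfl⟩

namespace RelConormal

open SymProj

variable {W S X : Scheme.{u}} {q : W ⟶ S} {i : X ⟶ W} {c : Chart q} {F : Γ(W, c.U)}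
variable [IsIntegral X]

theorem Chart.IsEquation.map_singIdeal (hF : c.IsEquation i F) {C : CommRingCat.{u}}
    (ψ : Γ(W, c.U) ⟶ C) (h : ψ F = 0) :
    (c.singIdeal i).map ψ.hom = Ideal.span (Set.range fun t => ψ (c.deriv t F)) := by
  apply le_antisymm
  · rw [Ideal.map_le_iff_le_comap]
    refine sup_le ?_ (Ideal.span_le.mpr ?_)
    · rw [hF.equations_eq, Ideal.span_singleton_le_iff_mem]
      exact (congrArg (· ∈ Ideal.span (Set.range fun t => ψ (c.deriv t F))) h).mpr (zero_mem _)
    · rintro _ ⟨t, G, hG, rfl⟩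
      rw [hF.equations_eq, Ideal.mem_span_singleton'] at hG
      obtain ⟨g, rfl⟩ := hG
      have h1 : ψ (c.deriv t (g * F)) = ψ g * ψ (c.deriv t F) := by
        rw [deriv_mul, map_add, map_mul, map_mul, h, zero_mul, add_zero]
      exact (congrArg (· ∈ Ideal.span (Set.range fun t => ψ (c.deriv t F))) h1).mpr
        (Ideal.mul_mem_left _ _ (Ideal.subset_span ⟨t, rfl⟩))
  · rw [Ideal.span_le]
    rintro _ ⟨t, rfl⟩
    exact Ideal.mem_map_of_mem _ (c.deriv_mem_singIdeal t hF.self_mem)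

theorem Chart.IsEquation.appLE_eq_zero (hF : c.IsEquation i F) {T : Scheme.{u}} (g : T ⟶ X)
    {V : T.Opens} (h : V ≤ (g ≫ i) ⁻¹ᵁ c.U) : (g ≫ i).appLE c.U V h F = 0 := by
  have h1 : i.app c.U F = 0 := i.ideal_ker_le ⟨c.U, c.isAffineOpen_U⟩ hF.self_mem
  rw [Scheme.Hom.comp_appLE, CategoryTheory.comp_apply, h1, map_zero]

variable [Smooth q] [CompactSpace W] [QuasiSeparatedSpace W]

theorem IsHypersurface.exists_isAdapted (H : IsHypersurface q i) {T : Scheme.{u}} (g : T ⟶ X)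
    (hg : IsInvertibleIdeal ((relSingIdeal q i).comap (g ≫ i))) (x : T) :
    ∃ (V : T.affineOpens) (c : Chart q) (F : Γ(W, c.U)) (h : V.1 ≤ (g ≫ i) ⁻¹ᵁ c.U) (t₀ : c.Tangent),
      x ∈ V.1 ∧ c.IsEquation i F ∧ c.IsAdapted F t₀ ((g ≫ i).appLE c.U V.1 h) := by
  obtain ⟨c, F, hxc, hF⟩ := H.exists_isEquation (g x)
  obtain ⟨V, hxV, hV, f, hf, hspan⟩ := hg.exists_le (x := x) (O := (g ≫ i) ⁻¹ᵁ c.U) hxc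
  have h0 := hF.appLE_eq_zero g hV
  have h1 := Scheme.IdealSheafData.ideal_comap (g ≫ i) (relSingIdeal q i)
    ⟨c.U, c.isAffineOpen_U⟩ V hV
  rw [Chart.relSingIdeal_ideal] at h1
  have h2 := (hF.map_singIdeal _ h0).symm.trans (h1.symm.trans hspan)
  obtain ⟨t₀, a, haP, ha⟩ := Ideal.exists_eq_mul_of_span_range_eq hf h2
    (V.2.primeIdealOf ⟨x, hxV⟩).asIdeal
  rw [V.2.mem_primeIdealOf_iff, not_not] at haP
  obtain ⟨V', hle, hxV', hunit, hnzd⟩ := IsAffineOpen.exists_isUnit_res V a haP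
  have hres (r) : (g ≫ i).appLE c.U V'.1 (hle.trans hV) r =
      T.presheaf.map (homOfLE hle).op ((g ≫ i).appLE c.U V.1 hV r) := by
    rw [← CategoryTheory.comp_apply, Scheme.Hom.appLE_map]
  have h3 : (g ≫ i).appLE c.U V'.1 (hle.trans hV) (c.deriv t₀ F) =
      T.presheaf.map (homOfLE hle).op a * T.presheaf.map (homOfLE hle).op f := by
    rw [hres, ← map_mul]
    exact congrArg _ ha
  refine ⟨V', c, F, hle.trans hV, t₀, hxV', hF, hF.appLE_eq_zero g _, ?_, fun t => ?_⟩
  · rw [h3]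
    exact mul_mem hunit.mem_nonZeroDivisors (hnzd f hf)
  · rw [h3, hunit.mul_left_dvd, hres]
    refine map_dvd (T.presheaf.map (homOfLE hle).op).hom ?_
    rw [← Ideal.mem_span_singleton, ← h2]
    exact Ideal.subset_span ⟨t, rfl⟩

end RelConormal

end

noncomputable section

namespace RelConormal

open SymProj

variable {W S X : Scheme.{u}} {q : W ⟶ S} {i : X ⟶ W}
variable [Smooth q]

instance : IsClosedImmersion (projConormal.ι q i) :=
  inferInstanceAs (IsClosedImmersion (projConormalIdeal q i).subschemeι)

theorem projConormal.ker_ι : (projConormal.ι q i).ker = projConormalIdeal q i :=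
  Scheme.IdealSheafData.ker_subschemeι _

theorem projConormalIdeal_le_ker_comp {T : Scheme.{u}} (h : T ⟶ projConormal q i) :
    projConormalIdeal q i ≤ (h ≫ projConormal.ι q i).ker :=
  projConormal.ker_ι.ge.trans (Scheme.Hom.le_ker_comp _ _)

variable [IsIntegral X] [IsClosedImmersion i] [IsIntegral W]
  [CompactSpace W] [QuasiSeparatedSpace W]

theorem _root_.AlgebraicGeometry.Scheme.hom_ext_of_fromSpec {T Y : Scheme.{u}} {f g : T ⟶ Y}
    (h : ∀ x : T, ∃ V : T.affineOpens, x ∈ V.1 ∧ V.2.fromSpec ≫ f = V.2.fromSpec ≫ g) : f = g := by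
  refine Scheme.hom_ext_of_forall f g fun x => ?_
  obtain ⟨V, hx, hV⟩ := h x
  refine ⟨V.1, hx, ?_⟩
  rw [← V.2.isoSpec_hom_fromSpec, Category.assoc, Category.assoc, hV]

theorem IsHypersurface.lift_unique (H : IsHypersurface q i) {T : Scheme.{u}} (g : T ⟶ X)
    (hg : IsInvertibleIdeal ((relSingIdeal q i).comap (g ≫ i))) {h h' : T ⟶ projConormal q i}
    (e : h ≫ projConormal.ι q i ≫ projCotangentBundle.proj q = g ≫ i)
    (e' : h' ≫ projConormal.ι q i ≫ projCotangentBundle.proj q = g ≫ i) : h = h' := by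
  refine Scheme.hom_ext_of_fromSpec fun x => ?_
  obtain ⟨V, c, F, hV, t₀, hxV, hF, hψ⟩ := H.exists_isAdapted g hg x
  refine ⟨V, hxV, ?_⟩
  have hs := c.isAffineOpen_U.SpecMap_appLE_fromSpec (g ≫ i) V.2 hV
  have key {h : T ⟶ projConormal q i}
      (e : h ≫ projConormal.ι q i ≫ projCotangentBundle.proj q = g ≫ i) :
      ((V.2.fromSpec ≫ h) ≫ projConormal.ι q i) ≫ projCotangentBundle.proj q =
        Spec.map ((g ≫ i).appLE c.U V.1 hV) ≫ c.isAffineOpen_U.fromSpec := by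
    simp only [Category.assoc]
    exact (congrArg (V.2.fromSpec ≫ ·) e).trans hs.symm
  exact (cancel_mono (projConormal.ι q i)).mp (H.lift_unique_of_isAdapted hF hψ
    (projConormalIdeal_le_ker_comp _) (projConormalIdeal_le_ker_comp _) (key e) (key e'))

theorem IsHypersurface.exists_local_lift (H : IsHypersurface q i) {T : Scheme.{u}} (g : T ⟶ X)
    (hg : IsInvertibleIdeal ((relSingIdeal q i).comap (g ≫ i))) (x : T) :
    ∃ (V : T.affineOpens) (h : Spec Γ(T, V.1) ⟶ projConormal q i), x ∈ V.1 ∧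
      h ≫ projConormal.ι q i ≫ projCotangentBundle.proj q = V.2.fromSpec ≫ g ≫ i := by
  obtain ⟨V, c, F, hV, t₀, hxV, hF, hψ⟩ := H.exists_isAdapted g hg x
  have : Nonempty V.1 := ⟨⟨x, hxV⟩⟩
  have hs := c.isAffineOpen_U.SpecMap_appLE_fromSpec (g ≫ i) V.2 hV
  obtain ⟨γ, hγ, hproj⟩ := H.exists_lift_of_isAdapted hF hψ
  refine ⟨V, IsClosedImmersion.lift (projConormal.ι q i) γ (projConormal.ker_ι.le.trans hγ), hxV, ?_⟩
  rw [← Category.assoc, IsClosedImmersion.lift_fac]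
  exact hproj.trans hs

theorem IsHypersurface.exists_lift (H : IsHypersurface q i) {T : Scheme.{u}} (g : T ⟶ X)
    (hg : IsInvertibleIdeal ((relSingIdeal q i).comap (g ≫ i))) :
    ∃ h : T ⟶ projConormal q i,
      h ≫ projConormal.ι q i ≫ projCotangentBundle.proj q = g ≫ i := by
  choose V h hx hh using H.exists_local_lift g hg
  let 𝒰 : T.OpenCover :=
    { I₀ := T
      X x := Spec Γ(T, (V x).1)
      f x := (V x).2.fromSpec
      mem₀ := by
        rw [Scheme.presieve₀_mem_precoverage_iff]
        refine ⟨fun x => ⟨x, (V x).2.range_fromSpec.ge (hx x)⟩,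
          fun x => (V x).2.isOpenImmersion_fromSpec⟩ }
  have (x : T) : IsOpenImmersion (𝒰.f x) := (V x).2.isOpenImmersion_fromSpec
  have hcompat (x y : T) : pullback.fst (𝒰.f x) (𝒰.f y) ≫ h x = pullback.snd (𝒰.f x) (𝒰.f y) ≫ h y := by
    refine H.lift_unique ((pullback.fst (𝒰.f x) (𝒰.f y) ≫ 𝒰.f x) ≫ g) ?_ ?_ ?_
    · rw [Category.assoc, Scheme.IdealSheafData.comap_comp]
      exact hg.comap_of_isOpenImmersion _
    · rw [Category.assoc, hh]
      simp only [Category.assoc]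
      rfl
    · rw [Category.assoc, hh, pullback.condition]
      simp only [Category.assoc]
      rfl
  refine ⟨𝒰.glueMorphisms h hcompat, ?_⟩
  refine Scheme.Cover.hom_ext 𝒰 _ _ fun x => ?_
  rw [Scheme.Cover.ι_glueMorphisms_assoc]
  exact hh x

end RelConormal

end

noncomputable section

theorem AlgebraicGeometry.IsAffineOpen.fromSpec_eq {X : Scheme.{u}} {U : X.Opens}
    (hU : IsAffineOpen U) {x : X} (hx : x ∈ U) {y : Spec Γ(X, U)}
    (h : ∀ f, f ∈ y.asIdeal ↔ x ∉ X.basicOpen f) : hU.fromSpec y = x := by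
  refine (congrArg hU.fromSpec ?_).trans (hU.fromSpec_primeIdealOf ⟨x, hx⟩)
  apply PrimeSpectrum.ext
  ext f
  rw [h, hU.mem_primeIdealOf_iff]

namespace RelConormal

open SymProj

theorem SymProj.mk_zero_eq_toAway {A T : Type u} [CommRing A] [AddCommGroup T] [Module A T]
    {s : SymmetricAlgebra A T} (hs : s ∈ grading A T 1) (a : A)
    (h : algebraMap A _ a ∈ grading A T (0 • 1)) :
    Away.mk (grading A T) hs 0 (algebraMap A _ a) h = toAway T s a := by
  ext
  rw [Away.val_mk]
  simp only [pow_zero]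
  rfl

variable {W S X : Scheme.{u}} {q : W ⟶ S} {i : X ⟶ W} [Smooth q]

theorem projConormal.isReduced : IsReduced (projConormal q i) :=
  Scheme.IdealSheafData.isReduced_subscheme_vanishingIdeal _

variable [IsIntegral X]
  [IsClosedImmersion i] [IsIntegral W] {c : Chart q} {F : Γ(W, c.U)}

theorem Chart.IsEquation.proj_chart_point (hF : c.IsEquation i F)
    (hsm : genericPoint X ∈ smoothLocus (i ≫ q)) :
    projCotangentBundle.proj q (projCotangentBundle.chart q c (hF.point hsm)) =
      i (genericPoint X) := by
  obtain ⟨t, ht⟩ := hF.exists_deriv_notMem hsm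
  obtain ⟨y, hy, hy'⟩ := projCotangentBundle.exists_piece_eq q c t (hF.point hsm)
    fun h => ht ((ι_mem_coneIdeal (c.derivMap F) (c.equations i) t).mp h)
  refine (congrArg (projCotangentBundle.proj q) hy.symm).trans
    ((congr($(projCotangentBundle.piece_proj q c t) y)).trans ?_)
  refine c.isAffineOpen_U.fromSpec_eq hF.mem fun f => ?_
  have h0 : algebraMap Γ(W, c.U) (SymmetricAlgebra Γ(W, c.U) c.Tangent) f ∈ c.symGrading (0 • 1) := by
    rw [zero_smul]
    exact SetLike.algebraMap_mem_graded (grading Γ(W, c.U) c.Tangent) f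
  have h1 : toAway c.Tangent _ f ∈ y.asIdeal ↔ _ :=
    iff_of_eq (congrArg (· ∈ y.asIdeal) (mk_zero_eq_toAway (ι_mem t) f h0).symm)
  exact h1.trans ((hy' 0 _ h0).trans ((algebraMap_mem_coneIdeal (c.derivMap F) (c.equations i) f).trans
    (c.mem_equations_iff f)))

theorem IsHypersurface.isIntegral (H : IsHypersurface q i) : IsIntegral (projConormal q i) := by
  obtain ⟨c, F, -, hF⟩ := H.exists_isEquation (genericPoint X)
  exact (congrArg (fun J : (projCotangentBundle q).IdealSheafData => IsIntegral J.subscheme)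
    (H.projConormalIdeal_eq hF)).mpr
      (Scheme.IdealSheafData.isIntegral_subscheme_vanishingIdeal_closure _)

theorem IsHypersurface.range_ι (H : IsHypersurface q i) (hF : c.IsEquation i F) :
    Set.range (projConormal.ι q i) =
      closure {projCotangentBundle.chart q c (hF.point H.smooth)} :=
  (Scheme.IdealSheafData.range_subschemeι _).trans
    (congrArg (fun J : (projCotangentBundle q).IdealSheafData => (J.support : Set (projCotangentBundle q)))
      (H.projConormalIdeal_eq hF))

/-- The projection of `ℙΛ_{X/S}` to `W` factors through `X`. -/
theorem IsHypersurface.exists_comp_eq (H : IsHypersurface q i) :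
    ∃ p : projConormal q i ⟶ X, p ≫ i = projConormal.ι q i ≫ projCotangentBundle.proj q := by
  have := projConormal.isReduced (q := q) (i := i)
  obtain ⟨c, F, -, hF⟩ := H.exists_isEquation (genericPoint X)
  have h : i.ker ≤ (projConormal.ι q i ≫ projCotangentBundle.proj q).ker := by
    refine Scheme.IdealSheafData.le_ker_of_isReduced _ _ ?_
    rw [Scheme.Hom.support_ker]
    rintro _ ⟨z, rfl⟩
    have h1 := (H.range_ι hF).le ⟨z, rfl⟩
    have h2 := (specializes_iff_mem_closure.mpr h1).map (projCotangentBundle.proj q).continuous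
    have h3 := hF.proj_chart_point H.smooth
    refine specializes_iff_mem_closure.mp h2 |> closure_mono ?_
    rintro _ rfl
    exact ⟨_, h3.symm⟩
  exact ⟨IsClosedImmersion.lift i _ h, IsClosedImmersion.lift_fac _ _ _⟩

variable [CompactSpace W] [QuasiSeparatedSpace W]

theorem IsHypersurface.isInvertibleIdeal (H : IsHypersurface q i) {p : projConormal q i ⟶ X}
    (hp : p ≫ i = projConormal.ι q i ≫ projCotangentBundle.proj q) :
    IsInvertibleIdeal ((relSingIdeal q i).comap (p ≫ i)) := by
  intro z
  have := H.isIntegral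
  obtain ⟨c, F, hzc, hF⟩ := H.exists_isEquation (p z)
  have hzc' : projCotangentBundle.proj q (projConormal.ι q i z) ∈ c.U :=
    Set.mem_of_eq_of_mem congr($hp z).symm hzc
  obtain ⟨t, ht⟩ := projCotangentBundle.exists_mem_opensRange_piece q c hzc'
  have hι : projConormalIdeal q i ≤ (projConormal.ι q i).ker := projConormal.ker_ι.ge
  have htF := H.deriv_notMem hF hι ht
  obtain ⟨_, ⟨V, hVa, rfl⟩, hzV, hVO⟩ :=
    (projConormal q i).isBasis_affineOpens.exists_subset_of_mem_open
      (show z ∈ ((projConormal.ι q i ⁻¹ᵁ (projCotangentBundle.piece q c t).opensRange ⊓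
        (p ≫ i) ⁻¹ᵁ c.U : (projConormal q i).Opens) : Set (projConormal q i)) from ⟨ht, hzc⟩)
      (projConormal.ι q i ⁻¹ᵁ (projCotangentBundle.piece q c t).opensRange ⊓ (p ≫ i) ⁻¹ᵁ c.U).2
  have hV : V ≤ (p ≫ i) ⁻¹ᵁ c.U := fun x hx => (hVO hx).2
  have hV' : V ≤ projConormal.ι q i ⁻¹ᵁ (projCotangentBundle.piece q c t).opensRange :=
    fun x hx => (hVO hx).1
  obtain ⟨φ, hφ⟩ := IsOpenImmersion.exists_specMap_comp_eq (projCotangentBundle.piece q c t)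
    (hVa.fromSpec ≫ projConormal.ι q i) (Set.range_subset_iff.mpr fun y =>
      hV' (hVa.range_fromSpec.le ⟨y, rfl⟩))
  have hker : projConormalIdeal q i ≤ (Spec.map φ ≫ projCotangentBundle.piece q c t).ker := by
    rw [hφ]
    exact projConormalIdeal_le_ker_comp _
  have hs := c.isAffineOpen_U.SpecMap_appLE_fromSpec (p ≫ i) hVa hV
  have hcomp (a) : φ (toAway c.Tangent _ a) = (p ≫ i).appLE c.U V hV a := by
    refine toAway_comp ?_ a
    rw [hφ, hs, hp, Category.assoc]
  have hmul (t') : (p ≫ i).appLE c.U V hV (c.deriv t' F) =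
      φ (frac (ι_mem t) t') * (p ≫ i).appLE c.U V hV (c.deriv t F) :=
    (hcomp _).symm.trans ((H.map_deriv hF htF φ hker t').trans (congrArg _ (hcomp _)))
  have : Nonempty V := ⟨⟨z, hzV⟩⟩
  refine ⟨⟨V, hVa⟩, hzV, (p ≫ i).appLE c.U V hV (c.deriv t F), ?_, ?_⟩
  · refine mem_nonZeroDivisors_of_ne_zero fun h0 => ?_
    obtain ⟨z₀, hz₀⟩ := (H.range_ι hF).ge (subset_closure rfl)
    have hsp : z₀ ⤳ z := by
      refine (projConormal.ι q i).isClosedEmbedding.isInducing.specializes_iff.mp ?_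
      rw [hz₀]
      exact specializes_iff_mem_closure.mpr ((H.range_ι hF).le ⟨z, rfl⟩)
    have h1 : z₀ ∈ (projConormal q i).basicOpen ((p ≫ i).appLE c.U V hV (c.deriv t F)) := by
      rw [Scheme.basicOpen_appLE]
      refine ⟨hsp.mem_open V.2 hzV, ?_⟩
      have h2 : (p ≫ i) z₀ = i (genericPoint X) :=
        congr($hp z₀).trans ((congrArg (projCotangentBundle.proj q) hz₀).trans
          (hF.proj_chart_point H.smooth))
      have h3 : i (genericPoint X) ∈ W.basicOpen (c.deriv t F) := (c.mem_basicOpen_iff _).mpr htF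
      exact Set.mem_of_eq_of_mem (s := (W.basicOpen (c.deriv t F) : Set W)) h2 h3
    rw [h0, Scheme.basicOpen_zero] at h1
    exact h1
  · refine (Scheme.IdealSheafData.ideal_comap (p ≫ i) (relSingIdeal q i)
      ⟨c.U, c.isAffineOpen_U⟩ ⟨V, hVa⟩ hV).trans ?_
    rw [Chart.relSingIdeal_ideal]
    refine (hF.map_singIdeal _ (hF.appLE_eq_zero p hV)).trans (le_antisymm ?_ ?_)
    · rw [Ideal.span_le]
      rintro _ ⟨t', rfl⟩
      exact Ideal.mem_span_singleton'.mpr ⟨_, (hmul t').symm⟩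
    · rw [Ideal.span_singleton_le_iff_mem]
      exact Ideal.subset_span ⟨t, rfl⟩

/-- The projectivised conormal variety of a hypersurface is the blowup of its singular scheme. -/
theorem IsHypersurface.exists_isBlowup (H : IsHypersurface q i) :
    ∃ p : projConormal q i ⟶ X,
      p ≫ i = projConormal.ι q i ≫ projCotangentBundle.proj q ∧
      IsBlowup p ((relSingIdeal q i).comap i) := by
  obtain ⟨p, hp⟩ := H.exists_comp_eq
  refine ⟨p, hp, ?_, fun T g hg => ?_⟩
  · rw [← Scheme.IdealSheafData.comap_comp]
    exact H.isInvertibleIdeal hp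
  · rw [← Scheme.IdealSheafData.comap_comp] at hg
    have hiff (h : T ⟶ projConormal q i) : h ≫ p = g ↔
        h ≫ projConormal.ι q i ≫ projCotangentBundle.proj q = g ≫ i := by
      rw [← hp, ← Category.assoc, cancel_mono]
    obtain ⟨h, hh⟩ := H.exists_lift g hg
    exact ⟨h, (hiff h).mpr hh, fun h' hh' => H.lift_unique g hg ((hiff h').mp hh') hh⟩

end RelConormal

end

namespace RelConormal

theorem isHypersurface_of_coheight_eq_one {S W X : Scheme.{0}} (s : S ⟶ Spec (.of ℂ)) [Smooth s]
    (q : W ⟶ S) (i : X ⟶ W) [IsIntegral W] [CompactSpace W] [Smooth q] [IsIntegral X]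
    [IsClosedImmersion i] [Flat (i ≫ q)] (hcodim : Order.coheight (i (genericPoint X)) = 1) :
    IsHypersurface q i where
  smooth := by
    have : IsLocallyNoetherian S := LocallyOfFiniteType.isLocallyNoetherian s
    have : LocallyOfFinitePresentation (i ≫ q) :=
      LocallyOfFinitePresentation.iff_locallyOfFiniteType.mpr inferInstance
    exact genericPoint_mem_smoothLocus s (i ≫ q)
  exists_isEquation x := by
    obtain ⟨c, hxc, F, hF0, hF⟩ := Chart.exists_equations_eq_span q (q ≫ s) i hcodim x
    exact ⟨c, F, hxc, hF, hF0, Chart.genericPoint_mem c.U hxc⟩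

end RelConormal

theorem mainTheorem11 {S W X : Scheme.{0}} (s : S ⟶ Spec (.of ℂ)) (q : W ⟶ S) (i : X ⟶ W)
    [IsIntegral S] [IsSeparated s] [QuasiCompact s]
    (hS : IsIso s ∨ SmoothOfRelativeDimension 1 s)
    [IsIntegral W] [IsSeparated q] [QuasiCompact q] [Smooth q] [IsDominant q]
    [IsIntegral X] [IsClosedImmersion i] [Flat (i ≫ q)]
    (hcodim : Order.coheight (i (genericPoint X)) = 1) :
    ∃ p : RelConormal.projConormal q i ⟶ X,
      p ≫ i = RelConormal.projConormal.ι q i ≫ RelConormal.projCotangentBundle.proj q ∧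
      RelConormal.IsBlowup p ((RelConormal.relSingIdeal q i).comap i) := by
  have : Smooth s := by
    rcases hS with h | h
    · infer_instance
    · exact h.smooth
  have : CompactSpace W := QuasiCompact.compactSpace_of_compactSpace (q ≫ s)
  have : QuasiSeparatedSpace W := quasiSeparatedSpace_of_quasiSeparated (q ≫ s)
  exact (RelConormal.isHypersurface_of_coheight_eq_one s q i hcodim).exists_isBlowup
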